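/- **Conventions.** A *descent category* is a category $\mathcal V$ with finite limits together with a (wide) subcategory of *covers* such that pullbacks of covers are covers, and if $f$ and $gf$ are covers then $g$ is a cover. The *coimage* of a morphism $f:A\to B$ is the coequalizer $p:A\to Z$ (if it exists) of the kernel pair $A\times_BA\rightrightarrows A$; the induced morphism $i:Z\to B$ with $ip=f$ is the *image* of $f$. A *regular descent category* is a descent category in which every cover is an effective epimorphism (is its own coimage), together with a subcategory of *regular* morphisms such that every cover is regular, pullbacks of regular morphisms are regular, and every regular morphism has a coimage, which is a cover. For a simplicial set $T$ and a simplicial object $X$ of $\mathcal V$, $\mathrm{Map}(T,X)$ denotes the object of $\mathcal V$ (if it exists) representing the functor $U\mapsto \mathrm{Hom}_{\mathrm{sSet}}(T,\mathcal V(U,X_\bullet))$; thus $\mathrm{Map}(\Delta^n,X)\cong X_n$. Write $\Lambda^n_i$ and $\partial\Delta^n$ for the horns and boundary of $\Delta^n$, and let the *thick $n$-simplex* $\mathbf\Delta^n$ be the simplicial set whose $m$-simplices are all functions $\{0,\dots,m\}\to\{0,\dots,n\}$; it contains $\Delta^n$. Let $k\ge 1$. * $X$ is a *$k$-groupoid*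 if for all $n>0$, $0\le i\le n$, the morphism $X_n\to\mathrm{Map}(\Lambda^n_i,X)$ is a cover, and is an isomorphism when $n>k$. * $X$ is a *$k$-category* if for all $0<i<n$ the morphism $X_n\to\mathrm{Map}(\Lambda^n_i,X)$ is a cover, and an isomorphism when $n>k$, and if for $i\in\{0,1\}$ the morphism $\mathrm{Map}(\mathbf\Delta^1,X)\to\mathrm{Map}(\Lambda^1_i,X)\cong X_0$ is a cover. It is *regular* if moreover $\mathrm{Map}(\mathbf\Delta^1,X)\to X_1$ is regular. * A morphism $f:X\to Y$ of simplicial objects is a *hypercover* if for all $n\ge0$ the morphism $X_n\to\mathrm{Map}(\partial\Delta^n,X)\times_{\mathrm{Map}(\partial\Delta^n,Y)}Y_n$ is a cover. **Theorem.** Let $k\ge1$ and let $X$ be a regular $k$-category in a regular descent category $\mathcal V$. Then the objects $\mathbb G(X)_n=\mathrm{Map}(\mathbf\Delta^n,X)$ exist and form a simplicial object $\mathbb G(X)$ of $\mathcal V$. For every $n\ge0$ the restriction morphism $\mathbb G(X)_n\to\mathrm{Map}(\Delta^n,X)\cong X_n$ is regular. Let $\mathcal G(X)_n$ be its image (the codomain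 of its coimage). The objects $\mathcal G(X)_n$ form a simplicial object $\mathcal G(X)$ with simplicial morphisms $\mathbb G(X)\to\mathcal G(X)\to X$ given in degree $n$ by the coimage and the image. Moreover $\mathcal G(X)$ is a $k$-groupoid, and the morphism $\mathbb G(X)\to\mathcal G(X)$ is a hypercover. -/

import Mathlib

open CategoryTheory CategoryTheory.Limits Opposite Simplicial

universe v u

namespace DescentCat

variable {C : Type u} [Category.{v} C]

/-! ### Descent categories -/

/-- A descent category: a category with finite limits and a (wide) subcategory of covers, stable
under pullback, such that `g` is a cover as soon as `f` and `g ∘ f` are covers. -/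
structure IsDescentCategory (cover : MorphismProperty C) : Prop where
  hasFiniteLimits : HasFiniteLimits C
  multiplicative : cover.IsMultiplicative
  stableUnderBaseChange : cover.IsStableUnderBaseChange
  cancel : ∀ {A B D : C} (f : A ⟶ B) (g : B ⟶ D), cover f → cover (f ≫ g) → cover g

/-- `p : A ⟶ Z` is a coimage of `f : A ⟶ B`: it is a coequalizer of the kernel pair
`A ×_B A ⇉ A` of `f`. -/
def IsCoimage {A B Z : C} (f : A ⟶ B) (p : A ⟶ Z) : Prop :=
  ∃ (R : C) (a b : R ⟶ A), IsKernelPair f a b ∧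
    ∃ w : a ≫ p = b ≫ p, Nonempty (IsColimit (Cofork.ofπ p w))

/-- `f` is an effective epimorphism: it is its own coimage. -/
def IsEffectiveEpi {A B : C} (f : A ⟶ B) : Prop := IsCoimage f f

/-- `i : Z ⟶ B` is the image of `f : A ⟶ B`, where `p : A ⟶ Z` is the coimage of `f`. -/
def IsImageFactorization {A B Z : C} (f : A ⟶ B) (p : A ⟶ Z) (i : Z ⟶ B) : Prop :=
  IsCoimage f p ∧ p ≫ i = f

/-- A regular descent category: a descent category in which every cover is an effective
epimorphism, with a subcategory of regular morphisms containing the covers and stable under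
pullback, such that each regular morphism has a coimage, which is a cover. -/
structure IsRegularDescentCategory (cover regular : MorphismProperty C) : Prop
    extends IsDescentCategory cover where
  subcanonical : ∀ {A B : C} (f : A ⟶ B), cover f → IsEffectiveEpi f
  regular_multiplicative : regular.IsMultiplicative
  cover_le_regular : cover ≤ regular
  regular_stableUnderBaseChange : regular.IsStableUnderBaseChange
  exists_coimage : ∀ {A B : C} (f : A ⟶ B), regular f →
    ∃ (Z : C) (p : A ⟶ Z), IsCoimage f p ∧ cover p

/-! ### Mapping spaces `Map(T, X)`

They are treated through their functors of points; a space of maps exists in `C` when this presheaf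
is representable. -/

/-- The simplicial set `Hom(U, X_•)` of `U`-valued points of a simplicial object `X`. -/
abbrev points (X : SimplicialObject C) (U : Cᵒᵖ) : SSet.{v} :=
  ((SimplicialObject.whiskering C (Type v)).obj (coyoneda.obj U)).obj X

/-- The functor of points of `Map(T, X)`: its `U`-valued points are the simplicial maps
from `T` to `Hom(U, X_•)`. -/
def mapSpace (T : SSet.{v}) (X : SimplicialObject C) : Cᵒᵖ ⥤ Type v where
  obj U := T ⟶ points X U
  map g := TypeCat.ofHom fun t => t ≫ ((SimplicialObject.whiskering C (Type v)).map (coyoneda.map g)).app X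

/-- Restriction `Map(T, X) ⟶ Map(S, X)` along `j : S ⟶ T`. -/
def mapRestrict {S T : SSet.{v}} (j : S ⟶ T) (X : SimplicialObject C) :
    mapSpace T X ⟶ mapSpace S X where
  app _ := TypeCat.ofHom fun t => j ≫ t

/-- The morphism `Map(T, X) ⟶ Map(T, Y)` induced by `f : X ⟶ Y`. -/
def mapPush (T : SSet.{v}) {X Y : SimplicialObject C} (f : X ⟶ Y) :
    mapSpace T X ⟶ mapSpace T Y where
  app U := TypeCat.ofHom fun t =>
    t ≫ ((SimplicialObject.whiskering C (Type v)).obj (coyoneda.obj U)).map f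
  naturality U V g := by
    refine ConcreteCategory.hom_ext _ _ fun (t : T ⟶ points X U) => ?_
    change (t ≫ ((SimplicialObject.whiskering C (Type v)).map (coyoneda.map g)).app X) ≫
        ((SimplicialObject.whiskering C (Type v)).obj (coyoneda.obj V)).map f =
      (t ≫ ((SimplicialObject.whiskering C (Type v)).obj (coyoneda.obj U)).map f) ≫
        ((SimplicialObject.whiskering C (Type v)).map (coyoneda.map g)).app Y
    rw [Category.assoc, Category.assoc]
    exact congrArg (t ≫ ·)
      (((SimplicialObject.whiskering C (Type v)).map (coyoneda.map g)).naturality f).symm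

/-- `Map(T, X) ⟶ Map(S ↪ T, f) = Map(S, X) ×_{Map(S, Y)} Map(T, Y)`. -/
noncomputable def relMap {S T : SSet.{v}} (j : S ⟶ T) {X Y : SimplicialObject C} (f : X ⟶ Y) :
    mapSpace T X ⟶ pullback (mapPush S f) (mapRestrict j Y) :=
  pullback.lift (mapRestrict j X) (mapPush T f) (by
    ext U t
    exact Category.assoc _ _ _)

/-- A morphism of presheaves is represented by a morphism of `C` having property `P`
(in particular its source and target are representable). -/
def RepresentedBy (P : MorphismProperty C) {F G : Cᵒᵖ ⥤ Type v} (φ : F ⟶ G) : Prop :=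
  ∃ (A B : C) (a : yoneda.obj A ≅ F) (b : yoneda.obj B ≅ G) (f : A ⟶ B),
    P f ∧ a.hom ≫ φ = yoneda.map f ≫ b.hom

/-! ### Groupoids and hypercovers -/

/-- `k`-groupoids: `X_n ≅ Map(Δ^n, X) ⟶ Map(Λ^n_i, X)` is a cover for `n > 0`, `0 ≤ i ≤ n`, and
an isomorphism if moreover `n > k`. -/
structure IsKGroupoid (cover : MorphismProperty C) (k : ℕ) (X : SimplicialObject C) : Prop where
  cover_horn : ∀ (n : ℕ) (i : Fin (n + 1)), 0 < n →
    RepresentedBy cover (mapRestrict (SSet.horn.{v} n i).ι X)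
  iso_horn : ∀ (n : ℕ) (i : Fin (n + 1)), 0 < n → k < n →
    IsIso (mapRestrict (SSet.horn.{v} n i).ι X)

/-- Hypercovers: `X_n ≅ Map(Δ^n, X) ⟶ Map(∂Δ^n, X) ×_{Map(∂Δ^n, Y)} Y_n` is a cover for
all `n ≥ 0`. -/
def IsHypercover (cover : MorphismProperty C) {X Y : SimplicialObject C} (f : X ⟶ Y) : Prop :=
  ∀ n : ℕ, RepresentedBy cover (relMap (SSet.boundary.{v} n).ι f)

/-! ### Thick simplices -/

/-- The thick simplices: the `m`-simplices of the thick `n`-simplex are all functions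
`{0, …, m} → {0, …, n}`. -/
def thick : SimplexCategory ⥤ SSet.{v} where
  obj n :=
    { obj := fun m => ULift.{v} (Fin (m.unop.len + 1) → Fin (n.len + 1))
      map := fun φ => TypeCat.ofHom fun s => ⟨s.down ∘ φ.unop.toOrderHom⟩ }
  map ψ :=
    { app := fun _ => TypeCat.ofHom fun s => ⟨ψ.toOrderHom ∘ s.down⟩ }

/-- The inclusion of the standard `n`-simplex into the thick `n`-simplex, sending a monotone
function to its underlying function. -/
def toThick : SSet.stdSimplex.{v} ⟶ thick.{v} where
  app _ :=
    { app := fun _ => TypeCat.ofHom fun s => ⟨(SSet.stdSimplex.objEquiv s).toOrderHom⟩ }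

/-! ### Categories -/

/-- `k`-categories: `X_n ≅ Map(Δ^n, X) ⟶ Map(Λ^n_i, X)` is a cover for `0 < i < n`, and an
isomorphism if moreover `n > k`; and for the thick `1`-simplex `Δ'^1` and `i ∈ {0, 1}`,
`Map(Δ'^1, X) ⟶ Map(Λ^1_i, X) ≅ X_0` is a cover. -/
structure IsKCategory (cover : MorphismProperty C) (k : ℕ) (X : SimplicialObject C) : Prop where
  cover_horn : ∀ (n : ℕ) (i : Fin (n + 1)), 0 < i → i < Fin.last n →
    RepresentedBy cover (mapRestrict (SSet.horn.{v} n i).ι X)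
  iso_horn : ∀ (n : ℕ) (i : Fin (n + 1)), 0 < i → i < Fin.last n → k < n →
    IsIso (mapRestrict (SSet.horn.{v} n i).ι X)
  cover_vertex : ∀ i : Fin 2,
    RepresentedBy cover (mapRestrict ((SSet.horn.{v} 1 i).ι ≫ toThick.app ⦋1⦌) X)

/-- Regular `k`-categories: moreover `Map(Δ'^1, X) ⟶ Map(Δ^1, X) ≅ X_1` is regular. -/
structure IsRegularKCategory (cover regular : MorphismProperty C) (k : ℕ)
    (X : SimplicialObject C) : Prop extends IsKCategory cover k X where
  regular_thick : RepresentedBy regular (mapRestrict (toThick.{v}.app ⦋1⦌) X)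

/-! ### The simplicial space of maps from thick simplices -/

/-- The simplicial presheaf `[n] ↦ Map(Δ'^n, X)`, where `Δ'^n` is the thick `n`-simplex. -/
def thickMap (X : SimplicialObject C) : SimplicialObject (Cᵒᵖ ⥤ Type v) where
  obj n := mapSpace (thick.obj n.unop) X
  map φ := mapRestrict (thick.map φ.unop) X
  map_id n := by
    ext U (t : thick.obj _ ⟶ points X U)
    change thick.map (𝟙 n.unop) ≫ t = t
    rw [thick.map_id, Category.id_comp]
  map_comp φ ψ := by
    ext U (t : thick.obj _ ⟶ points X U)
    change thick.map (ψ.unop ≫ φ.unop) ≫ t = thick.map ψ.unop ≫ thick.map φ.unop ≫ t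
    rw [thick.map_comp, Category.assoc]

/-- A simplicial object `K` together with isomorphisms `K_n ≅ Map(Δ'^n, X)`, natural in `n`. -/
abbrev ThickMapRepr (X K : SimplicialObject C) : Type (max u v) :=
  ((SimplicialObject.whiskering C (Cᵒᵖ ⥤ Type v)).obj yoneda).obj K ≅ thickMap X

/-- The universal map `Δ'^n ⟶ Hom(K_n, X_•)` of `K_n ≅ Map(Δ'^n, X)`. -/
def ThickMapRepr.univ {X K : SimplicialObject C} (e : ThickMapRepr X K)
    (n : SimplexCategoryᵒᵖ) : thick.obj n.unop ⟶ points X (op (K.obj n)) :=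
  ((e.hom.app n).app (op (K.obj n)) : (K.obj n ⟶ K.obj n) → _) (𝟙 (K.obj n))

/-- The simplicial map `K ⟶ X` given by the restrictions `K_n ≅ Map(Δ'^n, X) ⟶ Map(Δ^n, X) ≅ X_n`,
that is, by evaluating the universal map on the simplex `(0, …, n)` of `Δ'^n`. -/
def ThickMapRepr.toBase {X K : SimplicialObject C} (e : ThickMapRepr X K) : K ⟶ X where
  app n := ((e.univ n).app n : (thick.obj n.unop).obj n → (K.obj n ⟶ X.obj n)) ⟨id⟩
  naturality n m φ := by
    have h₁ : ((e.hom.app m).app (op (K.obj n)) : (K.obj n ⟶ K.obj m) → _) (𝟙 _ ≫ K.map φ) =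
        thick.map φ.unop ≫ e.univ n :=
      ConcreteCategory.congr_hom
        (NatTrans.congr_app (e.hom.naturality φ) (op (K.obj n))) (𝟙 (K.obj n))
    have h₂ : ((e.hom.app m).app (op (K.obj n)) : (K.obj n ⟶ K.obj m) → _) (K.map φ ≫ 𝟙 _) =
        e.univ m ≫ ((SimplicialObject.whiskering C (Type v)).map (coyoneda.map (K.map φ).op)).app X :=
      ConcreteCategory.congr_hom ((e.hom.app m).naturality (K.map φ).op) (𝟙 (K.obj m))
    rw [Category.id_comp] at h₁
    rw [Category.comp_id, h₁] at h₂
    have h₃ := ConcreteCategory.congr_hom (NatTrans.congr_app h₂ m)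
      (⟨id⟩ : ULift.{v} (Fin (m.unop.len + 1) → Fin (m.unop.len + 1)))
    have h₄ := ConcreteCategory.congr_hom ((e.univ n).naturality φ)
      (⟨id⟩ : ULift.{v} (Fin (n.unop.len + 1) → Fin (n.unop.len + 1)))
    exact h₃.symm.trans h₄

end DescentCat

open DescentCat

namespace DescentCat

variable {C : Type u} [Category.{v} C]

/-! ### Representable presheaves and relative properties -/

section Presheaf

/-! Call an inclusion `S ⊆ T` of simplicial sets an expansion for `X` if `Map(T, X) ⟶ Map(S, X)` is
a cover. Expansions are closed under composition and pushout, so inclusions built by filling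
finitely many inner horns are expansions. Infinitely many horns are allowed as long as all but
finitely many stages have dimension above `k`, where the fillings are unique. The work is to reach
thick simplices by such fillings.

A simplex of a thick simplex is a word in the letters `0, …, n`. Give one letter `c` the sign `0`
and the others nonzero signs; the turn of a word is the first place where the second nonzero sign
occurs. Inserting or deleting `c` immediately before the turn pairs up non-degenerate words, and the
longer word of a pair is attached along the horn at the inserted `c`. This horn is inner, since a
letter of the first sign comes before `c` and the turn comes after it (`Toggle`). Suitable signs
show that thick horns expand to thick simplices (`IsKCategory.expansion_thickHorn`). Together with
an induction that attaches a thick last edge, they also show that `Map(Δ'^n, X) ⟶ X_n` is regular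
(`IsRegularKCategory.expansion_toThick`).

Outer horns can be filled once their initial edge is thick: with the thick edge added, the horn and
the simplex both expand to the same complex of sorted words, and the cancellation axiom gives the
expansion between them (`IsRegularKCategory.expansion_outerHornSub`). Filling such outer horns along
words that start with `0`, in addition to toggles, expands the union of the thick boundary and the
standard simplex to the thick simplex for `n ≥ 2` (`IsRegularKCategory.expansion_ledSub`). This is
the hypercover condition in degrees `≥ 2` for the map from the thick mapping object `K` to `X`.

Factor this map as `p : K ⟶ G` followed by the degreewise monomorphism `G ⟶ X`. A cover that factors
through a monomorphism forces the monomorphism to be invertible, so `p` inherits the condition in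
degrees `≥ 2`; in degrees `0` and `1` it only says that `p` is a cover, because `K_0 ≅ X_0`
(`relMap_boundary_cover`). The horn conditions then pass from `K` to `G` by cancellation, and above
dimension `k` by the principle that a cover which is a monomorphism is an isomorphism. -/

lemma isPullback_presheaf_iff {F₁ F₂ F₃ F₄ : Cᵒᵖ ⥤ Type v} {t : F₁ ⟶ F₂} {l : F₁ ⟶ F₃}
    {r : F₂ ⟶ F₄} {b : F₃ ⟶ F₄} :
    IsPullback t l r b ↔ t ≫ r = l ≫ b ∧ ∀ U, (∀ x y : F₁.obj U, t.app U x = t.app U y →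
      l.app U x = l.app U y → x = y) ∧ ∀ (x : F₂.obj U) (y : F₃.obj U),
      r.app U x = b.app U y → ∃ z, t.app U z = x ∧ l.app U z = y := by
  constructor
  · intro h
    refine ⟨h.w, fun U => ?_⟩
    have := (Types.isPullback_iff _ _ _ _).1 (h.map ((evaluation _ _).obj U))
    exact ⟨fun x y h1 h2 => this.2.1 x y ⟨h1, h2⟩, this.2.2⟩
  · rintro ⟨w, h⟩
    refine ⟨⟨w⟩, ⟨evaluationJointlyReflectsLimits _ fun U => ?_⟩⟩
    refine (isLimitMapConePullbackConeEquiv _ _).symm (IsPullback.isLimit ?_)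
    exact (Types.isPullback_iff _ _ _ _).2
      ⟨NatTrans.congr_app w U, fun x y hxy => (h U).1 x y hxy.1 hxy.2, (h U).2⟩

lemma isIso_presheaf_iff {F G : Cᵒᵖ ⥤ Type v} (φ : F ⟶ G) :
    IsIso φ ↔ ∀ U, Function.Bijective (φ.app U) := by
  rw [NatTrans.isIso_iff_isIso_app]
  exact forall_congr' fun U => isIso_iff_bijective _

lemma isRepresentable_of_iso {F G : Cᵒᵖ ⥤ Type v} (e : F ≅ G) (hF : F.IsRepresentable) :
    G.IsRepresentable := isRepresentable_of_natIso F e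

lemma isRepresentable_of_isPullback [HasFiniteLimits C] {F₁ F₂ F₃ F₄ : Cᵒᵖ ⥤ Type v}
    {t : F₁ ⟶ F₂} {l : F₁ ⟶ F₃} {r : F₂ ⟶ F₄} {b : F₃ ⟶ F₄} (h : IsPullback t l r b)
    (h₂ : F₂.IsRepresentable) (h₃ : F₃.IsRepresentable) (h₄ : F₄.IsRepresentable) :
    F₁.IsRepresentable := by
  have h' := h.of_iso (Iso.refl _) F₂.reprW.symm F₃.reprW.symm F₄.reprW.symm
    (fst' := t ≫ F₂.reprW.inv) (snd' := l ≫ F₃.reprW.inv)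
    (f' := F₂.reprW.hom ≫ r ≫ F₄.reprW.inv) (g' := F₃.reprW.hom ≫ b ≫ F₄.reprW.inv)
    (by simp) (by simp) (by simp) (by simp)
  obtain ⟨f, hf⟩ := yoneda.map_surjective (F₂.reprW.hom ≫ r ≫ F₄.reprW.inv)
  obtain ⟨g, hg⟩ := yoneda.map_surjective (F₃.reprW.hom ≫ b ≫ F₄.reprW.inv)
  rw [← hf, ← hg] at h'
  exact isRepresentable_of_iso
    (((IsPullback.of_hasPullback f g).map yoneda).isoIsPullback _ _ h') inferInstance

variable {P : MorphismProperty C}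

lemma isRepresentable_of_presheaf {F G : Cᵒᵖ ⥤ Type v} {φ : F ⟶ G} (h : P.presheaf φ)
    (hG : G.IsRepresentable) : F.IsRepresentable := by
  have := (h.rep.isPullback G.reprW.hom).isIso_fst_of_isIso
  exact isRepresentable_of_iso (asIso (h.rep.fst G.reprW.hom)) inferInstance

/-- Separates the property of a morphism from the existence of its target. The property `P.presheaf`
inherits closure under composition and base change, so cell attachments can be handled before any
mapping space is known to be representable. -/
lemma representedBy_iff [HasFiniteLimits C] [P.IsStableUnderBaseChange] {F G : Cᵒᵖ ⥤ Type v}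
    {φ : F ⟶ G} : RepresentedBy P φ ↔ P.presheaf φ ∧ G.IsRepresentable := by
  constructor
  · rintro ⟨A, B, a, b, f, hf, w⟩
    refine ⟨?_, isRepresentable_of_iso b inferInstance⟩
    exact (P.presheaf.arrow_mk_iso_iff (Arrow.isoMk a b w)).1
      (MorphismProperty.relative_map hf)
  · rintro ⟨h, hG⟩
    have hF := isRepresentable_of_presheaf h hG
    obtain ⟨f, hf⟩ := yoneda.map_surjective (F.reprW.hom ≫ φ ≫ G.reprW.inv)
    have w : F.reprW.hom ≫ φ = yoneda.map f ≫ G.reprW.hom := by rw [hf]; simp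
    refine ⟨_, _, F.reprW, G.reprW, f, ?_, w⟩
    exact MorphismProperty.of_relative_map
      ((P.presheaf.arrow_mk_iso_iff (Arrow.isoMk F.reprW G.reprW w)).2 h)

end Presheaf

/-! ### Covers of representable presheaves: cancellation and monomorphisms. -/

section Covers

variable {cover : MorphismProperty C}

lemma IsCoimage.regularEpi {A B Z : C} {f : A ⟶ B} {p : A ⟶ Z} (h : IsCoimage f p) :
    IsRegularEpi p := by
  obtain ⟨R, a, b, -, w, ⟨hc⟩⟩ := h
  exact ⟨⟨{ W := R, left := a, right := b, w := w, isColimit := hc }⟩⟩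

variable (h : IsDescentCategory cover)
  (hs : ∀ {A B : C} (f : A ⟶ B), cover f → IsEffectiveEpi f)

include h in
lemma presheaf_cancel {F G H : Cᵒᵖ ⥤ Type v} (f : F ⟶ G) (g : G ⟶ H) (hf : cover.presheaf f)
    (hfg : cover.presheaf (f ≫ g)) (hG : G.IsRepresentable) (hH : H.IsRepresentable) :
    cover.presheaf g := by
  have := h.hasFiniteLimits
  have := h.stableUnderBaseChange
  obtain ⟨A, B, a, b, f', hf', w⟩ := representedBy_iff.2 ⟨hf, hG⟩
  obtain ⟨g', hg'⟩ := yoneda.map_surjective (b.hom ≫ g ≫ H.reprW.inv)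
  have w' : b.hom ≫ g = yoneda.map g' ≫ H.reprW.hom := by rw [hg']; simp
  have : cover (f' ≫ g') := by
    refine MorphismProperty.of_relative_map (F := yoneda)
      ((cover.presheaf.arrow_mk_iso_iff (Arrow.isoMk a H.reprW ?_)).2 hfg)
    simp [reassoc_of% w, w']
  exact (cover.presheaf.arrow_mk_iso_iff (Arrow.isoMk b H.reprW w')).1
    (MorphismProperty.relative_map (h.cancel _ _ hf' this))

include h hs in
-- A cover is a regular, hence strong, epimorphism. The last factor of a strong epimorphism is again
-- strong, and a strong epimorphism that is a monomorphism is invertible.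
lemma isIso_of_presheaf_comp_mono {F G H : Cᵒᵖ ⥤ Type v} (f : F ⟶ G) (g : G ⟶ H) [Mono g]
    (hfg : cover.presheaf (f ≫ g)) (hG : G.IsRepresentable) (hH : H.IsRepresentable) :
    IsIso g := by
  have := h.hasFiniteLimits
  have := h.stableUnderBaseChange
  obtain ⟨A, B, a, b, p, hp, w⟩ := representedBy_iff.2 ⟨hfg, hH⟩
  obtain ⟨g', hg'⟩ := yoneda.map_surjective (G.reprW.hom ≫ g ≫ b.inv)
  obtain ⟨f', hf'⟩ := yoneda.map_surjective (a.hom ≫ f ≫ G.reprW.inv)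
  have hp' : f' ≫ g' = p := yoneda.map_injective (by
    rw [Functor.map_comp, hg', hf', ← cancel_mono b.hom, ← w]; simp)
  have : Mono (yoneda.map g') := by rw [hg']; infer_instance
  have : Mono g' := yoneda.mono_of_mono_map this
  have := (hs p hp).regularEpi
  have : StrongEpi (f' ≫ g') := by rw [hp']; infer_instance
  have : StrongEpi g' := strongEpi_of_strongEpi f' g'
  have : IsIso g' := isIso_of_mono_of_strongEpi g'
  have : g = G.reprW.inv ≫ yoneda.map g' ≫ b.hom := by rw [hg']; simp
  rw [this]; infer_instance

include h hs in
lemma isIso_of_presheaf_mono {F G : Cᵒᵖ ⥤ Type v} (f : F ⟶ G) [Mono f]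
    (hf : cover.presheaf f) (hG : G.IsRepresentable) : IsIso f := by
  have := h.stableUnderBaseChange
  exact isIso_of_presheaf_comp_mono h hs (𝟙 _) f (by simpa using hf)
    (isRepresentable_of_presheaf hf hG) hG

end Covers

/-! ### Spaces of maps -/

section MapSpace

lemma mapRestrict_comp {R S T : SSet.{v}} (i : R ⟶ S) (j : S ⟶ T) (X : SimplicialObject C) :
    mapRestrict (i ≫ j) X = mapRestrict j X ≫ mapRestrict i X := by
  ext U (t : T ⟶ _)
  exact Category.assoc _ _ _

lemma mapRestrict_id (S : SSet.{v}) (X : SimplicialObject C) :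
    mapRestrict (𝟙 S) X = 𝟙 _ := by
  ext U (t : S ⟶ _)
  exact Category.id_comp _

/-- An isomorphism of simplicial sets induces an isomorphism of spaces of maps. -/
def mapIso {S T : SSet.{v}} (e : S ≅ T) (X : SimplicialObject C) :
    mapSpace T X ≅ mapSpace S X where
  hom := mapRestrict e.hom X
  inv := mapRestrict e.inv X
  hom_inv_id := by rw [← mapRestrict_comp, e.inv_hom_id, mapRestrict_id]
  inv_hom_id := by rw [← mapRestrict_comp, e.hom_inv_id, mapRestrict_id]

lemma isPullback_mapRestrict {S T S' T' : SSet.{v}} {t : S ⟶ T} {l : S ⟶ S'} {r : T ⟶ T'}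
    {b : S' ⟶ T'} (sq : IsPushout t l r b) (X : SimplicialObject C) :
    IsPullback (mapRestrict r X) (mapRestrict b X) (mapRestrict t X) (mapRestrict l X) := by
  rw [isPullback_presheaf_iff]
  refine ⟨by rw [← mapRestrict_comp, ← mapRestrict_comp, sq.w], fun U => ⟨?_, ?_⟩⟩
  · exact fun x y h1 h2 => sq.hom_ext h1 h2
  · exact fun x y hxy => ⟨sq.desc x y hxy, sq.inl_desc _ _ _, sq.inr_desc _ _ _⟩

/-- The morphisms `j` of simplicial sets such that the restriction along `j` of maps to `X`
has the property `W`. -/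
def expansion (W : MorphismProperty (Cᵒᵖ ⥤ Type v)) (X : SimplicialObject C) :
    MorphismProperty SSet.{v} := fun _ _ j => W (mapRestrict j X)

variable (W : MorphismProperty (Cᵒᵖ ⥤ Type v)) (X : SimplicialObject C)

instance [W.IsMultiplicative] : (expansion W X).IsMultiplicative where
  id_mem S := by
    change W _
    rw [mapRestrict_id]; exact W.id_mem _
  comp_mem f g hf hg := by
    change W _
    rw [mapRestrict_comp]
    exact W.comp_mem _ _ hg hf

instance [W.IsStableUnderBaseChange] : (expansion W X).IsStableUnderCobaseChange where
  of_isPushout sq h := W.of_isPullback (isPullback_mapRestrict sq X).flip h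

instance (P : MorphismProperty C) : P.presheaf.IsStableUnderBaseChange :=
  MorphismProperty.relative_isStableUnderBaseChange P

instance [W.IsStableUnderBaseChange] : (expansion W X).RespectsIso :=
  MorphismProperty.IsStableUnderCobaseChange.respectsIso

/-- Mapping spaces reverse arrows, so the cancellation axiom for covers removes the outer inclusion
and keeps the inner one. -/
lemma expansion_cancel {cover : MorphismProperty C} (h : IsDescentCategory cover)
    {X : SimplicialObject C} {R S T : SSet.{v}} (i : R ⟶ S) (j : S ⟶ T)
    (hj : expansion cover.presheaf X j) (hij : expansion cover.presheaf X (i ≫ j))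
    (hR : (mapSpace R X).IsRepresentable) (hS : (mapSpace S X).IsRepresentable) :
    expansion cover.presheaf X i := by
  refine presheaf_cancel h _ _ hj ?_ hS hR
  rw [← mapRestrict_comp]
  exact hij

/-- `Map(Δ^n, X)` is represented by `X_n`. -/
noncomputable def mapStdSimplex (n : SimplexCategory) (X : SimplicialObject C) :
    mapSpace (SSet.stdSimplex.{v}.obj n) X ≅ yoneda.obj (X.obj (op n)) :=
  NatIso.ofComponents (fun U => Equiv.toIso SSet.yonedaEquiv) (fun f => by
    ext (t : SSet.stdSimplex.{v}.obj n ⟶ _)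
    rfl)

lemma isRepresentable_mapStdSimplex (n : SimplexCategory) (X : SimplicialObject C) :
    (mapSpace (SSet.stdSimplex.{v}.obj n) X).IsRepresentable :=
  isRepresentable_of_iso (mapStdSimplex n X).symm inferInstance

lemma isRepresentable_mapSpace_bot [HasFiniteLimits C] {S : SSet.{v}} (X : SimplicialObject C) :
    (mapSpace (⊥ : S.Subcomplex).toSSet X).IsRepresentable := by
  refine isRepresentable_of_iso (F := yoneda.obj (⊤_ C)) (NatIso.ofComponents
    (fun U => Equiv.toIso (Equiv.ofUnique (U.unop ⟶ ⊤_ C) ((⊥ : S.Subcomplex).toSSet ⟶ points X U)))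
    (fun f => ?_)) inferInstance
  ext x
  exact Subsingleton.elim (α := (⊥ : S.Subcomplex).toSSet ⟶ _) _ _

end MapSpace

/-! ### Attaching simplices -/

section Attach

open SSet

/-- The map `f` need not be injective, only injective away from the preimage of `L`. This matters
for cells, whose horns may be mapped to `L` with identifications. In each degree the square is a
pullback, the two images cover the union, and no new simplices are identified. -/
lemma isPushout_attach {Y Z : SSet.{v}} (f : Y ⟶ Z) (L : Z.Subcomplex)
    (hf : ∀ (m : SimplexCategoryᵒᵖ) (x y : Y.obj m), x ∉ (L.preimage f).obj m →
      y ∉ (L.preimage f).obj m → f.app m x = f.app m y → x = y) :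
    IsPushout (L.fromPreimage f) (L.preimage f).ι
      (Subcomplex.homOfLE (le_sup_left : L ≤ L ⊔ Subcomplex.range f))
      (Subcomplex.lift f (le_sup_right : Subcomplex.range f ≤ L ⊔ Subcomplex.range f)) where
  w := rfl
  isColimit' := ⟨evaluationJointlyReflectsColimits _ fun m => by
    refine (PushoutCocone.isColimitMapCoconeEquiv _ _).2 (IsPushout.isColimit
      (?_ : IsPushout ((L.fromPreimage f).app m) ((L.preimage f).ι.app m)
        ((Subcomplex.homOfLE (le_sup_left : L ≤ L ⊔ Subcomplex.range f)).app m)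
        ((Subcomplex.lift f (le_sup_right : Subcomplex.range f ≤ L ⊔ Subcomplex.range f)).app m)))
    refine Types.isPushout_of_isPullback_of_mono' ?_ ?_ ?_
    · rw [Types.isPullback_iff]
      refine ⟨rfl, fun x y hxy => Subtype.ext hxy.2, fun x y hxy => ?_⟩
      have hxy' : x.1 = f.app m y := congrArg Subtype.val hxy
      exact ⟨⟨y, show f.app m y ∈ L.obj m from hxy' ▸ x.2⟩, Subtype.ext hxy'.symm, rfl⟩
    · refine Set.eq_univ_of_forall fun ⟨z, hz⟩ => ?_
      obtain hz | ⟨y, rfl⟩ := hz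
      · exact Or.inl ⟨⟨z, hz⟩, rfl⟩
      · exact Or.inr ⟨y, rfl⟩
    · intro x y hx hy hxy
      exact hf m x y (fun h => hx ⟨⟨x, h⟩, rfl⟩) (fun h => hy ⟨⟨y, h⟩, rfl⟩)
        (congrArg Subtype.val hxy)⟩

lemma expansion_attach (W : MorphismProperty (Cᵒᵖ ⥤ Type v)) [W.IsStableUnderBaseChange]
    (X : SimplicialObject C) {Y Z : SSet.{v}} (f : Y ⟶ Z) (L : Z.Subcomplex)
    (hf : ∀ (m : SimplexCategoryᵒᵖ) (x y : Y.obj m), x ∉ (L.preimage f).obj m →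
      y ∉ (L.preimage f).obj m → f.app m x = f.app m y → x = y)
    (h : expansion W X (L.preimage f).ι) :
    expansion W X (Subcomplex.homOfLE (le_sup_left : L ≤ L ⊔ Subcomplex.range f)) :=
  (expansion W X).of_isPushout (isPushout_attach f L hf) h

/-- The simplices of the range of `σ : Δ^m ⟶ Z` that do not belong to the image of the horn are
determined by their classifying map if `σ` and its `i`-th face are non-degenerate. -/
lemma injective_off_horn {Z : SSet.{v}} {m : ℕ} (σ : Z _⦋m + 1⦌) (i : Fin (m + 2))
    (hσ : σ ∈ Z.nonDegenerate (m + 1)) (hi : Z.δ i σ ∈ Z.nonDegenerate m)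
    (l : SimplexCategoryᵒᵖ) (x y : Δ[m + 1].obj l) (hx : x ∉ Λ[m + 1, i].obj l)
    (hy : y ∉ Λ[m + 1, i].obj l) (hxy : (yonedaEquiv.symm σ).app l x = (yonedaEquiv.symm σ).app l y) :
    x = y := by
  obtain ⟨l⟩ := l
  induction l using SimplexCategory.rec with | _ l
  -- A simplex off the horn hits every vertex except possibly `i`: it is a degeneracy of the top
  -- simplex or of its `i`-th face.
  have key : ∀ z : Δ[m + 1] _⦋l⦌, z ∉ Λ[m + 1, i].obj (op ⦋l⦌) →
      Epi (stdSimplex.objEquiv z : ⦋l⦌ ⟶ ⦋m + 1⦌) ∨ ∃ g : ⦋l⦌ ⟶ ⦋m⦌, Epi g ∧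
        g ≫ SimplexCategory.δ i = stdSimplex.objEquiv z := by
    intro z hz
    rw [mem_horn_iff_notMem_range] at hz
    push Not at hz
    by_cases h : i ∈ Set.range z
    · left
      rw [SimplexCategory.epi_iff_surjective]
      intro j
      by_cases hj : j = i
      · subst hj; exact h
      · exact hz j hj
    · right
      have hne : ∀ j, (stdSimplex.objEquiv z).toOrderHom j ≠ i := fun j hj => h ⟨j, hj⟩
      let g : ⦋l⦌ ⟶ ⦋m⦌ := SimplexCategory.Hom.mk
        ⟨fun j => (Fin.exists_succAbove_eq (hne j)).choose, fun a b hab => by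
          rw [← (Fin.strictMono_succAbove i).le_iff_le,
            (Fin.exists_succAbove_eq (hne a)).choose_spec,
            (Fin.exists_succAbove_eq (hne b)).choose_spec]
          exact (stdSimplex.objEquiv z).toOrderHom.monotone hab⟩
      have hg : ∀ j, i.succAbove (g.toOrderHom j) = (stdSimplex.objEquiv z).toOrderHom j :=
        fun j => (Fin.exists_succAbove_eq (hne j)).choose_spec
      refine ⟨g, ?_, ?_⟩
      · rw [SimplexCategory.epi_iff_surjective]
        intro a
        obtain ⟨j, hj⟩ := hz (i.succAbove a) (Fin.succAbove_ne i a)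
        exact ⟨j, Fin.succAbove_right_injective ((hg j).trans hj)⟩
      · ext j : 3
        exact hg j
  have hfac : ∀ (g : ⦋l⦌ ⟶ ⦋m⦌), Z.map (g ≫ SimplexCategory.δ i).op σ = Z.map g.op (Z.δ i σ) :=
    fun g => by rw [op_comp, Functor.map_comp_apply]; rfl
  apply stdSimplex.objEquiv.injective
  change Z.map (stdSimplex.objEquiv x).op σ = Z.map (stdSimplex.objEquiv y).op σ at hxy
  -- By the Eilenberg–Zilber lemma the non-degenerate simplex and the surjection are unique. The
  -- mixed cases would identify dimensions `m + 1` and `m`.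
  obtain hx | ⟨g, hg, hx⟩ := key x hx <;> obtain hy | ⟨g', hg', hy⟩ := key y hy
  · exact unique_nonDegenerate_map _ _ _ ⟨σ, hσ⟩ rfl _ ⟨σ, hσ⟩ hxy
  · rw [← hy, hfac] at hxy
    have := unique_nonDegenerate_dim _ _ _ ⟨σ, hσ⟩ rfl g' ⟨_, hi⟩ hxy
    omega
  · rw [← hx, hfac] at hxy
    have := unique_nonDegenerate_dim _ _ _ ⟨σ, hσ⟩ rfl g ⟨_, hi⟩ hxy.symm
    omega
  · rw [← hx, ← hy, hfac, hfac] at hxy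
    rw [← hx, ← hy]
    have := unique_nonDegenerate_map _ (Z.map g.op (Z.δ i σ)) g ⟨_, hi⟩ rfl g' ⟨_, hi⟩ hxy
    rw [this]

end Attach

/-! ### Relative cell structures -/

section Union

open SSet

lemma exists_desc_iSup {Z P : SSet.{v}} {T : Z.Subcomplex} {f : ℕ → Z.Subcomplex}
    (hf : Monotone f) (hT : ⨆ s, f s = T) (g : ∀ s, (f s).toSSet ⟶ P)
    (hg : ∀ s, Subcomplex.homOfLE (hf (Nat.le_succ s)) ≫ g (s + 1) = g s) :
    ∃ t : T.toSSet ⟶ P, ∀ s, Subcomplex.homOfLE ((le_iSup f s).trans hT.le) ≫ t = g s := by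
  have hg' : ∀ s s' (h : s ≤ s'), Subcomplex.homOfLE (hf h) ≫ g s' = g s := by
    intro s s' h
    induction s', h using Nat.le_induction with
    | base => exact Category.id_comp _
    | succ s' h ih =>
      rw [← ih, ← hg s', Subcomplex.homOfLE_comp_assoc]
  have happ : ∀ s s' (m : SimplexCategoryᵒᵖ) (x : Z.obj m) (hx : x ∈ (f s).obj m)
      (hx' : x ∈ (f s').obj m), (g s).app m ⟨x, hx⟩ = (g s').app m ⟨x, hx'⟩ := by
    have : ∀ s s' (_ : s ≤ s') (m : SimplexCategoryᵒᵖ) (x : Z.obj m) (hx : x ∈ (f s).obj m)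
      (hx' : x ∈ (f s').obj m), (g s).app m ⟨x, hx⟩ = (g s').app m ⟨x, hx'⟩ := by
      intro s s' h m x hx hx'
      rw [← hg' s s' h]; rfl
    intro s s' m x hx hx'
    obtain h | h := le_total s s'
    · exact this s s' h m x hx hx'
    · exact (this s' s h m x hx' hx).symm
  have hex : ∀ (m : SimplexCategoryᵒᵖ) (x : T.toSSet.obj m), ∃ s, x.1 ∈ (f s).obj m := by
    rintro m ⟨x, hx⟩
    rw [← hT] at hx
    simpa using hx
  refine ⟨{ app := fun m => TypeCat.ofHom fun x =>
              (g (hex m x).choose).app m ⟨x.1, (hex m x).choose_spec⟩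
            naturality := fun m m' φ => ?_ }, fun s => ?_⟩
  · refine ConcreteCategory.hom_ext _ _ fun (x : T.toSSet.obj m) => ?_
    have h := (hex m x).choose_spec
    refine (happ _ (hex m x).choose m' _ _ ((f _).map φ h)).trans ?_
    exact ConcreteCategory.congr_hom ((g (hex m x).choose).naturality φ) ⟨x.1, h⟩
  · ext m x
    exact happ _ _ _ _ _ _

/-- Unique extension at each stage passes to the union of the tower. Stated for isomorphisms only,
since an infinite tower of covers need not compose to a cover; this is why cells of large rank are
treated apart. -/
lemma isIso_expansion_iSup (X : SimplicialObject C) {Z : SSet.{v}} {T : Z.Subcomplex}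
    {f : ℕ → Z.Subcomplex} (hf : Monotone f) (hT : ⨆ s, f s = T)
    (h : ∀ s, expansion (.isomorphisms _) X (Subcomplex.homOfLE (hf (Nat.le_succ s)))) :
    expansion (.isomorphisms _) X (Subcomplex.homOfLE ((le_iSup f 0).trans hT.le)) := by
  refine (isIso_presheaf_iff _).2 fun U => ?_
  have hb : ∀ s, Function.Bijective fun t : (f (s + 1)).toSSet ⟶ points X U =>
      Subcomplex.homOfLE (hf (Nat.le_succ s)) ≫ t := fun s => (isIso_presheaf_iff _).1 (h s) U
  constructor
  · intro (t : T.toSSet ⟶ points X U) (t' : T.toSSet ⟶ points X U) htt'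
    have : ∀ s, Subcomplex.homOfLE ((le_iSup f s).trans hT.le) ≫ t =
        Subcomplex.homOfLE ((le_iSup f s).trans hT.le) ≫ t' := by
      intro s
      induction s with
      | zero => exact htt'
      | succ s ih => exact (hb s).1 ih
    refine NatTrans.ext (funext fun m => ConcreteCategory.hom_ext _ _ fun ⟨x, hx⟩ => ?_)
    obtain ⟨s, hs⟩ : ∃ s, x ∈ (f s).obj m := by
      rw [← hT] at hx
      simpa using hx
    exact ConcreteCategory.congr_hom (NatTrans.congr_app (this s) m) ⟨x, hs⟩
  · intro (t : (f 0).toSSet ⟶ points X U)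
    let g : ∀ s, (f s).toSSet ⟶ points X U :=
      fun s => Nat.rec t (fun s t => ((hb s).2 t).choose) s
    obtain ⟨t', ht'⟩ := exists_desc_iSup hf hT g (fun s => ((hb s).2 (g s)).choose_spec)
    exact ⟨t', ht' 0⟩

end Union

open SSet in
/-- A relative cell structure of a subcomplex `T` over a subcomplex `A`: each cell is a simplex
with a distinguished face, and attaching it amounts to filling a horn. The cells are attached in
the order of their ranks. -/
structure Cells {Z : SSet.{v}} (A T : Z.Subcomplex) where
  /-- the type of cells -/
  ι : Type
  /-- the dimension of the distinguished face of a cell -/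
  dim : ι → ℕ
  /-- the simplex of a cell -/
  simplex : ∀ c, Z _⦋dim c + 1⦌
  /-- the index of the distinguished face -/
  idx : ∀ c, Fin (dim c + 2)
  /-- the rank of a cell -/
  rank : ι → ℕ
  finite : ∀ r, {c | rank c = r}.Finite
  nonDegenerate : ∀ c, simplex c ∈ Z.nonDegenerate (dim c + 1)
  nonDegenerate_face : ∀ c, Z.δ (idx c) (simplex c) ∈ Z.nonDegenerate (dim c)
  face_mem : ∀ c j, j ≠ idx c → Z.δ j (simplex c) ∈
    (A ⊔ ⨆ c', ⨆ (_ : rank c' < rank c), Subcomplex.ofSimplex (simplex c')).obj _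
  face_notMem : ∀ c, Z.δ (idx c) (simplex c) ∉ A.obj _
  face_notMem_cell : ∀ c c', c' ≠ c → rank c' ≤ rank c →
    Z.δ (idx c) (simplex c) ∉ (Subcomplex.ofSimplex (simplex c')).obj _
  sup_eq : A ⊔ ⨆ c, Subcomplex.ofSimplex (simplex c) = T

namespace Cells

open SSet

variable {Z : SSet.{v}} {A T : Z.Subcomplex} (D : Cells A T)

/-- The subcomplex generated by `A` and the cells of rank `< r`. -/
def filtration (r : ℕ) : Z.Subcomplex :=
  A ⊔ ⨆ c, ⨆ (_ : D.rank c < r), Subcomplex.ofSimplex (D.simplex c)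

lemma le_filtration (r : ℕ) : A ≤ D.filtration r := le_sup_left

lemma filtration_monotone : Monotone D.filtration := fun r s h => by
  refine sup_le_sup le_rfl (iSup_mono fun c => iSup_le fun hc => ?_)
  exact le_iSup_of_le (hc.trans_le h) le_rfl

lemma filtration_zero : D.filtration 0 = A := by
  simp [filtration]

lemma cell_le_filtration {c : D.ι} {r : ℕ} (h : D.rank c < r) :
    Subcomplex.ofSimplex (D.simplex c) ≤ D.filtration r :=
  le_sup_of_le_right (le_iSup_of_le c (le_iSup_of_le h le_rfl))

lemma iSup_filtration : ⨆ r, D.filtration r = T := by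
  refine Eq.trans ?_ D.sup_eq
  apply le_antisymm
  · exact iSup_le fun r => sup_le_sup le_rfl (iSup_mono fun c => iSup_le fun _ => le_rfl)
  · refine sup_le (le_iSup_of_le 0 (D.le_filtration 0)) (iSup_le fun c => ?_)
    exact le_iSup_of_le (D.rank c + 1) (D.cell_le_filtration (Nat.lt_succ_self _))

include D in
lemma le : A ≤ T := by rw [← D.sup_eq]; exact le_sup_left

lemma iSup_filtration_add (N : ℕ) : ⨆ s, D.filtration (N + s) = T := by
  refine Eq.trans ?_ D.iSup_filtration
  refine le_antisymm (iSup_le fun s => le_iSup D.filtration _) (iSup_le fun s => ?_)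
  exact le_iSup_of_le s (D.filtration_monotone (Nat.le_add_left _ _))

/-- A subcomplex of a simplex lies in the `i`-th horn exactly when it omits the `i`-th face. All the
other faces are already in `L` by `face_mem`. -/
lemma preimage_eq_horn (c : D.ι) (L : Z.Subcomplex) (hL : D.filtration (D.rank c) ≤ L)
    (hc : Z.δ (D.idx c) (D.simplex c) ∉ L.obj _) :
    L.preimage (yonedaEquiv.symm (D.simplex c)) = Λ[D.dim c + 1, D.idx c] := by
  have key : ∀ j, stdSimplex.face.{v} {j}ᶜ ≤ L.preimage (yonedaEquiv.symm (D.simplex c)) ↔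
      Z.δ j (D.simplex c) ∈ L.obj _ := by
    intro j
    rw [← stdSimplex.ofSimplex_yonedaEquiv_δ, Subcomplex.ofSimplex_le_iff]
    rfl
  apply le_antisymm
  · rw [subcomplex_le_horn_iff, key]
    exact hc
  · rw [horn_eq_iSup]
    exact iSup_le fun j => (key _).2 (hL _ (D.face_mem c _ j.2))

/-- Attaching the cell `c` to a subcomplex containing `A` has the property `W` for maps to `X`. -/
def IsStep (W : MorphismProperty (Cᵒᵖ ⥤ Type v)) (X : SimplicialObject C) (c : D.ι) : Prop :=
  ∀ L : Z.Subcomplex, A ≤ L →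
    L.preimage (yonedaEquiv.symm (D.simplex c)) = Λ[D.dim c + 1, D.idx c] →
    expansion W X (Subcomplex.homOfLE (le_sup_left :
      L ≤ L ⊔ Subcomplex.range (yonedaEquiv.symm (D.simplex c))))

variable {W : MorphismProperty (Cᵒᵖ ⥤ Type v)} {X : SimplicialObject C}

lemma isStep_of_horn [W.IsStableUnderBaseChange] {c : D.ι}
    (h : expansion W X (Λ[D.dim c + 1, D.idx c] : Subcomplex _).ι) : D.IsStep W X c := by
  intro L _ hL
  refine expansion_attach W X _ L (fun m x y hx hy => ?_) (by rwa [hL])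
  rw [hL] at hx hy
  exact injective_off_horn _ _ (D.nonDegenerate c) (D.nonDegenerate_face c) _ _ _ hx hy

/-- Cells of equal rank are attached one at a time. Condition `face_notMem_cell` ensures that the
distinguished face of the next cell is still absent, so the cell meets the previous stage in a horn.
-/
lemma expansion_finset [W.IsMultiplicative] (r : ℕ)
    (h : ∀ c, D.rank c = r → D.IsStep W X c) (F : Finset D.ι) (hF : ∀ c ∈ F, D.rank c = r)
    (B : Z.Subcomplex)
    (hB : D.filtration r ⊔ ⨆ c, ⨆ (_ : c ∈ F), Subcomplex.ofSimplex (D.simplex c) = B) :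
    expansion W X (Subcomplex.homOfLE (le_sup_left.trans hB.le : D.filtration r ≤ B)) := by
  classical
  induction F using Finset.induction_on generalizing B with
  | empty =>
    obtain rfl : D.filtration r = B := by simpa using hB
    exact (expansion W X).id_mem _
  | insert c F hc ih =>
    have hF' : ∀ c ∈ F, D.rank c = r := fun c hc => hF c (Finset.mem_insert_of_mem hc)
    have hcr : D.rank c = r := hF c (Finset.mem_insert_self _ _)
    have h₁ := ih hF' _ rfl
    have hrange : Subcomplex.range (yonedaEquiv.symm (D.simplex c)) =
        Subcomplex.ofSimplex (D.simplex c) := by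
      rw [Subcomplex.range_eq_ofSimplex, Equiv.apply_symm_apply]
    have hB' : (D.filtration r ⊔ ⨆ c, ⨆ (_ : c ∈ F), Subcomplex.ofSimplex (D.simplex c)) ⊔
        Subcomplex.range (yonedaEquiv.symm (D.simplex c)) = B := by
      rw [← hB, hrange, sup_assoc, Finset.iSup_insert c F, sup_comm (Subcomplex.ofSimplex _)]
    subst hB'
    refine (expansion W X).comp_mem _ _ h₁ (h c hcr _ ((D.le_filtration r).trans le_sup_left) ?_)
    refine D.preimage_eq_horn c _ (by rw [hcr]; exact le_sup_left) ?_
    simp only [filtration, Subfunctor.max_obj, Subfunctor.iSup_obj, Set.mem_union, Set.mem_iUnion,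
      not_or, not_exists]
    refine ⟨⟨D.face_notMem c, fun c' hc' => ?_⟩, fun c' hc' => ?_⟩
    · exact D.face_notMem_cell c c' (by rintro rfl; omega) (by omega)
    · exact D.face_notMem_cell c c' (by rintro rfl; exact hc hc') (by rw [hF' _ hc', hcr])

lemma expansion_filtration_succ [W.IsMultiplicative] (r : ℕ)
    (h : ∀ c, D.rank c = r → D.IsStep W X c) :
    expansion W X (Subcomplex.homOfLE (D.filtration_monotone (Nat.le_succ r))) := by
  refine D.expansion_finset r h (D.finite r).toFinset (fun c hc => by simpa using hc) _ ?_
  apply le_antisymm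
  · refine sup_le (D.filtration_monotone (Nat.le_succ r)) (iSup_le fun c => iSup_le fun hc => ?_)
    exact D.cell_le_filtration (by simp at hc; omega)
  · refine sup_le (le_sup_of_le_left (D.le_filtration r)) (iSup_le fun c => iSup_le fun hc => ?_)
    by_cases hc' : D.rank c = r
    · exact le_sup_of_le_right (le_iSup_of_le c (le_iSup_of_le (by simpa using hc') le_rfl))
    · exact le_sup_of_le_left (D.cell_le_filtration (by omega))

lemma expansion_filtration [W.IsMultiplicative] (h : ∀ c, D.IsStep W X c) (r : ℕ) :
    expansion W X (Subcomplex.homOfLE (D.le_filtration r)) := by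
  induction r with
  | zero =>
    have : ∀ (B : Z.Subcomplex) (h : A = B), expansion W X (Subcomplex.homOfLE h.le) := by
      rintro B rfl
      exact (expansion W X).id_mem _
    exact this _ D.filtration_zero.symm
  | succ r ih =>
    exact (expansion W X).comp_mem _ _ ih (D.expansion_filtration_succ r fun c _ => h c)

/-- If attaching each cell has the property `W` and attaching each cell of large rank is an
isomorphism, then the inclusion of `A` in `T` has the property `W`. -/
theorem expansion_homOfLE [W.IsMultiplicative] [W.RespectsIso] (h : ∀ c, D.IsStep W X c) (N : ℕ)
    (hN : ∀ c, N ≤ D.rank c → D.IsStep (.isomorphisms _) X c) :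
    expansion W X (Subcomplex.homOfLE D.le) := by
  have h₁ := isIso_expansion_iSup X (f := fun s => D.filtration (N + s))
    (fun _ _ h => D.filtration_monotone (Nat.add_le_add_left h N)) (D.iSup_filtration_add N)
    (fun s => D.expansion_filtration_succ _ fun c hc => hN c (by omega))
  exact (expansion W X).comp_mem _ _ (D.expansion_filtration h N)
    (MorphismProperty.isomorphisms_le_of_containsIdentities W _ h₁)

end Cells

/-! ### Words -/

section Words

variable {n m : ℕ}

/-- The simplex of the thick simplex given by a word. -/
abbrev word (w : Fin (m + 1) → Fin (n + 1)) : (thick.{v}.obj ⦋n⦌) _⦋m⦌ := ⟨w⟩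

lemma word_mem_nonDegenerate_iff (w : Fin (m + 1) → Fin (n + 1)) :
    word.{v} w ∈ (thick.{v}.obj ⦋n⦌).nonDegenerate m ↔ ∀ j : Fin m, w j.castSucc ≠ w j.succ := by
  obtain _ | m := m
  · simp
  rw [SSet.mem_nonDegenerate_iff_notMem_degenerate, SSet.degenerate_eq_iUnion_range_σ,
    ← not_iff_not, not_not]
  push Not
  simp only [Set.mem_iUnion, Set.mem_range]
  refine exists_congr fun j => ⟨?_, fun h => ?_⟩
  · rintro ⟨⟨y⟩, hy⟩
    have hy' : y ∘ j.predAbove = w := congrArg ULift.down hy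
    rw [← hy']
    simp
  · refine ⟨word (w ∘ j.castSucc.succAbove), congrArg ULift.up (funext fun a => ?_)⟩
    change w (j.castSucc.succAbove (j.predAbove a)) = w a
    by_cases ha : a = j.castSucc
    · subst ha; simp [h]
    · obtain ⟨b, rfl⟩ := Fin.exists_succAbove_eq ha
      rw [Fin.predAbove_succAbove]

/-- The position of `w` at which a letter of a second sign occurs for the first time. -/
def IsTurn (κ : Fin (n + 1) → SignType) (w : Fin (m + 1) → Fin (n + 1)) (t : Fin (m + 1)) : Prop :=
  κ (w t) ≠ 0 ∧ (∃ j < t, κ (w j) ≠ 0) ∧ ∀ j < t, κ (w j) ≠ κ (w t)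

variable {κ : Fin (n + 1) → SignType}

lemma SignType.eq_of_ne {a b c : SignType} (hab : a ≠ b) (hac : a ≠ c) (hbc : b ≠ c) :
    a = 0 ∨ b = 0 ∨ c = 0 := by
  revert a b c; decide

/-- Two distinct turns would exhibit three different nonzero signs. -/
lemma IsTurn.unique {w : Fin (m + 1) → Fin (n + 1)} {t t' : Fin (m + 1)} (h : IsTurn κ w t)
    (h' : IsTurn κ w t') : t = t' := by
  have key : ∀ t t', IsTurn κ w t → IsTurn κ w t' → ¬ t < t' := by
    intro t t' h h' htt'
    obtain ⟨h0, ⟨j, hj, hj0⟩, ht⟩ := h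
    have := SignType.eq_of_ne (ht j hj) (h'.2.2 j (hj.trans htt')) (h'.2.2 t htt')
    have := h'.1
    tauto
  exact le_antisymm (not_lt.1 (key _ _ h' h)) (not_lt.1 (key _ _ h h'))

/-- The turn is the least position by which both signs have occurred. -/
lemma exists_isTurn {w : Fin (m + 1) → Fin (n + 1)} {a b : Fin (m + 1)} (ha : κ (w a) = 1)
    (hb : κ (w b) = -1) : ∃ t, IsTurn κ w t := by
  classical
  have hex : ∃ t, (∃ a ≤ t, κ (w a) = 1) ∧ ∃ b ≤ t, κ (w b) = -1 :=
    ⟨max a b, ⟨a, le_max_left _ _, ha⟩, ⟨b, le_max_right _ _, hb⟩⟩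
  obtain ⟨t, ⟨⟨a, hat, ha⟩, ⟨b, hbt, hb⟩⟩, hmin⟩ := WellFounded.has_min
    (wellFounded_lt : WellFounded ((· < ·) : Fin (m + 1) → Fin (m + 1) → Prop)) _ hex
  have hmin' : ∀ a' b', a' < t → b' < t → κ (w a') = 1 → κ (w b') = -1 → False :=
    fun a' b' ha' hb' h1 h2 => hmin (max a' b')
      ⟨⟨a', le_max_left _ _, h1⟩, ⟨b', le_max_right _ _, h2⟩⟩ (max_lt ha' hb')
  refine ⟨t, ?_⟩
  obtain rfl | hat := hat.eq_or_lt
  · have hba : b < a := lt_of_le_of_ne hbt (by rintro rfl; rw [ha] at hb; exact absurd hb (by decide))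
    refine ⟨by rw [ha]; decide, ⟨b, hba, by rw [hb]; decide⟩, fun j hj hj' => ?_⟩
    exact hmin' j b hj hba (hj'.trans ha) hb
  obtain rfl | hbt := hbt.eq_or_lt
  · refine ⟨by rw [hb]; decide, ⟨a, hat, by rw [ha]; decide⟩, fun j hj hj' => ?_⟩
    exact hmin' a j hat hj ha (hj'.trans hb)
  exact (hmin' a b hat hbt ha hb).elim

/-- Letters of sign `0` play no role in the definition of a turn, so deleting one only renumbers it.
-/
lemma isTurn_comp_succAbove_iff {w : Fin (m + 2) → Fin (n + 1)} {q : Fin (m + 2)}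
    (hq : κ (w q) = 0) (t : Fin (m + 1)) :
    IsTurn κ (w ∘ q.succAbove) t ↔ IsTurn κ w (q.succAbove t) := by
  refine and_congr_right fun h0 => and_congr ⟨?_, ?_⟩ ⟨fun h j hj => ?_, fun h j hj => ?_⟩
  · rintro ⟨j, hj, h⟩
    exact ⟨_, Fin.strictMono_succAbove q hj, h⟩
  · rintro ⟨j, hj, h⟩
    obtain ⟨i, rfl⟩ := Fin.exists_succAbove_eq (x := j) (y := q) (by rintro rfl; exact h hq)
    exact ⟨i, (Fin.strictMono_succAbove q).lt_iff_lt.1 hj, h⟩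
  · by_cases hjq : j = q
    · subst hjq
      rw [hq]
      exact h0.symm
    · obtain ⟨i, rfl⟩ := Fin.exists_succAbove_eq hjq
      exact h i ((Fin.strictMono_succAbove q).lt_iff_lt.1 hj)
  · exact h _ (Fin.strictMono_succAbove q hj)

end Words

/-! ### Pairing words by toggling a letter before the turn. -/

section Toggle

variable {n m : ℕ}

/-- The number of letters of a word that are different from `c`. -/
def countNe (c : Fin (n + 1)) (w : Fin (m + 1) → Fin (n + 1)) : ℕ :=
  ∑ i, if w i = c then 0 else 1

lemma countNe_le (c : Fin (n + 1)) (w : Fin (m + 1) → Fin (n + 1)) : countNe c w ≤ m + 1 := by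
  refine (Finset.sum_le_card_nsmul _ _ 1 fun i _ => ?_).trans (by simp)
  split_ifs <;> simp

lemma countNe_succAbove (c : Fin (n + 1)) (w : Fin (m + 2) → Fin (n + 1)) (q : Fin (m + 2)) :
    countNe c w = (if w q = c then 0 else 1) + countNe c (w ∘ q.succAbove) :=
  Fin.sum_univ_succAbove _ q

variable {κ : Fin (n + 1) → SignType} {c : Fin (n + 1)}

lemma isTurn_comp_castSucc_succAbove_iff {w : Fin (m + 2) → Fin (n + 1)} {j : Fin (m + 1)}
    (hj : κ (w j.castSucc) = 0) :
    IsTurn κ (w ∘ j.castSucc.succAbove) j ↔ IsTurn κ w j.succ := by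
  rw [isTurn_comp_succAbove_iff hj, Fin.succAbove_castSucc_self]

/-- Removing a letter `c` not immediately before the turn of a word with the letter `c` immediately
before the turn gives a word with the same property. -/
lemma IsTurn.exists_of_succAbove {w : Fin (m + 2) → Fin (n + 1)} {j : Fin (m + 1)}
    (h0 : κ c = 0) (hj : w j.castSucc = c) (h : IsTurn κ w j.succ) {q : Fin (m + 2)} (hq : w q = c)
    (hqj : q ≠ j.castSucc) {t : Fin (m + 1)} (ht : IsTurn κ (w ∘ q.succAbove) t) :
    ∃ i : Fin m, i.succ = t ∧ w (q.succAbove i.castSucc) = c := by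
  have htj := ((isTurn_comp_succAbove_iff (by rw [hq, h0]) t).1 ht).unique h
  obtain ⟨i, hi⟩ := Fin.exists_succAbove_eq hqj.symm
  have hit : i < t := by
    rw [← (Fin.strictMono_succAbove q).lt_iff_lt, hi, htj]
    exact Fin.castSucc_lt_succ
  obtain ⟨i', rfl⟩ : ∃ i' : Fin m, i = i'.castSucc :=
    ⟨i.castPred (Fin.ne_last_of_lt hit), by simp⟩
  refine ⟨i', ?_, by rw [hi, hj]⟩
  have h1 : i'.succ ≤ t := Fin.castSucc_lt_iff_succ_le.1 hit
  refine h1.eq_of_not_lt fun h2 => ?_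
  have h3 := Fin.strictMono_succAbove q h2
  have h4 := Fin.strictMono_succAbove q (Fin.castSucc_lt_succ (i := i'))
  rw [htj] at h3
  rw [hi] at h4
  simp only [Fin.lt_def, Fin.val_castSucc, Fin.val_succ] at h3 h4
  omega

/-- The subcomplexes `A ≤ T` of a thick simplex are such that `T` is obtained from `A` by inserting
the letter `c` immediately before the turn of words. -/
structure Toggle (κ : Fin (n + 1) → SignType) (c : Fin (n + 1))
    (A T : (thick.{v}.obj ⦋n⦌).Subcomplex) : Prop where
  zero_iff : ∀ x, κ x = 0 ↔ x = c
  le : A ≤ T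
  exists_turn : ∀ {m : ℕ} (w : Fin (m + 1) → Fin (n + 1)), word w ∈ T.obj (op ⦋m⦌) →
    word w ∉ A.obj (op ⦋m⦌) → ∃ t, IsTurn κ w t
  insert_mem : ∀ {m : ℕ} (w : Fin (m + 2) → Fin (n + 1)) (j : Fin (m + 1)), w j.castSucc = c →
    IsTurn κ w j.succ → word (w ∘ j.castSucc.succAbove) ∈ T.obj (op ⦋m⦌) →
    word (w ∘ j.castSucc.succAbove) ∉ A.obj (op ⦋m⦌) → word w ∈ T.obj (op ⦋m + 1⦌)
  remove_notMem : ∀ {m : ℕ} (w : Fin (m + 2) → Fin (n + 1)) (j : Fin (m + 1)), w j.castSucc = c →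
    IsTurn κ w j.succ → word w ∈ T.obj (op ⦋m + 1⦌) → word w ∉ A.obj (op ⦋m + 1⦌) →
    word (w ∘ j.castSucc.succAbove) ∉ A.obj (op ⦋m⦌)

/-- The words with the letter `c` immediately before their turn. -/
structure ToggleCell (κ : Fin (n + 1) → SignType) (c : Fin (n + 1))
    (A T : (thick.{v}.obj ⦋n⦌).Subcomplex) where
  /-- the length of the word is `dim + 2` -/
  dim : ℕ
  /-- the word -/
  w : Fin (dim + 2) → Fin (n + 1)
  /-- the position of the letter `c` before the turn -/
  pos : Fin (dim + 1)
  nonDegenerate : ∀ i : Fin (dim + 1), w i.castSucc ≠ w i.succ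
  mem : word w ∈ T.obj (op ⦋dim + 1⦌)
  notMem : word w ∉ A.obj (op ⦋dim + 1⦌)
  letter : w pos.castSucc = c
  turn : IsTurn κ w pos.succ

namespace ToggleCell

variable {A T : (thick.{v}.obj ⦋n⦌).Subcomplex}

/-- Cells are attached by dimension, and then by the number of letters different from `c`. -/
def rank (x : ToggleCell κ c A T) : ℕ := (x.dim + 2) ^ 2 + countNe c x.w

lemma rank_lt {x y : ToggleCell κ c A T} (h : x.dim < y.dim) : x.rank < y.rank := by
  have := countNe_le c x.w
  -- The count of letters is at most `x.dim + 2`, less than the gap to the next square, so the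
  -- dimension dominates the rank.
  have : (x.dim + 2) ^ 2 + (x.dim + 2) < (y.dim + 2) ^ 2 := by nlinarith
  simp only [rank]
  omega

lemma finite_rank (r : ℕ) : Set.Finite {x | rank (κ := κ) (c := c) (A := A) (T := T) x = r} := by
  let F : {x : ToggleCell κ c A T // x.rank = r} →
      Σ d : Fin (r + 1), (Fin (d + 2) → Fin (n + 1)) × Fin (d + 1) := fun x =>
    ⟨⟨x.1.dim, by have := x.2; simp only [rank] at this; nlinarith⟩,
      x.1.w, x.1.pos⟩
  have hF : Function.Injective F := by
    rintro ⟨⟨d, w, p, _, _, _, _, _⟩, _⟩ ⟨⟨d', w', p', _, _, _, _, _⟩, _⟩ h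
    simp only [F, Sigma.mk.injEq, Fin.mk.injEq] at h
    obtain ⟨rfl, h⟩ := h
    simp only [heq_eq_eq, Prod.mk.injEq] at h
    obtain ⟨rfl, rfl⟩ := h
    rfl
  exact Finite.of_injective F hF

end ToggleCell

namespace Toggle

lemma not_letter_of_face {w : Fin (m + 2) → Fin (n + 1)} {j : Fin (m + 1)}
    (hw : ∀ i : Fin (m + 1), w i.castSucc ≠ w i.succ) (hj : w j.castSucc = c) (i : Fin m)
    (hi : i.succ = j) : w (j.castSucc.succAbove i.castSucc) ≠ c := by
  subst hi
  rw [Fin.succAbove_of_castSucc_lt _ _ (by simp [Fin.lt_def]), ← hj]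
  exact hw i.castSucc

variable {A T : (thick.{v}.obj ⦋n⦌).Subcomplex} (h : Toggle κ c A T)

include h

/-- The turn of the face sits at the index of the deleted letter, so the face determines both the
position and the word. -/
lemma eq_of_face_eq {w w' : Fin (m + 2) → Fin (n + 1)} {j j' : Fin (m + 1)}
    (hj : w j.castSucc = c) (hj' : w' j'.castSucc = c) (ht : IsTurn κ w j.succ)
    (ht' : IsTurn κ w' j'.succ) (hw : w ∘ j.castSucc.succAbove = w' ∘ j'.castSucc.succAbove) :
    j = j' ∧ w = w' := by
  rw [← isTurn_comp_castSucc_succAbove_iff (by rw [hj, h.zero_iff])] at ht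
  rw [← isTurn_comp_castSucc_succAbove_iff (by rw [hj', h.zero_iff]), ← hw] at ht'
  obtain rfl := ht.unique ht'
  refine ⟨rfl, funext fun i => ?_⟩
  by_cases hi : i = j.castSucc
  · rw [hi, hj, hj']
  · obtain ⟨i, rfl⟩ := Fin.exists_succAbove_eq hi
    exact congrFun hw i

/-- The only new adjacency is between the turn and the letter that preceded `c`. These differ, as no
earlier letter has the sign of the turn. -/
lemma face_nonDegenerate {w : Fin (m + 2) → Fin (n + 1)} {j : Fin (m + 1)}
    (hw : ∀ i : Fin (m + 1), w i.castSucc ≠ w i.succ) (hj : w j.castSucc = c)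
    (ht : IsTurn κ w j.succ) (a : Fin m) :
    w (j.castSucc.succAbove a.castSucc) ≠ w (j.castSucc.succAbove a.succ) := by
  rw [← isTurn_comp_castSucc_succAbove_iff (by rw [hj, h.zero_iff])] at ht
  obtain ha | rfl | ha := lt_trichotomy a.succ j
  · rw [Fin.succAbove_of_castSucc_lt, Fin.succAbove_of_castSucc_lt]
    · exact hw a.castSucc
    · rwa [Fin.castSucc_lt_castSucc_iff]
    · simp only [Fin.lt_def, Fin.val_castSucc, Fin.val_succ] at ha ⊢; omega
  · intro h'
    exact ht.2.2 a.castSucc Fin.castSucc_lt_succ (congrArg κ h')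
  · rw [Fin.succAbove_of_le_castSucc, Fin.succAbove_of_le_castSucc]
    · exact hw a.succ
    · simp only [Fin.lt_def, Fin.le_def, Fin.val_castSucc, Fin.val_succ] at ha ⊢; omega
    · simp only [Fin.lt_def, Fin.le_def, Fin.val_castSucc, Fin.val_succ] at ha ⊢; omega

/-- The cell obtained by inserting `c` before the turn of a word. -/
lemma exists_cell_of_small {w : Fin (m + 1) → Fin (n + 1)} (hT : word w ∈ T.obj (op ⦋m⦌))
    (hA : word w ∉ A.obj (op ⦋m⦌)) (hw : ∀ i : Fin m, w i.castSucc ≠ w i.succ) {t : Fin (m + 1)}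
    (ht : IsTurn κ w t) (hc : ∀ i : Fin m, i.succ = t → w i.castSucc ≠ c) :
    ∃ (w' : Fin (m + 2) → Fin (n + 1)) (j : Fin (m + 1)), w' ∘ j.castSucc.succAbove = w ∧
      w' j.castSucc = c ∧ IsTurn κ w' j.succ ∧ word w' ∈ T.obj (op ⦋m + 1⦌) ∧
      word w' ∉ A.obj (op ⦋m + 1⦌) ∧ ∀ i : Fin (m + 1), w' i.castSucc ≠ w' i.succ := by
  let w' : Fin (m + 2) → Fin (n + 1) := Fin.insertNth t.castSucc c w
  have h1 : w' ∘ t.castSucc.succAbove = w := by ext1 i; simp [w']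
  have h2 : w' t.castSucc = c := by simp [w']
  have h3 : IsTurn κ w' t.succ := by
    rw [← isTurn_comp_castSucc_succAbove_iff (by rw [h2, h.zero_iff]), h1]
    exact ht
  refine ⟨w', t, h1, h2, h3, h.insert_mem w' t h2 h3 (by rwa [h1]) (by rwa [h1]), fun hA' => hA ?_,
    fun i => ?_⟩
  · have := A.map (SimplexCategory.δ t.castSucc).op hA'
    rw [← h1]
    exact this
  -- Only the two adjacencies of the inserted `c` are new. On its left `hc` excludes another `c`; on
  -- its right the turn has nonzero sign.
  · obtain hi | rfl | hi := lt_trichotomy i t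
    · rw [← Fin.succAbove_of_castSucc_lt t.castSucc i (by simpa using hi)]
      change (w' ∘ t.castSucc.succAbove) i ≠ _
      by_cases hit : i.succ = t.castSucc
      · rw [h1, hit, h2]
        have hne : i ≠ Fin.last m := by
          rintro rfl
          exact absurd hi (not_lt.2 (Fin.le_last _))
        obtain ⟨i, rfl⟩ := Fin.exists_castSucc_eq.2 hne
        refine hc i ?_
        rw [Fin.succ_castSucc] at hit
        exact Fin.castSucc_injective _ hit
      · have hne : i ≠ Fin.last m := by
          rintro rfl
          exact absurd hi (not_lt.2 (Fin.le_last _))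
        obtain ⟨i, rfl⟩ := Fin.exists_castSucc_eq.2 hne
        rw [Fin.succ_castSucc, ← Fin.succAbove_of_castSucc_lt t.castSucc i.succ]
        · change _ ≠ (w' ∘ t.castSucc.succAbove) i.succ
          rw [h1]
          exact hw i
        · rw [Fin.succ_castSucc] at hit
          simp only [Fin.lt_def, Fin.ext_iff, Fin.val_castSucc, Fin.val_succ] at hi hit ⊢
          omega
    · rw [h2, ← Fin.succAbove_castSucc_self]
      change c ≠ (w' ∘ i.castSucc.succAbove) i
      rw [h1]
      intro h'
      exact ht.1 ((h.zero_iff _).2 h'.symm)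
    · have hne : i ≠ 0 := by
        rintro rfl
        exact absurd hi (not_lt.2 (Fin.zero_le _))
      obtain ⟨i, rfl⟩ := Fin.exists_succ_eq.2 hne
      rw [← Fin.succ_castSucc, ← Fin.succAbove_of_le_castSucc t.castSucc i.castSucc,
        ← Fin.succAbove_of_le_castSucc t.castSucc i.succ]
      · change (w' ∘ t.castSucc.succAbove) _ ≠ (w' ∘ t.castSucc.succAbove) _
        rw [h1]
        exact hw i
      · simp only [Fin.lt_def, Fin.le_def, Fin.val_castSucc, Fin.val_succ] at hi ⊢
        omega
      · simp only [Fin.lt_def, Fin.le_def, Fin.val_castSucc, Fin.val_succ] at hi ⊢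
        omega

end Toggle

end Toggle

/-! ### The cell structure given by toggling. -/

namespace Toggle

open SSet

variable {n : ℕ} {κ : Fin (n + 1) → SignType} {c : Fin (n + 1)}
  {A T : (thick.{v}.obj ⦋n⦌).Subcomplex}

/-- The distinguished horn of a cell is inner. -/
lemma pos_ne_zero (h : Toggle κ c A T) (x : ToggleCell κ c A T) : x.pos.castSucc ≠ 0 := by
  intro h0
  -- A letter of nonzero sign precedes the turn. If `c` were in position `0`, it would be the only
  -- letter there, but its sign is `0`.
  obtain ⟨-, ⟨j, hj, hj0⟩, -⟩ := x.turn
  have : j = x.pos.castSucc := by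
    rw [h0]
    simp only [Fin.lt_def, Fin.ext_iff, Fin.val_succ, Fin.val_castSucc, Fin.val_zero] at hj h0 ⊢
    omega
  rw [this, x.letter] at hj0
  exact hj0 ((h.zero_iff c).2 rfl)

/-- The Eilenberg–Zilber surjection splits, so a word and its non-degenerate core lie in the same
subcomplexes. -/
lemma exists_word_nonDegenerate {m : ℕ} (w : Fin (m + 1) → Fin (n + 1)) :
    ∃ (l : ℕ) (f : ⦋m⦌ ⟶ ⦋l⦌) (_ : Epi f) (z : Fin (l + 1) → Fin (n + 1)),
      (∀ i : Fin l, z i.castSucc ≠ z i.succ) ∧ w = z ∘ f.toOrderHom ∧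
      (∀ B : (thick.{v}.obj ⦋n⦌).Subcomplex,
        word z ∈ B.obj (op ⦋l⦌) ↔ word w ∈ B.obj (op ⦋m⦌)) := by
  obtain ⟨l, f, hf, ⟨⟨z⟩, hz⟩, hw⟩ := (thick.{v}.obj ⦋n⦌).exists_nonDegenerate (word w)
  have hw' : w = z ∘ f.toOrderHom := congrArg ULift.down hw
  refine ⟨l, f, hf, z, (word_mem_nonDegenerate_iff z).1 hz, hw', fun B => ⟨fun h => ?_, fun h => ?_⟩⟩
  · rw [hw]
    exact B.map f.op h
  · have := isSplitEpi_of_epi f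
    have h2 := B.map (section_ f).op h
    have h3 : w ∘ (section_ f).toOrderHom = z := by
      rw [hw']
      funext i
      exact congrArg z (SimplexCategory.congr_toOrderHom_apply (IsSplitEpi.id f) i)
    change word (w ∘ (section_ f).toOrderHom) ∈ B.obj (op ⦋l⦌) at h2
    rwa [h3] at h2

lemma _root_.DescentCat.ToggleCell.countNe_eq (y : ToggleCell κ c A T) {d : ℕ} (hd : y.dim = d)
    {w : Fin (d + 1) → Fin (n + 1)} (hw : y.w ∘ y.pos.castSucc.succAbove = hd ▸ w) :
    countNe c y.w = countNe c w := by
  subst hd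
  rw [countNe_succAbove c y.w y.pos.castSucc, if_pos y.letter, hw, zero_add]

variable (h : Toggle κ c A T)

include h

/-- Every non-degenerate word of `T` not in `A` is a cell or the distinguished face of a cell. -/
lemma exists_cell {m : ℕ} (w : Fin (m + 1) → Fin (n + 1))
    (hw : ∀ i : Fin m, w i.castSucc ≠ w i.succ) (hT : word w ∈ T.obj (op ⦋m⦌))
    (hA : word w ∉ A.obj (op ⦋m⦌)) :
    (∃ (x : ToggleCell κ c A T) (hx : m = x.dim + 1), word.{v} (hx ▸ x.w) = word w) ∨
    ∃ (x : ToggleCell κ c A T) (hx : x.dim = m) (t : Fin (m + 1)), IsTurn κ w t ∧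
      (∀ i : Fin m, i.succ = t → w i.castSucc ≠ c) ∧ x.pos = hx ▸ t ∧
      x.w ∘ x.pos.castSucc.succAbove = hx ▸ w := by
  obtain ⟨t, ht⟩ := h.exists_turn w hT hA
  by_cases hc : ∀ i : Fin m, i.succ = t → w i.castSucc ≠ c
  · right
    obtain ⟨w', j, h1, h2, h3, h4, h5, h6⟩ := h.exists_cell_of_small hT hA hw ht hc
    refine ⟨⟨m, w', j, h6, h4, h5, h2, h3⟩, rfl, t, ht, hc, ?_, h1⟩
    rw [← isTurn_comp_castSucc_succAbove_iff (by rw [h2, h.zero_iff]), h1] at h3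
    exact h3.unique ht
  · left
    push Not at hc
    obtain ⟨i, rfl, hi⟩ := hc
    obtain _ | m := m
    · exact i.elim0
    exact ⟨⟨m, w, i, hw, hT, hA, hi, ht⟩, rfl, rfl⟩

lemma exists_cell_of_notMem {m : ℕ} (w : Fin (m + 1) → Fin (n + 1)) (hT : word w ∈ T.obj (op ⦋m⦌))
    (hA : word w ∉ A.obj (op ⦋m⦌)) :
    ∃ x : ToggleCell κ c A T, word.{v} w ∈ (Subcomplex.ofSimplex (word.{v} x.w)).obj (op ⦋m⦌) ∧
      (x.dim < m ∨ ∃ (hx : x.dim = m) (t : Fin (m + 1)), IsTurn κ w t ∧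
        (∀ i : Fin m, i.succ = t → w i.castSucc ≠ c) ∧
        x.w ∘ x.pos.castSucc.succAbove = hx ▸ w) := by
  obtain ⟨l, f, hf, z, hz, hwz, hB⟩ := exists_word_nonDegenerate.{v} w
  have hl : l ≤ m := SimplexCategory.len_le_of_epi f
  obtain ⟨x, hx, hxw⟩ | ⟨x, hx, t, ht, ht', hxt, hxw⟩ :=
    h.exists_cell z hz ((hB T).2 hT) (fun h' => hA ((hB A).1 h'))
  · subst hx
    refine ⟨x, ?_, Or.inl (by omega)⟩
    rw [← hB, ← hxw]
    exact Subcomplex.mem_ofSimplex_obj _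
  · subst hx
    refine ⟨x, ?_, ?_⟩
    · rw [← hB]
      refine ⟨(SimplexCategory.δ x.pos.castSucc).op, ?_⟩
      exact congrArg ULift.up hxw
    · obtain hl | hl := hl.lt_or_eq
      · exact Or.inl hl
      · right
        refine ⟨hl, ?_⟩
        subst hl
        have : IsIso f := (SimplexCategory.isIso_iff_of_epi f).2 rfl
        obtain rfl := SimplexCategory.eq_id_of_isIso f
        obtain rfl : w = z := hwz
        exact ⟨t, ht, ht', hxw⟩

/-- A face outside `A` lies in a cell of smaller dimension or is the distinguished face of a cell of
the same dimension. In the second case the deleted letter cannot be `c`, since otherwise `c` would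
still precede the turn; hence the number of letters different from `c` drops by one. -/
lemma face_mem_cells (x : ToggleCell κ c A T) (q : Fin (x.dim + 2)) (hq : q ≠ x.pos.castSucc) :
    word (x.w ∘ q.succAbove) ∈ (A ⊔ ⨆ (y : ToggleCell κ c A T),
      ⨆ (_ : y.rank < x.rank), Subcomplex.ofSimplex (word.{v} y.w)).obj (op ⦋x.dim⦌) := by
  by_cases hA : word (x.w ∘ q.succAbove) ∈ A.obj (op ⦋x.dim⦌)
  · exact Or.inl hA
  obtain ⟨y, hy, hxy⟩ := h.exists_cell_of_notMem _ (T.map (SimplexCategory.δ q).op x.mem) hA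
  have key : y.rank < x.rank → word (x.w ∘ q.succAbove) ∈ (A ⊔ ⨆ (y : ToggleCell κ c A T),
      ⨆ (_ : y.rank < x.rank), Subcomplex.ofSimplex (word.{v} y.w)).obj (op ⦋x.dim⦌) := fun hr =>
    (le_sup_of_le_right ((le_iSup (fun _ : y.rank < x.rank => Subcomplex.ofSimplex (word.{v} y.w))
      hr).trans (le_iSup (fun y : ToggleCell κ c A T =>
        ⨆ (_ : y.rank < x.rank), Subcomplex.ofSimplex (word.{v} y.w)) y))) _ hy
  apply key
  obtain hlt | ⟨hd, t, ht, ht', hw⟩ := hxy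
  · exact ToggleCell.rank_lt hlt
  · have hwq : x.w q ≠ c := fun hwq => by
      obtain ⟨i, hi, hi'⟩ := x.turn.exists_of_succAbove ((h.zero_iff c).2 rfl) x.letter hwq hq ht
      exact ht' i hi hi'
    have h1 := countNe_succAbove c x.w q
    rw [if_neg hwq] at h1
    have h2 := y.countNe_eq hd hw
    change countNe c y.w = countNe c (x.w ∘ q.succAbove) at h2
    simp only [ToggleCell.rank, hd]
    omega

/-- If `y` has the dimension of the face, it equals the face, which has no `c` before its turn.
Otherwise the face is obtained from `y` by deleting one letter: deleting the distinguished `c` gives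
`y = x`, deleting another `c` leaves `c` before the turn, and deleting a different letter makes the
rank of `y` larger than that of `x`. -/
lemma face_notMem_cell (x y : ToggleCell κ c A T) (hxy : y ≠ x) (hr : y.rank ≤ x.rank) :
    word (x.w ∘ x.pos.castSucc.succAbove) ∉
      (Subcomplex.ofSimplex (word.{v} y.w)).obj (op ⦋x.dim⦌) := by
  intro hmem
  obtain ⟨f, hf⟩ := (Subcomplex.mem_ofSimplex_obj_iff _ _).1 hmem
  have hnd := (word_mem_nonDegenerate_iff.{v} (x.w ∘ x.pos.castSucc.succAbove)).2
    (h.face_nonDegenerate x.nonDegenerate x.letter x.turn)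
  have : Mono f := SSet.mono_of_nonDegenerate _ ⟨_, hnd⟩ f _ hf
  have hle : x.dim ≤ y.dim + 1 := SimplexCategory.le_of_mono f
  have hle' : y.dim ≤ x.dim := by
    by_contra! hlt
    exact absurd (ToggleCell.rank_lt hlt) (not_lt.2 hr)
  have hsmall := not_letter_of_face x.nonDegenerate x.letter
  have htx := (isTurn_comp_castSucc_succAbove_iff (by rw [x.letter, h.zero_iff])).2 x.turn
  obtain hd | hd : x.dim = y.dim + 1 ∨ x.dim = y.dim := by omega
  · obtain ⟨d, w, j, hw, hT, hA, hj, ht⟩ := x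
    subst hd
    obtain rfl := SimplexCategory.eq_id_of_mono f
    have hf' : y.w = w ∘ j.castSucc.succAbove := congrArg ULift.down hf
    simp only at htx hsmall
    rw [← hf'] at htx
    refine hsmall y.pos (y.turn.unique htx) ?_
    change (w ∘ j.castSucc.succAbove) _ = c
    rw [← hf', y.letter]
  · obtain ⟨d, w, j, hw, hT, hA, hj, ht⟩ := x
    obtain ⟨d', w', j', hw', hT', hA', hj', ht'⟩ := y
    obtain rfl : d = d' := hd
    obtain ⟨q, rfl⟩ := SimplexCategory.eq_δ_of_mono f
    have hf' : w' ∘ q.succAbove = w ∘ j.castSucc.succAbove := congrArg ULift.down hf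
    simp only [ToggleCell.rank] at htx hsmall hr
    by_cases hq : q = j'.castSucc
    · subst hq
      obtain ⟨rfl, rfl⟩ := h.eq_of_face_eq hj' hj ht' ht hf'
      exact hxy rfl
    · by_cases hwq : w' q = c
      · rw [← hf'] at htx
        obtain ⟨i, hi, hi'⟩ := ht'.exists_of_succAbove ((h.zero_iff c).2 rfl) hj' hwq hq htx
        refine hsmall i hi ?_
        change (w ∘ j.castSucc.succAbove) _ = c
        rw [← hf']
        exact hi'
      · have h1 := countNe_succAbove c w' q
        have h2 := countNe_succAbove c w j.castSucc
        rw [if_neg hwq, hf'] at h1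
        rw [if_pos hj] at h2
        omega

/-- The cell structure of `T` over `A` given by insertion of letters before the turns of words. -/
def cells : Cells A T where
  ι := ToggleCell κ c A T
  dim := ToggleCell.dim
  simplex x := word x.w
  idx x := x.pos.castSucc
  rank := ToggleCell.rank
  finite := ToggleCell.finite_rank
  nonDegenerate x := (word_mem_nonDegenerate_iff _).2 x.nonDegenerate
  nonDegenerate_face x := (word_mem_nonDegenerate_iff.{v} (x.w ∘ x.pos.castSucc.succAbove)).2
    (h.face_nonDegenerate x.nonDegenerate x.letter x.turn)
  face_mem := h.face_mem_cells
  face_notMem x := h.remove_notMem _ _ x.letter x.turn x.mem x.notMem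
  face_notMem_cell := h.face_notMem_cell
  sup_eq := by
    refine le_antisymm (sup_le h.le (iSup_le fun x => (Subcomplex.ofSimplex_le_iff _ _).2 x.mem)) ?_
    rintro ⟨l⟩ ⟨w⟩ hw
    by_cases hA : word w ∈ A.obj (op ⦋l.len⦌)
    · exact Or.inl hA
    · obtain ⟨x, hx, -⟩ := h.exists_cell_of_notMem w hw hA
      exact (le_sup_of_le_right (le_iSup_of_le x le_rfl) : Subcomplex.ofSimplex (word.{v} x.w) ≤ _) _ hx

end Toggle

/-! ### Toggles are expansions for a `k`-category. -/

section

variable {cover : MorphismProperty C} {k : ℕ} {X : SimplicialObject C}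

lemma IsKCategory.expansion_horn (hC : IsDescentCategory cover) (hX : IsKCategory cover k X) {n : ℕ}
    (i : Fin (n + 1)) (h0 : 0 < i) (hn : i < Fin.last n) :
    expansion cover.presheaf X (SSet.horn.{v} n i).ι := by
  have := hC.hasFiniteLimits
  have := hC.stableUnderBaseChange
  exact (representedBy_iff.1 (hX.cover_horn n i h0 hn)).1

variable {n : ℕ} {κ : Fin (n + 1) → SignType} {c : Fin (n + 1)}
  {A T : (thick.{v}.obj ⦋n⦌).Subcomplex} (h : Toggle κ c A T)

namespace Toggle

include h

lemma isStep (hC : IsDescentCategory cover) (hX : IsKCategory cover k X) (x : h.cells.ι) :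
    h.cells.IsStep cover.presheaf X x :=
  h.cells.isStep_of_horn (hX.expansion_horn hC _ (Fin.pos_iff_ne_zero.2 (h.pos_ne_zero x))
    (Fin.castSucc_lt_last _))

lemma isStep_isomorphisms (hX : IsKCategory cover k X) (x : h.cells.ι) (hx : k ≤ x.dim) :
    h.cells.IsStep (.isomorphisms _) X x :=
  h.cells.isStep_of_horn (hX.iso_horn _ _ (Fin.pos_iff_ne_zero.2 (h.pos_ne_zero x))
    (Fin.castSucc_lt_last _) (Nat.lt_succ_of_le hx))

theorem expansion_homOfLE (hC : IsDescentCategory cover) (hX : IsKCategory cover k X) :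
    expansion cover.presheaf X (SSet.Subcomplex.homOfLE h.le) := by
  have := hC.multiplicative
  have := hC.stableUnderBaseChange
  -- A cell with `dim < k` has rank at most `(k + 1) ^ 2 + (k + 1)`. Beyond the chosen bound the
  -- horn therefore has dimension `dim + 1 > k` and is filled uniquely.
  refine h.cells.expansion_homOfLE (h.isStep hC hX) ((k + 2) ^ 2 + (k + 2)) fun x hx =>
    h.isStep_isomorphisms hX x ?_
  have h1 : (k + 2) ^ 2 + (k + 2) ≤ (x.dim + 2) ^ 2 + countNe c x.w := hx
  have h2 := countNe_le c x.w
  by_contra! h3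
  nlinarith

theorem isomorphisms_homOfLE (hX : IsKCategory cover k X)
    (hdim : ∀ x : ToggleCell κ c A T, k ≤ x.dim) :
    expansion (.isomorphisms _) X (SSet.Subcomplex.homOfLE h.le) :=
  h.cells.expansion_homOfLE (fun x => h.isStep_isomorphisms hX x (hdim x)) 0
    fun x _ => h.isStep_isomorphisms hX x (hdim x)

end Toggle

end

/-! ### Subcomplexes of thick simplices -/

section WordSub

variable {n : ℕ}

/-- The subcomplex of a thick simplex of words satisfying a condition. -/
def wordSub (p : ∀ ⦃m : ℕ⦄, (Fin (m + 1) → Fin (n + 1)) → Prop)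
    (hp : ∀ ⦃m l : ℕ⦄ (f : Fin (l + 1) →o Fin (m + 1)) (w : Fin (m + 1) → Fin (n + 1)),
      p w → p (w ∘ f)) : (thick.{v}.obj ⦋n⦌).Subcomplex where
  obj m := {x | p (m := m.unop.len) x.down}
  map f x hx := hp f.unop.toOrderHom x.down hx

variable {p q : ∀ ⦃m : ℕ⦄, (Fin (m + 1) → Fin (n + 1)) → Prop}
  {hp : ∀ ⦃m l : ℕ⦄ (f : Fin (l + 1) →o Fin (m + 1)) (w : Fin (m + 1) → Fin (n + 1)),
      p w → p (w ∘ f)}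
  {hq : ∀ ⦃m l : ℕ⦄ (f : Fin (l + 1) →o Fin (m + 1)) (w : Fin (m + 1) → Fin (n + 1)),
      q w → q (w ∘ f)}

lemma subcomplex_ext_word {S T : (thick.{v}.obj ⦋n⦌).Subcomplex}
    (h : ∀ {m : ℕ} (w : Fin (m + 1) → Fin (n + 1)),
      word w ∈ S.obj (op ⦋m⦌) ↔ word w ∈ T.obj (op ⦋m⦌)) : S = T := by
  ext ⟨m⟩ ⟨w⟩
  exact h (m := m.len) w

lemma word_mem_range_iff {Y : SSet.{v}} (f : Y ⟶ thick.{v}.obj ⦋n⦌) {m : ℕ}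
    (w : Fin (m + 1) → Fin (n + 1)) :
    word w ∈ (SSet.Subcomplex.range f).obj (op ⦋m⦌) ↔
      ∃ y : Y.obj (op ⦋m⦌), (f.app (op ⦋m⦌) y).down = w := by
  constructor
  · rintro ⟨y, hy⟩; exact ⟨y, congrArg ULift.down hy⟩
  · rintro ⟨y, hy⟩; exact ⟨y, congrArg ULift.up hy⟩

/-- The standard simplex as a subcomplex of the thick simplex. -/
def monotoneSub (n : ℕ) : (thick.{v}.obj ⦋n⦌).Subcomplex :=
  wordSub (fun _ w => Monotone w) fun _ _ f _ h => h.comp f.monotone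

lemma range_toThick (n : ℕ) :
    SSet.Subcomplex.range (toThick.{v}.app ⦋n⦌) = monotoneSub n := by
  refine subcomplex_ext_word fun {m} w => ?_
  rw [word_mem_range_iff]
  constructor
  · rintro ⟨y, rfl⟩
    exact (SSet.stdSimplex.objEquiv y).toOrderHom.monotone
  · exact fun h => ⟨SSet.stdSimplex.objEquiv.symm (SimplexCategory.mkHom ⟨w, h⟩), rfl⟩

lemma toThick_app_injective (n : SimplexCategory) (m : SimplexCategoryᵒᵖ) :
    Function.Injective ((toThick.{v}.app n).app m) := by
  intro x y hxy
  apply SSet.stdSimplex.objEquiv.injective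
  ext1
  exact OrderHom.ext _ _ (congrArg ULift.down hxy)

instance (n : SimplexCategory) : Mono (toThick.{v}.app n) := by
  have := fun m => (mono_iff_injective _).2 (toThick_app_injective.{v} n m)
  exact NatTrans.mono_of_mono_app _

lemma thick_map_app_injective {a b : SimplexCategory} (f : a ⟶ b) [Mono f]
    (m : SimplexCategoryᵒᵖ) : Function.Injective ((thick.{v}.map f).app m) := by
  rintro ⟨x⟩ ⟨y⟩ hxy
  have h : f.toOrderHom ∘ x = f.toOrderHom ∘ y := congrArg ULift.down hxy
  exact congrArg ULift.up ((SimplexCategory.mono_iff_injective.1 ‹_›).comp_left h)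

variable {κ : Fin (n + 1) → SignType} {c : Fin (n + 1)}

lemma Toggle.of_wordSub (h0 : ∀ x, κ x = 0 ↔ x = c)
    (hpq : ∀ {m : ℕ} (w : Fin (m + 1) → Fin (n + 1)), p w → q w)
    (turn : ∀ {m : ℕ} (w : Fin (m + 1) → Fin (n + 1)), q w → ¬ p w → ∃ t, IsTurn κ w t)
    (insert : ∀ {m : ℕ} (w : Fin (m + 2) → Fin (n + 1)) (j : Fin (m + 1)), w j.castSucc = c →
      IsTurn κ w j.succ → q (w ∘ j.castSucc.succAbove) → ¬ p (w ∘ j.castSucc.succAbove) → q w)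
    (remove : ∀ {m : ℕ} (w : Fin (m + 2) → Fin (n + 1)) (j : Fin (m + 1)), w j.castSucc = c →
      IsTurn κ w j.succ → q w → ¬ p w → ¬ p (w ∘ j.castSucc.succAbove)) :
    Toggle κ c (wordSub.{v} p hp) (wordSub q hq) :=
  ⟨h0, fun _ w hw => hpq w.down hw, turn, insert, remove⟩

lemma Toggle.of_wordSub_top (h0 : ∀ x, κ x = 0 ↔ x = c)
    (turn : ∀ {m : ℕ} (w : Fin (m + 1) → Fin (n + 1)), ¬ p w → ∃ t, IsTurn κ w t)
    (remove : ∀ {m : ℕ} (w : Fin (m + 2) → Fin (n + 1)) (j : Fin (m + 1)), w j.castSucc = c →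
      IsTurn κ w j.succ → ¬ p w → ¬ p (w ∘ j.castSucc.succAbove)) :
    Toggle κ c (wordSub.{v} p hp) ⊤ :=
  ⟨h0, le_top, fun w _ => turn w, fun _ _ _ _ _ _ => trivial, fun w j hj ht _ => remove w j hj ht⟩

end WordSub

/-! ### Expansions between subcomplexes. -/

section ExpansionSub

variable (W : MorphismProperty (Cᵒᵖ ⥤ Type v)) (X : SimplicialObject C) {Z : SSet.{v}}

lemma expansion_homOfLE_congr {S T S' T' : Z.Subcomplex} {h : S ≤ T}
    (hW : expansion W X (SSet.Subcomplex.homOfLE h)) (hS : S = S') (hT : T = T') (h' : S' ≤ T') :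
    expansion W X (SSet.Subcomplex.homOfLE h') := by
  subst hS hT
  exact hW

variable [W.IsStableUnderBaseChange]

lemma expansion_range_iff {Y : SSet.{v}} (f : Y ⟶ Z) [Mono f] :
    expansion W X (SSet.Subcomplex.range f).ι ↔ expansion W X f := by
  have : IsIso (SSet.Subcomplex.toRange f) := by
    have := mono_of_mono_fac (SSet.Subcomplex.toRange_ι f)
    exact isIso_of_mono_of_epi _
  rw [← (expansion W X).cancel_left_of_respectsIso (SSet.Subcomplex.toRange f),
    SSet.Subcomplex.toRange_ι]

lemma expansion_ι_iff (S : Z.Subcomplex) :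
    expansion W X S.ι ↔ expansion W X (SSet.Subcomplex.homOfLE (le_top : S ≤ ⊤)) := by
  rw [← (expansion W X).cancel_right_of_respectsIso _ (⊤ : Z.Subcomplex).ι]
  rfl

end ExpansionSub

/-! ### Signs given by comparison with a letter. -/

section Side

variable {n m : ℕ}

/-- The position of a letter with respect to `c`. -/
noncomputable def side (c x : Fin (n + 1)) : SignType := SignType.sign ((c : ℤ) - x)

lemma side_eq_zero_iff {c x : Fin (n + 1)} : side c x = 0 ↔ x = c := by
  rw [side, sign_eq_zero_iff, Fin.ext_iff]; omega

lemma side_eq_one_iff {c x : Fin (n + 1)} : side c x = 1 ↔ x < c := by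
  rw [side, sign_eq_one_iff, Fin.lt_def]; omega

lemma side_eq_neg_one_iff {c x : Fin (n + 1)} : side c x = -1 ↔ c < x := by
  rw [side, sign_eq_neg_one_iff, Fin.lt_def]; omega

lemma side_cases {c x y : Fin (n + 1)} (hx : side c x ≠ 0) (hxy : side c y ≠ side c x) :
    c < x ∧ y ≤ c ∨ x < c ∧ c ≤ y := by
  obtain h | h | h := lt_trichotomy c x
  · left
    refine ⟨h, not_lt.1 fun h' => hxy ?_⟩
    rw [side_eq_neg_one_iff.2 h, side_eq_neg_one_iff.2 h']
  · exact absurd (side_eq_zero_iff.2 h.symm) hx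
  · right
    refine ⟨h, not_lt.1 fun h' => hxy ?_⟩
    rw [side_eq_one_iff.2 h, side_eq_one_iff.2 h']

lemma isTurn_side_cases {c : Fin (n + 1)} {w : Fin (m + 1) → Fin (n + 1)} {t : Fin (m + 1)}
    (h : IsTurn (side c) w t) :
    (c < w t ∧ (∀ a < t, w a ≤ c) ∧ ∃ a < t, w a < c) ∨
      (w t < c ∧ (∀ a < t, c ≤ w a) ∧ ∃ a < t, c < w a) := by
  obtain ⟨h0, ⟨a, hat, ha⟩, ht⟩ := h
  obtain ⟨h1, h2⟩ | ⟨h1, h2⟩ := side_cases h0 (ht a hat)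
  · refine Or.inl ⟨h1, fun b hb => ?_, a, hat, h2.lt_of_ne fun h => ha (side_eq_zero_iff.2 h)⟩
    obtain h | h := side_cases h0 (ht b hb)
    · exact h.2
    · exact absurd h1 h.1.not_gt
  · refine Or.inr ⟨h1, fun b hb => ?_, a, hat, h2.lt_of_ne' fun h => ha (side_eq_zero_iff.2 h)⟩
    obtain h | h := side_cases h0 (ht b hb)
    · exact absurd h1 h.1.not_gt
    · exact h.2

lemma exists_isTurn_side {c : Fin (n + 1)} {w : Fin (m + 1) → Fin (n + 1)} {a b : Fin (m + 1)}
    (ha : w a < c) (hb : c < w b) : ∃ t, IsTurn (side c) w t :=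
  exists_isTurn (side_eq_one_iff.2 ha) (side_eq_neg_one_iff.2 hb)

/-- The letter `w a` is also a letter of the word obtained by removing another letter. -/
lemma exists_comp_succAbove_eq (w : Fin (m + 2) → Fin (n + 1)) {q a : Fin (m + 2)} (h : w a ≠ w q) :
    ∃ b, (w ∘ q.succAbove) b = w a := by
  obtain ⟨b, rfl⟩ := Fin.exists_succAbove_eq (x := a) (y := q) (fun h' => h (by rw [h']))
  exact ⟨b, rfl⟩

lemma forall_comp_succAbove_le {w : Fin (m + 2) → Fin (n + 1)} {q : Fin (m + 2)}
    (h : Monotone (w ∘ q.succAbove)) {a b : Fin (m + 2)} (ha : a ≠ q) (hb : b ≠ q) (hab : a ≤ b) :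
    w a ≤ w b := by
  obtain ⟨a, rfl⟩ := Fin.exists_succAbove_eq ha
  obtain ⟨b, rfl⟩ := Fin.exists_succAbove_eq hb
  exact h ((Fin.strictMono_succAbove q).le_iff_le.1 hab)

/-- If the rest of the word is monotone, the turn passes from letters at most `c` to a letter above
`c`, and `c` fits between them. -/
lemma monotone_of_isTurn_side {c : Fin (n + 1)} {w : Fin (m + 2) → Fin (n + 1)} {j : Fin (m + 1)}
    (hj : w j.castSucc = c) (ht : IsTurn (side c) w j.succ)
    (h : Monotone (w ∘ j.castSucc.succAbove)) : Monotone w := by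
  have hne : ∀ {a}, w a ≠ c → a ≠ j.castSucc := fun h h' => h (by rw [h', hj])
  obtain ⟨h1, h2, -⟩ | ⟨h1, -, a, ha, hca⟩ := isTurn_side_cases ht
  · intro a b hab
    by_cases ha : a = j.castSucc
    · by_cases hb : b = j.castSucc
      · rw [ha, hb]
      · rw [ha, hj]
        refine h1.le.trans (forall_comp_succAbove_le h (hne h1.ne') hb ?_)
        rw [ha] at hab
        exact Fin.castSucc_lt_iff_succ_le.1 (lt_of_le_of_ne hab (Ne.symm hb))
    · by_cases hb : b = j.castSucc
      · rw [hb, hj]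
        rw [hb] at hab
        exact h2 a (lt_of_le_of_lt hab Fin.castSucc_lt_succ)
      · exact forall_comp_succAbove_le h ha hb hab
  · exact absurd (forall_comp_succAbove_le h (hne hca.ne') (hne h1.ne) ha.le)
      (not_le.2 (h1.trans hca))

end Side

/-! ### Thick horns -/

section ThickHorn

variable {n : ℕ}

/-- The words that miss a letter different from `i`. -/
def thickHorn (i : Fin (n + 1)) : (thick.{v}.obj ⦋n⦌).Subcomplex :=
  wordSub (fun _ w => ∃ j ≠ i, ∀ a, w a ≠ j) fun _ _ f _ ⟨j, hj, h⟩ => ⟨j, hj, fun a => h (f a)⟩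

/-- A function distinguishing `i`, `a`, and the remaining letters. -/
def pick (i a x : Fin (n + 1)) : SignType := if x = i then 0 else if x = a then 1 else -1

/-- A word outside the horn contains every letter different from `i`. For `n ≥ 2` these can be split
into two nonempty sign classes, and deleting an `i` removes none of them. -/
lemma toggle_thickHorn (i : Fin (n + 1)) (hn : 2 ≤ n) :
    ∃ κ, Toggle κ i (thickHorn.{v} i) ⊤ := by
  obtain ⟨a, ha⟩ : ∃ a, a ≠ i := by
    by_contra! h
    have h0 := h 0
    have h1 := h (Fin.last n)
    rw [← h0, Fin.ext_iff] at h1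
    simp at h1
    omega
  obtain ⟨b, hb⟩ : ∃ b, b ∉ ({i, a} : Finset (Fin (n + 1))) := by
    by_contra! h
    have h1 := Finset.card_le_card (fun x _ => h x : Finset.univ ⊆ ({i, a} : Finset (Fin (n + 1))))
    have h2 := Finset.card_le_two (a := i) (b := a)
    simp at h1
    omega
  simp only [Finset.mem_insert, Finset.mem_singleton, not_or] at hb
  refine ⟨pick i a, Toggle.of_wordSub_top (fun x => ?_) (fun w hw => ?_)
    fun w j hj _ hw hw' => hw ?_⟩
  · unfold pick; split_ifs <;> simp_all
  · push Not at hw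
    obtain ⟨s, hs⟩ := hw a ha
    obtain ⟨t, ht⟩ := hw b hb.1
    refine exists_isTurn (a := s) (b := t) ?_ ?_
    · rw [hs, pick, if_neg ha, if_pos rfl]
    · rw [ht, pick, if_neg hb.1, if_neg hb.2]
  · obtain ⟨l, hl, h⟩ := hw'
    refine ⟨l, hl, fun s hs => ?_⟩
    obtain ⟨t, ht⟩ := exists_comp_succAbove_eq w (q := j.castSucc) (a := s) (by rw [hs, hj]; exact hl)
    exact h t (ht.trans hs)

/-- The word of a cell uses all `n + 1` letters, including `i`, and has length `dim + 2`. Hence all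
the horns that are filled have dimension at least `n`. -/
lemma le_dim_of_toggleCell_thickHorn {i : Fin (n + 1)} {κ : Fin (n + 1) → SignType}
    (x : ToggleCell κ i (thickHorn.{v} i) ⊤) : n ≤ x.dim + 1 := by
  have h : Function.Surjective x.w := fun l => by
    by_cases hl : l = i
    · exact ⟨_, x.letter.trans hl.symm⟩
    · have : ¬ ∃ j ≠ i, ∀ a, x.w a ≠ j := x.notMem
      push Not at this
      exact this l hl
  have := Fintype.card_le_of_surjective _ h
  simpa using this

variable {cover : MorphismProperty C} {k : ℕ} {X : SimplicialObject C}

theorem IsKCategory.expansion_thickHorn (hC : IsDescentCategory cover) (hX : IsKCategory cover k X)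
    (hn : 2 ≤ n) (i : Fin (n + 1)) : expansion cover.presheaf X (thickHorn.{v} i).ι := by
  have := hC.stableUnderBaseChange
  obtain ⟨κ, h⟩ := toggle_thickHorn.{v} i hn
  exact (expansion_ι_iff _ _ _).2 (h.expansion_homOfLE hC hX)

theorem IsKCategory.isomorphisms_thickHorn (hX : IsKCategory cover k X) (hn : 2 ≤ n) (hk : k < n)
    (i : Fin (n + 1)) : expansion (.isomorphisms _) X (thickHorn.{v} i).ι := by
  obtain ⟨κ, h⟩ := toggle_thickHorn.{v} i hn
  exact (expansion_ι_iff _ _ _).2 (h.isomorphisms_homOfLE hX fun x => by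
    have := le_dim_of_toggleCell_thickHorn x
    omega)

end ThickHorn

/-! ### From standard simplices to thick simplices -/

section Spine

variable {n : ℕ}

/-- The words which are monotone, or miss the last letter, or have only the last two letters. -/
def spineSub (n : ℕ) : (thick.{v}.obj ⦋n + 2⦌).Subcomplex :=
  wordSub (fun _ w => Monotone w ∨ (∀ a, w a ≠ Fin.last (n + 2)) ∨
      ∀ a, (Fin.last (n + 1)).castSucc ≤ w a) fun _ _ f _ h =>
    h.imp (fun h => h.comp f.monotone) (Or.imp (fun h a => h (f a)) fun h a => h (f a))

/-- A word outside `spineSub` has the last letter and a letter below the penultimate one, hence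
letters on both sides of the penultimate letter. -/
lemma toggle_spineSub (n : ℕ) :
    Toggle (side (Fin.last (n + 1)).castSucc) (Fin.last (n + 1)).castSucc (spineSub.{v} n) ⊤ := by
  refine Toggle.of_wordSub_top (fun x => side_eq_zero_iff) (fun w hw => ?_)
    fun w j hj ht hw hw' => hw ?_
  · push Not at hw
    obtain ⟨-, ⟨b, hb⟩, a, ha⟩ := hw
    exact exists_isTurn_side ha (hb ▸ Fin.castSucc_lt_last _)
  · obtain h | h | h := hw'
    · exact Or.inl (monotone_of_isTurn_side hj ht h)
    · refine Or.inr (Or.inl fun a ha => ?_)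
      obtain ⟨b, hb⟩ := exists_comp_succAbove_eq w (q := j.castSucc) (a := a)
        (by rw [ha, hj]; exact (Fin.castSucc_lt_last _).ne')
      exact h b (hb.trans ha)
    · refine Or.inr (Or.inr fun a => ?_)
      by_cases ha : a = j.castSucc
      · rw [ha, hj]
      · obtain ⟨a, rfl⟩ := Fin.exists_succAbove_eq ha
        exact h a

lemma expansion_monotoneSub_iff (W : MorphismProperty (Cᵒᵖ ⥤ Type v)) [W.IsStableUnderBaseChange]
    (X : SimplicialObject C) (n : ℕ) :
    expansion W X (monotoneSub.{v} n).ι ↔ expansion W X (toThick.{v}.app ⦋n⦌) := by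
  rw [← range_toThick, expansion_range_iff]

/-- Attaching a thick face to a subcomplex of a thick simplex that meets it in a standard simplex. -/
lemma expansion_sup_range_thick (W : MorphismProperty (Cᵒᵖ ⥤ Type v)) [W.IsStableUnderBaseChange]
    (X : SimplicialObject C) {m : ℕ} (f : ⦋m⦌ ⟶ ⦋n⦌) [Mono f] (L : (thick.{v}.obj ⦋n⦌).Subcomplex)
    (hL : L.preimage (thick.{v}.map f) = monotoneSub m)
    (h : expansion W X (toThick.{v}.app ⦋m⦌)) :
    expansion W X (SSet.Subcomplex.homOfLE
      (le_sup_left : L ≤ L ⊔ SSet.Subcomplex.range (thick.{v}.map f))) := by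
  refine expansion_attach W X _ L (fun l x y _ _ hxy => thick_map_app_injective f l hxy) ?_
  rwa [hL, expansion_monotoneSub_iff]

lemma monotone_comp_iff {m l : ℕ} (f : ⦋m⦌ ⟶ ⦋n⦌) [Mono f] (w : Fin (l + 1) → Fin (m + 1)) :
    Monotone (f.toOrderHom ∘ w) ↔ Monotone w := by
  have := f.toOrderHom.monotone.strictMono_of_injective (SimplexCategory.mono_iff_injective.1 ‹_›)
  exact forall_congr' fun a => forall_congr' fun b => forall_congr' fun _ => this.le_iff_le

variable {cover regular : MorphismProperty C} {k : ℕ} {X : SimplicialObject C}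

/-- By induction, a thick face and then a thick edge are attached to the standard simplex. Both meet
the previous stage in a standard simplex, so these steps are regular. The remaining words are
attached along inner horns. -/
theorem IsRegularKCategory.expansion_toThick (hC : IsRegularDescentCategory cover regular)
    (hX : IsRegularKCategory cover regular k X) (n : ℕ) :
    expansion regular.presheaf X (toThick.{v}.app ⦋n⦌) := by
  have := hC.hasFiniteLimits
  have := hC.regular_stableUnderBaseChange
  have := hC.regular_multiplicative
  have h1 : expansion regular.presheaf X (toThick.{v}.app ⦋1⦌) :=
    (representedBy_iff.1 hX.regular_thick).1
  induction n with
  | zero =>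
    rw [← expansion_monotoneSub_iff, expansion_ι_iff]
    have : monotoneSub.{v} 0 = ⊤ := by
      refine subcomplex_ext_word fun w => iff_of_true (fun a b _ => ?_) trivial
      exact (Subsingleton.elim (α := Fin 1) (w a) (w b)).le
    exact expansion_homOfLE_congr _ _ (h := le_refl _) ((expansion regular.presheaf X).id_mem _)
      this.symm rfl _
  | succ n ih =>
    obtain _ | n := n
    · exact h1
    rw [← expansion_monotoneSub_iff, expansion_ι_iff]
    have h2 := expansion_sup_range_thick regular.presheaf X
      (SimplexCategory.δ (Fin.last (n + 2))) (monotoneSub.{v} (n + 2))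
      (subcomplex_ext_word fun w => monotone_comp_iff (SimplexCategory.δ (Fin.last (n + 2))) w) ih
    let e : ⦋1⦌ ⟶ ⦋n + 2⦌ := SimplexCategory.mkOfSucc (Fin.last (n + 1))
    have he0 : e.toOrderHom 0 = (Fin.last (n + 1)).castSucc := rfl
    have he1 : e.toOrderHom 1 = Fin.last (n + 2) := rfl
    have : Mono e := by
      rw [SimplexCategory.mono_iff_injective]
      intro a b hab
      fin_cases a <;> fin_cases b
      · rfl
      · exact absurd (he0.symm.trans (hab.trans he1)) (Fin.castSucc_lt_last _).ne
      · exact absurd (he0.symm.trans (hab.symm.trans he1)) (Fin.castSucc_lt_last _).ne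
      · rfl
    have hδ : ∀ {m : ℕ} (w : Fin (m + 1) → Fin (n + 3)), word w ∈ (SSet.Subcomplex.range
        (thick.{v}.map (SimplexCategory.δ (Fin.last (n + 2))))).obj (op ⦋m⦌) ↔
        ∀ a, w a ≠ Fin.last (n + 2) := by
      intro m w
      rw [word_mem_range_iff]
      constructor
      · rintro ⟨⟨y⟩, rfl⟩ a
        exact Fin.succAbove_ne _ _
      · intro h
        choose y hy using fun a => Fin.exists_succAbove_eq (h a)
        exact ⟨⟨y⟩, funext hy⟩
    have he : ∀ {m : ℕ} (w : Fin (m + 1) → Fin (n + 3)), word w ∈ (SSet.Subcomplex.range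
        (thick.{v}.map e)).obj (op ⦋m⦌) ↔ ∀ a, (Fin.last (n + 1)).castSucc ≤ w a := by
      intro m w
      rw [word_mem_range_iff]
      constructor
      · rintro ⟨⟨y⟩, rfl⟩ a
        rw [← he0]
        exact e.toOrderHom.monotone (Fin.zero_le _)
      · intro h
        refine ⟨⟨fun a => if w a = Fin.last _ then 1 else 0⟩, funext fun a => ?_⟩
        change e.toOrderHom (if w a = Fin.last _ then 1 else 0) = w a
        split_ifs with hw
        · rw [he1, hw]
        · rw [he0]
          refine le_antisymm (h a) (Fin.le_def.2 ?_)
          have := Fin.val_lt_last hw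
          simp only [Fin.val_castSucc, Fin.val_last]
          omega
    -- On the last edge, a word missing the last letter is constant. The thick face thus contributes
    -- nothing beyond monotone words to the intersection.
    have h3 := expansion_sup_range_thick regular.presheaf X e
      (monotoneSub.{v} (n + 2) ⊔ SSet.Subcomplex.range
        (thick.{v}.map (SimplexCategory.δ (Fin.last (n + 2)))))
      (subcomplex_ext_word fun w => by
        constructor
        · rintro (h | h)
          · exact (monotone_comp_iff e w).1 h
          · intro a b _
            have h' := (hδ (e.toOrderHom ∘ w)).1 h
            have : ∀ a, w a = 0 := fun a => by
              by_contra ha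
              exact h' a ((congrArg e.toOrderHom (Fin.eq_one_of_ne_zero _ ha)).trans he1)
            exact ((this a).trans (this b).symm).le
        · exact fun h => Or.inl ((monotone_comp_iff e w).2 h)) h1
    have h4 := (toggle_spineSub.{v} n).expansion_homOfLE hC.toIsDescentCategory hX.toIsKCategory
    have h5 : expansion regular.presheaf X (SSet.Subcomplex.homOfLE (toggle_spineSub.{v} n).le) :=
      MorphismProperty.relative_monotone hC.cover_le_regular _ h4
    have hs : monotoneSub.{v} (n + 2) ⊔ SSet.Subcomplex.range
        (thick.{v}.map (SimplexCategory.δ (Fin.last (n + 2)))) ⊔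
          SSet.Subcomplex.range (thick.{v}.map e) = spineSub n := by
      refine subcomplex_ext_word fun w => ?_
      refine Iff.trans (or_congr (or_congr Iff.rfl (hδ w)) (he w)) or_assoc
    have h6 := (expansion regular.presheaf X).comp_mem _ _ h2 h3
    have h7 := expansion_homOfLE_congr _ _ (h := le_sup_left.trans le_sup_left) h6 rfl hs
      (hs ▸ le_sup_left.trans le_sup_left)
    exact (expansion regular.presheaf X).comp_mem _ _ h7 h5

lemma IsRegularKCategory.isRepresentable_mapSpace_thick
    (hC : IsRegularDescentCategory cover regular)
    (hX : IsRegularKCategory cover regular k X) (n : ℕ) :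
    (mapSpace (thick.{v}.obj ⦋n⦌) X).IsRepresentable :=
  isRepresentable_of_presheaf (hX.expansion_toThick hC n) (isRepresentable_mapStdSimplex _ _)

end Spine

/-! ### Outer horns with an invertible edge -/

section OuterHorn

variable {n m : ℕ}

/-- From the first letter that is at least `2`, the word is increasing. -/
def IsSorted (w : Fin (m + 1) → Fin (n + 3)) : Prop :=
  ∀ a b, a ≤ b → 2 ≤ (w a : ℕ) → w a ≤ w b

lemma IsSorted.comp {l : ℕ} {w : Fin (m + 1) → Fin (n + 3)} (h : IsSorted w)
    (f : Fin (l + 1) →o Fin (m + 1)) : IsSorted (w ∘ f) :=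
  fun _ _ hab ha => h _ _ (f.monotone hab) ha

/-- The monotone words missing a letter different from `0`, and the words with letters `0`, `1`. -/
def IsOuterHorn (w : Fin (m + 1) → Fin (n + 3)) : Prop :=
  (Monotone w ∧ ∃ j ≠ 0, ∀ a, w a ≠ j) ∨ ∀ a, (w a : ℕ) ≤ 1

lemma IsOuterHorn.comp {l : ℕ} {w : Fin (m + 1) → Fin (n + 3)} (h : IsOuterHorn w)
    (f : Fin (l + 1) →o Fin (m + 1)) : IsOuterHorn (w ∘ f) :=
  h.imp (fun ⟨h, j, hj, hw⟩ => ⟨h.comp f.monotone, j, hj, fun _ => hw _⟩) fun h _ => h _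

lemma isSorted_of_monotone_or {w : Fin (m + 1) → Fin (n + 3)}
    (h : Monotone w ∨ ∀ a, (w a : ℕ) ≤ 1) : IsSorted w := by
  intro a b hab ha
  obtain h | h := h
  · exact h hab
  · have := h a; omega

lemma IsOuterHorn.isSorted {w : Fin (m + 1) → Fin (n + 3)} (h : IsOuterHorn w) : IsSorted w :=
  isSorted_of_monotone_or (h.imp_left fun h => h.1)

section Turn

variable {κ : Fin (n + 3) → SignType} (hκ : ∀ x, κ x = -1 ↔ 2 ≤ (x : ℕ))

include hκ

/-- In a sorted word a letter `≥ 2` is followed only by letters `≥ 2`, all of sign `-1`. The turn is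
therefore the first of them. The hypothesis on `κ` covers toggles of both `0` and `1`. -/
lemma IsSorted.le_one_of_isTurn {w : Fin (m + 1) → Fin (n + 3)} (h : IsSorted w)
    {t : Fin (m + 1)} (ht : IsTurn κ w t) {a : Fin (m + 1)} (hat : a < t) : (w a : ℕ) ≤ 1 := by
  obtain ⟨h0, ⟨b, hbt, hb⟩, ht⟩ := ht
  have key : κ (w t) = -1 := by
    by_contra h1
    have hb' := SignType.eq_of_ne (ht b hbt) (show κ (w b) ≠ -1 from fun h2 => by
      have h3 := h b t hbt.le ((hκ _).1 h2)
      exact h1 ((hκ _).2 (((hκ _).1 h2).trans h3))) h1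
    simp_all
  have := ht a hat
  rw [key, Ne, hκ] at this
  omega

/-- The letter `c` stands before the turn, where only letters `0` and `1` occur, so its insertion
does not affect the order of letters `≥ 2`. -/
lemma IsSorted.of_remove {c : Fin (n + 3)} (hc : κ c = 0) {w : Fin (m + 2) → Fin (n + 3)}
    {j : Fin (m + 1)} (hj : w j.castSucc = c) (ht : IsTurn κ w j.succ)
    (h : IsSorted (w ∘ j.castSucc.succAbove)) : IsSorted w := by
  intro a b hab ha
  have hcj : ∀ {x}, 2 ≤ (w x : ℕ) → x ≠ j.castSucc := by
    rintro _ hx rfl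
    rw [hj, ← hκ, hc] at hx
    exact absurd hx (by decide)
  obtain ⟨a, rfl⟩ := Fin.exists_succAbove_eq (hcj ha)
  by_cases hb : b = j.castSucc
  · rw [← isTurn_comp_castSucc_succAbove_iff (by rw [hj, hc])] at ht
    have haj : a < j := by
      by_contra! haj
      rw [hb, Fin.succAbove_of_le_castSucc _ _ (by simpa using haj)] at hab
      simp only [Fin.le_def, Fin.val_succ, Fin.val_castSucc] at hab haj
      omega
    have h1 : (w (j.castSucc.succAbove a) : ℕ) ≤ 1 := h.le_one_of_isTurn hκ ht haj
    omega
  · obtain ⟨b, rfl⟩ := Fin.exists_succAbove_eq hb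
    exact h a b ((Fin.strictMono_succAbove _).le_iff_le.1 hab) ha

end Turn

lemma side_one_eq_neg_one_iff (x : Fin (n + 3)) : side 1 x = -1 ↔ 2 ≤ (x : ℕ) := by
  rw [side_eq_neg_one_iff, Fin.lt_def, Fin.val_one]
  rfl

lemma pick_zero_one_eq_neg_one_iff (x : Fin (n + 3)) : pick 0 1 x = -1 ↔ 2 ≤ (x : ℕ) := by
  rw [pick]
  simp only [Fin.ext_iff, Fin.val_one, Fin.val_zero]
  split_ifs with h h <;> simp <;> omega

/-- A sorted word with a letter `2` or higher which is not monotone has the letters `0` and `1` before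
any of the other letters. -/
lemma IsSorted.exists_isTurn_side {w : Fin (m + 1) → Fin (n + 3)} (h : IsSorted w)
    (h1 : ¬ Monotone w) (h2 : ¬ ∀ a, (w a : ℕ) ≤ 1) : ∃ t, IsTurn (side 1) w t := by
  push Not at h2
  obtain ⟨b, hb⟩ := h2
  have ha : ∃ a, w a = 0 := by
    by_contra! ha
    refine h1 fun a b hab => ?_
    by_cases h3 : 2 ≤ (w a : ℕ)
    · exact h a b hab h3
    · have := Fin.val_ne_of_ne (ha b)
      rw [Fin.val_zero] at this
      rw [Fin.le_def]
      omega
  obtain ⟨a, ha⟩ := ha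
  refine DescentCat.exists_isTurn_side (a := a) (b := b) (by rw [ha]; exact Fin.zero_lt_one) ?_
  rw [Fin.lt_def, Fin.val_one]
  exact hb

lemma exists_comp_succAbove_of_two_le {w : Fin (m + 2) → Fin (n + 3)} {q : Fin (m + 2)}
    (hq : (w q : ℕ) ≤ 1) (h : ¬ ∀ a, (w a : ℕ) ≤ 1) : ¬ ∀ a, ((w ∘ q.succAbove) a : ℕ) ≤ 1 := by
  push Not at h ⊢
  obtain ⟨a, ha⟩ := h
  obtain ⟨b, hb⟩ := exists_comp_succAbove_eq w (q := q) (a := a) (fun h => by rw [h] at ha; omega)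
  exact ⟨b, by rwa [hb]⟩

/-- The sorted words. -/
def sortedSub (n : ℕ) : (thick.{v}.obj ⦋n + 2⦌).Subcomplex :=
  wordSub (fun _ w => IsSorted w) fun _ _ f _ h => h.comp f

/-- The union of the standard simplex and the thick initial edge. -/
def edgeSub (n : ℕ) : (thick.{v}.obj ⦋n + 2⦌).Subcomplex :=
  wordSub (fun _ w => Monotone w ∨ ∀ a, (w a : ℕ) ≤ 1) fun _ _ f _ h =>
    h.imp (fun h => h.comp f.monotone) fun h _ => h _

/-- The union of the standard outer horn and the thick initial edge. -/
def outerHornSub (n : ℕ) : (thick.{v}.obj ⦋n + 2⦌).Subcomplex :=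
  wordSub (fun _ w => IsOuterHorn w) fun _ _ f _ h => h.comp f

/-- The union of the outer horn and of the sorted words missing a letter that is at least `2`. -/
def sortedHornSub (n : ℕ) : (thick.{v}.obj ⦋n + 2⦌).Subcomplex :=
  wordSub (fun _ w => IsOuterHorn w ∨ (IsSorted w ∧ ∃ j : Fin (n + 3), 2 ≤ (j : ℕ) ∧ ∀ a, w a ≠ j))
    fun _ _ f _ h => h.imp (fun h => h.comp f) fun ⟨h, j, hj, hw⟩ => ⟨h.comp f, j, hj, fun _ => hw _⟩

lemma outerHornSub_le_edgeSub (n : ℕ) : outerHornSub.{v} n ≤ edgeSub n :=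
  fun _ _ h => Or.imp_left (fun h => h.1) h

lemma toggle_edgeSub (n : ℕ) : Toggle (side 1) 1 (edgeSub.{v} n) (sortedSub n) := by
  have h10 : side (1 : Fin (n + 3)) 1 = 0 := side_eq_zero_iff.2 rfl
  refine Toggle.of_wordSub (fun x => side_eq_zero_iff) (fun w => isSorted_of_monotone_or)
    (fun w hw hw' => ?_) (fun w j hj ht hw _ => hw.of_remove side_one_eq_neg_one_iff h10 hj ht)
    (fun w j hj ht hw hw' => ?_)
  · rw [not_or] at hw'
    exact hw.exists_isTurn_side hw'.1 hw'.2
  · rw [not_or] at hw' ⊢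
    exact ⟨fun h => hw'.1 (monotone_of_isTurn_side hj ht h),
      exists_comp_succAbove_of_two_le (by simp [hj]) hw'.2⟩

lemma toggle_outerHornSub (n : ℕ) :
    Toggle (side 1) 1 (outerHornSub.{v} n) (sortedHornSub n) := by
  have h10 : side (1 : Fin (n + 3)) 1 = 0 := side_eq_zero_iff.2 rfl
  have key : ∀ {m : ℕ} {w : Fin (m + 1) → Fin (n + 3)}, (IsOuterHorn w ∨ (IsSorted w ∧
      ∃ j : Fin (n + 3), 2 ≤ (j : ℕ) ∧ ∀ a, w a ≠ j)) → ¬ IsOuterHorn w → IsSorted w ∧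
        (∃ j : Fin (n + 3), 2 ≤ (j : ℕ) ∧ ∀ a, w a ≠ j) ∧ ¬ Monotone w ∧ ¬ ∀ a, (w a : ℕ) ≤ 1 := by
    intro m w hw hw'
    obtain ⟨h1, j, hj, h2⟩ := hw.resolve_left hw'
    refine ⟨h1, ⟨j, hj, h2⟩, fun h => hw' (Or.inl ⟨h, j, ?_, h2⟩), fun h => hw' (Or.inr h)⟩
    rintro rfl
    simp at hj
  refine Toggle.of_wordSub (fun x => side_eq_zero_iff) (fun w => Or.inl)
    (fun w hw hw' => ?_) (fun w j hj ht hw hw' => ?_) (fun w j hj ht hw hw' => ?_)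
  · obtain ⟨h1, -, h2, h3⟩ := key hw hw'
    exact h1.exists_isTurn_side h2 h3
  · obtain ⟨h1, ⟨i, hi, h2⟩, -⟩ := key hw hw'
    refine Or.inr ⟨h1.of_remove side_one_eq_neg_one_iff h10 hj ht, i, hi, fun a ha => ?_⟩
    obtain ⟨b, hb⟩ := exists_comp_succAbove_eq w (q := j.castSucc) (a := a) (by
      rw [ha, hj]; rintro rfl; simp at hi)
    exact h2 b (hb.trans ha)
  · obtain ⟨-, -, h2, h3⟩ := key hw hw'
    rintro (⟨h, -⟩ | h)
    · exact h2 (monotone_of_isTurn_side hj ht h)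
    · exact exists_comp_succAbove_of_two_le (by simp [hj]) h3 h

lemma toggle_sortedHornSub (n : ℕ) :
    Toggle (pick 0 1) 0 (sortedHornSub.{v} n) (sortedSub n) := by
  have h00 : pick (0 : Fin (n + 3)) 1 0 = 0 := by simp [pick]
  have key : ∀ {m : ℕ} {w : Fin (m + 1) → Fin (n + 3)}, IsSorted w → ¬ (IsOuterHorn w ∨ (IsSorted w ∧
      ∃ j : Fin (n + 3), 2 ≤ (j : ℕ) ∧ ∀ a, w a ≠ j)) → ∀ j ≠ 0, ∃ a, w a = j := by
    intro m w hw hw' j hj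
    rw [not_or] at hw'
    by_contra! h
    have hj1 : (j : ℕ) = 1 := by
      have : ¬ 2 ≤ (j : ℕ) := fun h' => hw'.2 ⟨hw, j, h', h⟩
      have := Fin.val_ne_of_ne hj
      rw [Fin.val_zero] at this
      omega
    -- A sorted word without the letter `1` is monotone: its letters below `2` are all `0`.
    refine hw'.1 (Or.inl ⟨fun a b hab => ?_, j, hj, h⟩)
    by_cases h3 : 2 ≤ (w a : ℕ)
    · exact hw a b hab h3
    · have := Fin.val_ne_of_ne (h a)
      rw [Fin.le_def]
      omega
  refine Toggle.of_wordSub (fun x => ?_) (fun w hw => ?_)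
    (fun w hw hw' => ?_) (fun w j hj ht hw hw' => ?_) (fun w j hj ht hw hw' => ?_)
  · unfold pick; split_ifs <;> simp_all
  · exact hw.elim (fun h => h.isSorted) fun h => h.1
  · obtain ⟨a, ha⟩ := key hw hw' 1 (by simp)
    obtain ⟨b, hb⟩ := key hw hw' (Fin.last _) (by simp [Fin.ext_iff])
    refine exists_isTurn (a := a) (b := b) (by simp [ha, pick]) ?_
    rw [hb, pick_zero_one_eq_neg_one_iff]
    simp
  · exact hw.of_remove pick_zero_one_eq_neg_one_iff h00 hj ht
  · have h1 : ∀ i ≠ 0, ∃ a, (w ∘ j.castSucc.succAbove) a = i := fun i hi => by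
      obtain ⟨a, ha⟩ := key hw hw' i hi
      obtain ⟨b, hb⟩ := exists_comp_succAbove_eq w (q := j.castSucc) (a := a) (by rw [ha, hj]; exact hi)
      exact ⟨b, hb.trans ha⟩
    rintro ((⟨-, i, hi, h2⟩ | h2) | ⟨-, i, hi, h2⟩)
    · obtain ⟨a, ha⟩ := h1 i hi
      exact h2 a ha
    · obtain ⟨a, ha⟩ := h1 (Fin.last _) (by simp [Fin.ext_iff])
      have := h2 a
      rw [ha] at this
      simp at this
    · obtain ⟨a, ha⟩ := h1 i (by rintro rfl; simp at hi)
      exact h2 a ha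

end OuterHorn

/-! ### Representability of spaces of maps from subcomplexes of simplices -/

section Representability

variable {n : ℕ}

/-- A union of faces of the standard simplex. -/
def faceUnion (F : Finset (Finset (Fin (n + 1)))) : (Δ[n] : SSet.{v}).Subcomplex where
  obj m := {x | ∃ s ∈ F, x ∈ (SSet.stdSimplex.face s).obj m}
  map f _ := fun ⟨s, hs, hx⟩ => ⟨s, hs, (SSet.stdSimplex.face s).map f hx⟩

lemma faceUnion_le_iff (F : Finset (Finset (Fin (n + 1)))) (S : (Δ[n] : SSet.{v}).Subcomplex) :
    faceUnion F ≤ S ↔ ∀ s ∈ F, SSet.stdSimplex.face s ≤ S :=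
  ⟨fun h s hs _ _ hx => h _ ⟨s, hs, hx⟩, fun h _ _ ⟨s, hs, hx⟩ => h s hs _ hx⟩

lemma exists_eq_faceUnion (S : (Δ[n] : SSet.{v}).Subcomplex) : ∃ F, S = faceUnion F := by
  classical
  refine ⟨Finset.univ.filter fun s => SSet.stdSimplex.face s ≤ S, le_antisymm ?_ ?_⟩
  · rw [SSet.Subcomplex.le_iff_contains_nonDegenerate]
    intro d x hx
    refine ⟨SSet.stdSimplex.nonDegenerateEquiv' x, ?_, ?_⟩
    · rw [Finset.mem_filter, SSet.stdSimplex.face_nonDegenerateEquiv',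
        SSet.Subcomplex.ofSimplex_le_iff]
      exact ⟨Finset.mem_univ _, hx⟩
    · rw [SSet.stdSimplex.face_nonDegenerateEquiv']
      exact SSet.Subcomplex.mem_ofSimplex_obj _
  · rw [faceUnion_le_iff]
    exact fun s hs => (Finset.mem_filter.1 hs).2

lemma bicartSq_faceUnion (s : Finset (Fin (n + 1)))
    (F : Finset (Finset (Fin (n + 1)))) :
    SSet.Subcomplex.BicartSq (faceUnion.{v} (F.image (s ∩ ·))) (SSet.stdSimplex.face s)
      (faceUnion F) (faceUnion (insert s F)) where
  sup_eq := by
    refine Subfunctor.ext (funext fun m => Set.ext fun x => ?_)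
    constructor
    · rintro (h | ⟨t, ht, h⟩)
      · exact ⟨s, Finset.mem_insert_self _ _, h⟩
      · exact ⟨t, Finset.mem_insert_of_mem ht, h⟩
    · rintro ⟨t, ht, h⟩
      obtain rfl | ht := Finset.mem_insert.1 ht
      · exact Or.inl h
      · exact Or.inr ⟨t, ht, h⟩
  inf_eq := by
    refine Subfunctor.ext (funext fun m => Set.ext fun x => ?_)
    constructor
    · rintro ⟨h, t, ht, h'⟩
      refine ⟨s ∩ t, Finset.mem_image_of_mem _ ht, ?_⟩
      exact (SSet.stdSimplex.face_inter_face s t).le m ⟨h, h'⟩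
    · rintro ⟨_, ht₀, h⟩
      obtain ⟨t, ht, rfl⟩ := Finset.mem_image.1 ht₀
      have h' := (SSet.stdSimplex.face_inter_face s t).ge m h
      exact ⟨h'.1, t, ht, h'.2⟩

variable [HasFiniteLimits C] (X : SimplicialObject C)

lemma isRepresentable_mapSpace_face (s : Finset (Fin (n + 1))) :
    (mapSpace (SSet.stdSimplex.face.{v} s).toSSet X).IsRepresentable := by
  obtain rfl | hs := s.eq_empty_or_nonempty
  · rw [SSet.stdSimplex.face_empty]
    exact isRepresentable_mapSpace_bot X
  · have hc : s.card = s.card - 1 + 1 := (Nat.sub_add_cancel hs.card_pos).symm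
    exact isRepresentable_of_iso (mapIso (SSet.stdSimplex.isoOfRepresentableBy
      (SSet.stdSimplex.faceRepresentableBy s _ (s.orderIsoOfFin hc))) X).symm
      (isRepresentable_mapStdSimplex _ X)

/-- Adding a face `s` glues it along the union of the faces `s ∩ t`, of which there are no more than
before. The mapping space is thus a pullback of representable ones, by induction on a bound `r` for
the number of faces. -/
lemma isRepresentable_mapSpace_faceUnion (r : ℕ) (F : Finset (Finset (Fin (n + 1))))
    (hF : F.card ≤ r) : (mapSpace (faceUnion.{v} F).toSSet X).IsRepresentable := by
  induction r generalizing F with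
  | zero =>
    obtain rfl := Finset.card_eq_zero.1 (Nat.le_zero.1 hF)
    have : faceUnion.{v} (∅ : Finset (Finset (Fin (n + 1)))) = ⊥ :=
      le_bot_iff.1 ((faceUnion_le_iff _ _).2 (by simp))
    rw [this]
    exact isRepresentable_mapSpace_bot X
  | succ r ih =>
    induction F using Finset.induction_on with
    | empty => exact ih _ (by simp)
    | insert s F hs _ =>
      rw [Finset.card_insert_of_notMem hs] at hF
      refine isRepresentable_of_isPullback (isPullback_mapRestrict (bicartSq_faceUnion s F).isPushout X)
        (isRepresentable_mapSpace_face X s) (ih F (by omega)) (ih _ ?_)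
      exact Finset.card_image_le.trans (by omega)

theorem isRepresentable_mapSpace_subcomplex (S : (Δ[n] : SSet.{v}).Subcomplex) :
    (mapSpace S.toSSet X).IsRepresentable := by
  obtain ⟨F, rfl⟩ := exists_eq_faceUnion S
  exact isRepresentable_mapSpace_faceUnion X _ F le_rfl

end Representability

/-! ### Horns of high dimension -/

section Mono

variable {X : SimplicialObject C} {k n : ℕ}

lemma preimage_δ_horn (i : Fin (n + 2)) :
    (Λ[n + 1, i] : (Δ[n + 1] : SSet.{v}).Subcomplex).preimage (SSet.stdSimplex.δ i) = ∂Δ[n] := by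
  ext ⟨m⟩ x
  induction m using SimplexCategory.rec with | _ m
  rw [SSet.Subcomplex.preimage_obj, Set.mem_preimage, SSet.mem_horn_iff_notMem_range,
    SSet.mem_boundary_iff_notMem_range]
  constructor
  · rintro ⟨j, hj, h⟩
    obtain ⟨j, rfl⟩ := Fin.exists_succAbove_eq hj
    refine ⟨j, ?_⟩
    rintro ⟨a, rfl⟩
    exact h ⟨a, rfl⟩
  · rintro ⟨j, hj⟩
    refine ⟨i.succAbove j, Fin.succAbove_ne _ _, ?_⟩
    rintro ⟨a, ha⟩
    exact hj ⟨a, Fin.succAbove_right_injective ha⟩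

lemma horn_sup_range_δ (i : Fin (n + 2)) :
    (Λ[n + 1, i] : (Δ[n + 1] : SSet.{v}).Subcomplex) ⊔
      SSet.Subcomplex.range (SSet.stdSimplex.δ i) = ∂Δ[n + 1] := by
  rw [SSet.stdSimplex.range_δ, SSet.boundary_eq_iSup, SSet.horn_eq_iSup]
  apply le_antisymm
  · exact sup_le (iSup_le fun j => le_iSup (fun j => SSet.stdSimplex.face {j}ᶜ) _)
      (le_iSup (fun j => SSet.stdSimplex.face {j}ᶜ) i)
  · refine iSup_le fun j => ?_
    by_cases hj : j = i
    · subst hj; exact le_sup_right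
    · exact le_sup_of_le_left (le_iSup (fun j : ({i}ᶜ : Set (Fin (n + 2))) =>
        SSet.stdSimplex.face {j.1}ᶜ) ⟨j, hj⟩)

lemma horn_le_boundary (i : Fin (n + 2)) :
    (Λ[n + 1, i] : (Δ[n + 1] : SSet.{v}).Subcomplex) ≤ ∂Δ[n + 1] :=
  le_sup_left.trans (horn_sup_range_δ i).le

lemma expansion_horn_boundary (W : MorphismProperty (Cᵒᵖ ⥤ Type v)) [W.IsStableUnderBaseChange]
    (X : SimplicialObject C) (i : Fin (n + 2)) (h : expansion W X (∂Δ[n] : Δ[n].Subcomplex).ι)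
    (h' : (Λ[n + 1, i] : (Δ[n + 1] : SSet.{v}).Subcomplex) ≤ ∂Δ[n + 1]) :
    expansion W X (SSet.Subcomplex.homOfLE h') := by
  refine expansion_homOfLE_congr W X (h := le_sup_left) ?_ rfl (horn_sup_range_δ i) h'
  refine expansion_attach W X _ _ (fun m x y _ _ hxy => ?_) (by rwa [preimage_δ_horn])
  have : Mono (SSet.stdSimplex.δ.{v} i) := inferInstance
  exact (mono_iff_injective _).1 ((NatTrans.mono_iff_mono_app _).1 this m) hxy

/-- Restriction to the horn factors through restriction to the boundary, and the first factor of an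
isomorphism is a monomorphism. -/
lemma expansion_monomorphisms_boundary (i : Fin (n + 2))
    (h : expansion (.isomorphisms _) X (Λ[n + 1, i] : (Δ[n + 1] : SSet.{v}).Subcomplex).ι) :
    expansion (.monomorphisms _) X (∂Δ[n + 1] : (Δ[n + 1] : SSet.{v}).Subcomplex).ι := by
  have hle : (Λ[n + 1, i] : (Δ[n + 1] : SSet.{v}).Subcomplex) ≤ ∂Δ[n + 1] := horn_le_boundary i
  have h1 : mapRestrict (Λ[n + 1, i] : (Δ[n + 1] : SSet.{v}).Subcomplex).ι X =
      mapRestrict (∂Δ[n + 1] : (Δ[n + 1] : SSet.{v}).Subcomplex).ι X ≫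
        mapRestrict (SSet.Subcomplex.homOfLE hle) X := by
    rw [← mapRestrict_comp]; rfl
  have : IsIso (mapRestrict (Λ[n + 1, i] : (Δ[n + 1] : SSet.{v}).Subcomplex).ι X) := h
  have := mono_of_mono_fac h1.symm
  exact this

/-- The boundary arises from the horn by attaching an `n`-simplex along its own boundary. Unique
inner fillings make the restrictions to boundaries in dimensions `n` and `n + 1` monomorphisms, so
any horn, outer ones included, has at most one filling. -/
lemma IsKCategory.monomorphisms_horn {cover : MorphismProperty C} (hX : IsKCategory cover k X)
    (hn : 2 ≤ n) (hk : k < n) (i : Fin (n + 2)) :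
    expansion (.monomorphisms _) X (Λ[n + 1, i] : (Δ[n + 1] : SSet.{v}).Subcomplex).ι := by
  have key : ∀ l, 2 ≤ l → k < l →
      expansion (.monomorphisms _) X (∂Δ[l] : (Δ[l] : SSet.{v}).Subcomplex).ι := by
    intro l hl hkl
    obtain ⟨l, rfl⟩ := Nat.exists_eq_add_of_le' hl
    refine expansion_monomorphisms_boundary 1 (hX.iso_horn (l + 2) 1 Fin.zero_lt_one ?_ hkl)
    simp [Fin.lt_def]
  have h1 := expansion_horn_boundary (.monomorphisms _) X i (key n hn hk) (horn_le_boundary i)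
  exact (expansion (.monomorphisms _) X).comp_mem _ _ h1 (key (n + 1) (by omega) (by omega))

end Mono

/-! ### Filling outer horns whose initial edge is thick. -/

section OuterHornExpansion

variable {n : ℕ}

/-- The initial edge. -/
def initialEdge (n : ℕ) : ⦋1⦌ ⟶ ⦋n + 2⦌ := SimplexCategory.mkOfSucc 0

lemma initialEdge_val (x : Fin 2) : ((initialEdge n).toOrderHom x : ℕ) = x := by
  fin_cases x <;> rfl

instance : Mono (initialEdge n) := by
  rw [SimplexCategory.mono_iff_injective]
  intro a b hab
  have := congrArg Fin.val hab
  exact Fin.ext ((initialEdge_val a).symm.trans (this.trans (initialEdge_val b)))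

lemma word_mem_range_initialEdge_iff {m : ℕ} (w : Fin (m + 1) → Fin (n + 3)) :
    word w ∈ (SSet.Subcomplex.range (thick.{v}.map (initialEdge n))).obj (op ⦋m⦌) ↔
      ∀ a, (w a : ℕ) ≤ 1 := by
  rw [word_mem_range_iff]
  constructor
  · rintro ⟨⟨y⟩, rfl⟩ a
    have := initialEdge_val (n := n) (y a)
    exact (this.trans_le (Nat.lt_succ_iff.1 (y a).2) :)
  · intro h
    refine ⟨⟨fun a => ⟨w a, Nat.lt_succ_of_le (h a)⟩⟩, funext fun a => Fin.ext ?_⟩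
    exact initialEdge_val _

/-- The standard outer horn in the thick simplex. -/
def monotoneHornSub (n : ℕ) : (thick.{v}.obj ⦋n + 2⦌).Subcomplex :=
  wordSub (fun _ w => Monotone w ∧ ∃ j ≠ 0, ∀ a, w a ≠ j) fun _ _ f _ ⟨h, j, hj, hw⟩ =>
    ⟨h.comp f.monotone, j, hj, fun _ => hw _⟩

lemma range_horn_toThick (n : ℕ) : SSet.Subcomplex.range
    ((Λ[n + 2, 0] : (Δ[n + 2] : SSet.{v}).Subcomplex).ι ≫ toThick.app ⦋n + 2⦌) =
      monotoneHornSub n := by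
  refine subcomplex_ext_word fun {m} w => ?_
  rw [word_mem_range_iff]
  constructor
  · rintro ⟨⟨y, hy⟩, rfl⟩
    obtain ⟨j, hj, h⟩ := (SSet.mem_horn_iff_notMem_range _ _).1 hy
    exact ⟨(SSet.stdSimplex.objEquiv y).toOrderHom.monotone, j, hj, fun a ha => h ⟨a, ha⟩⟩
  · rintro ⟨h, j, hj, hw⟩
    refine ⟨⟨SSet.stdSimplex.objEquiv.symm (SimplexCategory.mkHom ⟨w, h⟩), ?_⟩, rfl⟩
    refine (SSet.mem_horn_iff_notMem_range _ _).2 ⟨j, hj, ?_⟩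
    rintro ⟨a, ha⟩
    exact hw a ha

lemma preimage_outerHornSub (n : ℕ) :
    (outerHornSub.{v} n).preimage (toThick.app ⦋n + 2⦌) = Λ[n + 2, 0] := by
  ext ⟨m⟩ x
  induction m using SimplexCategory.rec with | _ m
  rw [SSet.Subcomplex.preimage_obj, Set.mem_preimage, SSet.mem_horn_iff_notMem_range]
  constructor
  · rintro (⟨-, j, hj, hw⟩ | h)
    · exact ⟨j, hj, fun ⟨a, ha⟩ => hw a ha⟩
    · refine ⟨Fin.last _, by simp [Fin.ext_iff], ?_⟩
      rintro ⟨a, ha⟩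
      have := (congrArg Fin.val ha).symm.trans_le (h a)
      simp at this
  · rintro ⟨j, hj, h⟩
    exact Or.inl ⟨(SSet.stdSimplex.objEquiv x).toOrderHom.monotone, j, hj, fun a ha => h ⟨a, ha⟩⟩

lemma outerHornSub_sup_range (n : ℕ) :
    outerHornSub.{v} n ⊔ SSet.Subcomplex.range (toThick.app ⦋n + 2⦌) = edgeSub n := by
  rw [range_toThick]
  refine subcomplex_ext_word fun w => ⟨?_, ?_⟩
  · rintro (h | h)
    · exact outerHornSub_le_edgeSub n _ h
    · exact Or.inl h
  · rintro (h | h)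
    · exact Or.inr h
    · exact Or.inl (Or.inr h)

variable {cover regular : MorphismProperty C} {k : ℕ} {X : SimplicialObject C}

lemma isRepresentable_mapSpace_range {Y Z : SSet.{v}} (f : Y ⟶ Z) [Mono f]
    (h : (mapSpace Y X).IsRepresentable) :
    (mapSpace (SSet.Subcomplex.range f).toSSet X).IsRepresentable := by
  have : IsIso (SSet.Subcomplex.toRange f) := by
    have := mono_of_mono_fac (SSet.Subcomplex.toRange_ι f)
    exact isIso_of_mono_of_epi _
  exact isRepresentable_of_iso (mapIso (asIso (SSet.Subcomplex.toRange f)).symm X) h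

lemma IsRegularKCategory.isRepresentable_mapSpace_sup
    (hC : IsRegularDescentCategory cover regular)
    (hX : IsRegularKCategory cover regular k X) (L L' : (thick.{v}.obj ⦋n + 2⦌).Subcomplex)
    (hL : (mapSpace L.toSSet X).IsRepresentable)
    (hLe : L.preimage (thick.{v}.map (initialEdge n)) = monotoneSub 1)
    (hL' : L ⊔ SSet.Subcomplex.range (thick.{v}.map (initialEdge n)) = L') :
    (mapSpace L'.toSSet X).IsRepresentable := by
  have := hC.regular_stableUnderBaseChange
  subst hL'
  exact isRepresentable_of_presheaf (expansion_sup_range_thick regular.presheaf X (initialEdge n) L hLe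
    (hX.expansion_toThick hC 1)) hL

lemma IsRegularKCategory.isRepresentable_mapSpace_edgeSub
    (hC : IsRegularDescentCategory cover regular)
    (hX : IsRegularKCategory cover regular k X) (n : ℕ) :
    (mapSpace (edgeSub.{v} n).toSSet X).IsRepresentable := by
  refine hX.isRepresentable_mapSpace_sup hC (monotoneSub (n + 2)) _ ?_ ?_ ?_
  · rw [← range_toThick]
    exact isRepresentable_mapSpace_range _ (isRepresentable_mapStdSimplex _ X)
  · exact subcomplex_ext_word fun w => monotone_comp_iff _ w
  · exact subcomplex_ext_word fun w => or_congr Iff.rfl (word_mem_range_initialEdge_iff w)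

lemma IsRegularKCategory.isRepresentable_mapSpace_outerHornSub
    (hC : IsRegularDescentCategory cover regular)
    (hX : IsRegularKCategory cover regular k X) (n : ℕ) :
    (mapSpace (outerHornSub.{v} n).toSSet X).IsRepresentable := by
  have := hC.hasFiniteLimits
  refine hX.isRepresentable_mapSpace_sup hC (monotoneHornSub n) _ ?_ ?_ ?_
  · rw [← range_horn_toThick]
    exact isRepresentable_mapSpace_range _ (isRepresentable_mapSpace_subcomplex X _)
  · refine subcomplex_ext_word fun w => ⟨fun h => (monotone_comp_iff _ w).1 h.1, fun h => ?_⟩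
    refine ⟨(monotone_comp_iff _ w).2 h, Fin.last _, by simp [Fin.ext_iff], fun a ha => ?_⟩
    have h1 := (initialEdge_val (n := n) (w a)).symm.trans (congrArg Fin.val ha)
    have h2 : (w a : ℕ) < 2 := (w a).2
    rw [h1] at h2
    simp at h2
  · exact subcomplex_ext_word fun w => or_congr Iff.rfl (word_mem_range_initialEdge_iff w)

/-- Both complexes expand to the sorted words by inner horns: the simplex with its thick edge
directly, the horn with its thick edge through `sortedHornSub`. Cancellation leaves the wanted
inclusion and is where both mapping spaces must be representable. -/
theorem IsRegularKCategory.expansion_outerHornSub (hC : IsRegularDescentCategory cover regular)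
    (hX : IsRegularKCategory cover regular k X) (n : ℕ) :
    expansion cover.presheaf X (SSet.Subcomplex.homOfLE (outerHornSub_le_edgeSub.{v} n)) := by
  have := hC.multiplicative
  have hD := hC.toIsDescentCategory
  have hK := hX.toIsKCategory
  refine expansion_cancel hD _ (SSet.Subcomplex.homOfLE (toggle_edgeSub n).le)
    ((toggle_edgeSub n).expansion_homOfLE hD hK) ?_
    (hX.isRepresentable_mapSpace_outerHornSub hC n) (hX.isRepresentable_mapSpace_edgeSub hC n)
  have := hC.stableUnderBaseChange
  have h := (expansion cover.presheaf X).comp_mem _ _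
    ((toggle_outerHornSub.{v} n).expansion_homOfLE hD hK)
    ((toggle_sortedHornSub n).expansion_homOfLE hD hK)
  exact h

/-- The restriction is a cover, and a monomorphism by uniqueness of fillings of the horn of
dimension `n + 2`. -/
theorem IsRegularKCategory.isomorphisms_outerHornSub
    (hC : IsRegularDescentCategory cover regular)
    (hX : IsRegularKCategory cover regular k X) (n : ℕ) (hk : 0 < k) (hn : k ≤ n) :
    expansion (.isomorphisms _) X (SSet.Subcomplex.homOfLE (outerHornSub_le_edgeSub.{v} n)) := by
  have h1 : expansion (.monomorphisms _) X
      (SSet.Subcomplex.homOfLE (outerHornSub_le_edgeSub.{v} n)) := by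
    refine expansion_homOfLE_congr _ X (h := le_sup_left) ?_ rfl (outerHornSub_sup_range n) _
    refine expansion_attach _ X _ _ (fun m x y _ _ hxy => toThick_app_injective _ m hxy) ?_
    rw [preimage_outerHornSub]
    exact hX.monomorphisms_horn (by omega) (by omega) 0
  have : Mono (mapRestrict (SSet.Subcomplex.homOfLE (outerHornSub_le_edgeSub.{v} n)) X) := h1
  exact isIso_of_presheaf_mono hC.toIsDescentCategory hC.subcanonical _
    (hX.expansion_outerHornSub hC n) (hX.isRepresentable_mapSpace_outerHornSub hC n)

end OuterHornExpansion

/-! ### The boundary of a thick simplex -/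

section Lead

variable {n m : ℕ}

/-- The letters smaller than `r` are not preceded by larger letters. -/
def IsLed (r : ℕ) (w : Fin (m + 1) → Fin (n + 1)) : Prop :=
  ∀ a b, a ≤ b → (w b : ℕ) < r → w a ≤ w b

lemma IsLed.comp {r l : ℕ} {w : Fin (m + 1) → Fin (n + 1)} (h : IsLed r w)
    (f : Fin (l + 1) →o Fin (m + 1)) : IsLed r (w ∘ f) :=
  fun _ _ hab hb => h _ _ (f.monotone hab) hb

/-- The words missing a letter, or such that letters smaller than `r` are not preceded by larger
letters. -/
def ledSub (n r : ℕ) : (thick.{v}.obj ⦋n⦌).Subcomplex :=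
  wordSub (fun _ w => ¬ Function.Surjective w ∨ IsLed r w) fun _ _ f _ h =>
    h.imp (fun h h' => h h'.of_comp) fun h => h.comp f

lemma ledSub_anti {r s : ℕ} (h : r ≤ s) : ledSub.{v} n s ≤ ledSub n r :=
  fun _ _ hw => Or.imp_right (fun hw a b hab hb => hw a b hab (hb.trans_le h)) hw

lemma IsLed.of_remove {c : Fin (n + 1)} {w : Fin (m + 2) → Fin (n + 1)} {j : Fin (m + 1)}
    (hj : w j.castSucc = c) (ht : IsTurn (side c) w j.succ)
    (h : IsLed c (w ∘ j.castSucc.succAbove)) : IsLed c w := by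
  have h0 : ∀ {x}, w x ≠ c → x ≠ j.castSucc := by rintro x hx rfl; exact hx hj
  have key : ∀ a b, a ≠ j.castSucc → a ≤ b → w b < c → w a ≤ w b := by
    intro a b ha hab hb
    obtain ⟨b, rfl⟩ := Fin.exists_succAbove_eq (h0 hb.ne)
    obtain ⟨a, rfl⟩ := Fin.exists_succAbove_eq ha
    exact h a b ((Fin.strictMono_succAbove _).le_iff_le.1 hab) hb
  intro a b hab hb
  have hb' : w b < c := hb
  obtain ⟨h1, -⟩ | ⟨h1, -, x, hx, hcx⟩ := isTurn_side_cases ht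
  · by_cases ha : a = j.castSucc
    · subst ha
      have h2 : j.castSucc < b := hab.lt_of_ne (h0 hb'.ne).symm
      exact absurd (key _ b (h0 h1.ne') (Fin.castSucc_lt_iff_succ_le.1 h2) hb')
        (not_le.2 (hb'.trans h1))
    · exact key a b ha hab hb
  · exact absurd (key x j.succ (h0 hcx.ne') hx.le h1) (not_le.2 (h1.trans hcx))

/-- A word to be attached has an occurrence of `c` after a larger letter. It is not the `c` before
the turn: an upward turn has no larger letter before it, and a downward turn would violate the
condition on letters below `c`. Deleting the latter `c` therefore keeps all letters and the
violation. -/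
lemma toggle_ledSub {c : Fin (n + 1)} (h0 : 0 < c) (hn : c < Fin.last n) :
    Toggle (side c) c (ledSub.{v} n (c + 1)) (ledSub n c) := by
  have key : ∀ {m : ℕ} {w : Fin (m + 1) → Fin (n + 1)}, (¬ Function.Surjective w ∨ IsLed c w) →
      ¬ (¬ Function.Surjective w ∨ IsLed (c + 1) w) →
      Function.Surjective w ∧ IsLed c w ∧ ¬ IsLed (c + 1) w := by
    intro m w hw hw'
    tauto
  refine Toggle.of_wordSub (fun x => side_eq_zero_iff) (fun w => ?_)
    (fun w hw hw' => ?_) (fun w j hj ht hw hw' => ?_) (fun w j hj ht hw hw' => ?_)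
  · exact Or.imp_right fun hw a b hab hb => hw a b hab (by omega)
  · obtain ⟨h1, -, -⟩ := key hw hw'
    obtain ⟨a, ha⟩ := h1 0
    obtain ⟨b, hb⟩ := h1 (Fin.last n)
    exact exists_isTurn_side (ha ▸ h0) (hb ▸ hn)
  · exact Or.inr ((key hw hw').2.1.of_remove hj ht)
  · obtain ⟨h1, h2, h3⟩ := key hw hw'
    simp only [IsLed] at h3
    push Not at h3
    obtain ⟨a, b, hab, hb, hba⟩ := h3
    have hbc : w b = c := by
      by_contra hbc
      have := Fin.val_ne_of_ne hbc
      exact absurd (h2 a b hab (by omega)) (not_le.2 hba)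
    have hca : c < w a := hbc ▸ hba
    have haj : a ≠ j.castSucc := by rintro rfl; exact hca.ne' hj
    have hbj : b ≠ j.castSucc := by
      rintro rfl
      obtain ⟨-, h4, -⟩ | ⟨h4, -, x, hx, hcx⟩ := isTurn_side_cases ht
      · exact absurd (h4 a (lt_of_le_of_lt hab Fin.castSucc_lt_succ)) (not_le.2 hca)
      · exact absurd (h2 x _ hx.le h4) (not_le.2 (h4.trans hcx))
    have h1' : Function.Surjective (w ∘ j.castSucc.succAbove) := by
      intro l
      by_cases hl : l = c
      · obtain ⟨b, rfl⟩ := Fin.exists_succAbove_eq hbj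
        exact ⟨b, hbc.trans hl.symm⟩
      · obtain ⟨x, hx⟩ := h1 l
        obtain ⟨y, hy⟩ := exists_comp_succAbove_eq w (q := j.castSucc) (a := x) (by rw [hx, hj]; exact hl)
        exact ⟨y, hy.trans hx⟩
    rw [not_or, not_not]
    refine ⟨h1', fun h4 => ?_⟩
    obtain ⟨b, rfl⟩ := Fin.exists_succAbove_eq hbj
    obtain ⟨a, rfl⟩ := Fin.exists_succAbove_eq haj
    exact absurd (h4 a b ((Fin.strictMono_succAbove _).le_iff_le.1 hab) hb) (not_le.2 hba)

lemma ledSub_self_word_iff (w : Fin (m + 1) → Fin (n + 1)) :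
    word w ∈ (ledSub.{v} n n).obj (op ⦋m⦌) ↔ ¬ Function.Surjective w ∨ Monotone w := by
  refine or_congr Iff.rfl ⟨fun h a b hab => ?_, fun h a b hab _ => h hab⟩
  by_cases hb : (w b : ℕ) < n
  · exact h a b hab hb
  · rw [Fin.le_def]
    have : (w a : ℕ) < n + 1 := (w a).2
    have hb' : ¬ (w b : ℕ) < n := hb
    change (w a : ℕ) ≤ (w b : ℕ)
    omega

/-- The non-degenerate words starting with `0` that have all letters, and do not have all their
letters `0` at the beginning. -/
structure LeadCell (n : ℕ) where
  /-- the length of the word is `dim + 2` -/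
  dim : ℕ
  /-- the word -/
  w : Fin (dim + 2) → Fin (n + 1)
  nonDegenerate : ∀ i : Fin (dim + 1), w i.castSucc ≠ w i.succ
  zero : w 0 = 0
  surjective : Function.Surjective w
  not_led : ¬ IsLed 1 w

lemma IsLed.one_iff {w : Fin (m + 1) → Fin (n + 1)} :
    IsLed 1 w ↔ ∀ a b, a ≤ b → w b = 0 → w a = 0 := by
  refine forall_congr' fun a => forall_congr' fun b => forall_congr' fun _ => ?_
  rw [Nat.lt_one_iff, Fin.val_eq_zero_iff]
  refine forall_congr' fun h => ?_
  rw [h, Fin.le_zero_iff]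

namespace LeadCell

lemma ext_of {x y : LeadCell n} (hd : x.dim = y.dim) (hw : x.w = hd ▸ y.w) : x = y := by
  obtain ⟨d, w, _, _, _, _⟩ := x
  obtain ⟨d', w', _, _, _, _⟩ := y
  obtain rfl : d = d' := hd
  obtain rfl : w = w' := hw
  rfl

lemma finite_dim (n r : ℕ) : Set.Finite {x | dim (n := n) x = r} := by
  let F : {x : LeadCell n // x.dim = r} → (Fin (r + 2) → Fin (n + 1)) := fun x => x.2 ▸ x.1.w
  refine Finite.of_injective F ?_
  rintro ⟨x, rfl⟩ ⟨y, hy⟩ h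
  exact Subtype.ext (ext_of hy.symm h)

lemma succ_ne_zero (x : LeadCell n) : x.w (Fin.succ 0) ≠ 0 := fun h =>
  x.nonDegenerate 0 (x.zero.trans h.symm)

lemma exists_zero (x : LeadCell n) : ∃ b : Fin (x.dim + 1), x.w b.succ = 0 := by
  have := x.not_led
  rw [IsLed.one_iff] at this
  push Not at this
  obtain ⟨a, b, hab, hb, ha⟩ := this
  obtain ⟨b, rfl⟩ := Fin.exists_succ_eq.2 (show b ≠ 0 by
    rintro rfl
    obtain rfl := Fin.le_zero_iff.1 hab
    exact ha hb)
  exact ⟨b, hb⟩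

lemma face_surjective (x : LeadCell n) :
    Function.Surjective (x.w ∘ (0 : Fin (x.dim + 2)).succAbove) := by
  intro l
  obtain ⟨a, rfl⟩ := x.surjective l
  obtain rfl | ⟨a, rfl⟩ := Fin.eq_zero_or_eq_succ a
  · obtain ⟨b, hb⟩ := x.exists_zero
    exact ⟨b, by simp [hb, x.zero]⟩
  · exact ⟨a, by simp⟩

lemma face_not_led (x : LeadCell n) : ¬ IsLed 1 (x.w ∘ (0 : Fin (x.dim + 2)).succAbove) := by
  rw [IsLed.one_iff]
  intro h
  obtain ⟨b, hb⟩ := x.exists_zero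
  have := h 0 b (Fin.zero_le _) (by simpa using hb)
  exact x.succ_ne_zero (by simpa using this)

/-- A word that does not start with `0` is the `0`-th face of the word with a `0` prepended. -/
lemma exists_of_nonDegenerate {l : ℕ} (z : Fin (l + 1) → Fin (n + 1)) (hz : Function.Surjective z)
    (hz' : ¬ IsLed 1 z) (hnd : ∀ i : Fin l, z i.castSucc ≠ z i.succ) :
    ∃ x : LeadCell n, word.{v} z ∈ (SSet.Subcomplex.ofSimplex (word.{v} x.w)).obj (op ⦋l⦌) ∧
      (z 0 = 0 → x.dim < l) := by
  by_cases h0 : z 0 = 0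
  · obtain _ | l := l
    · refine absurd (IsLed.one_iff.2 fun a b _ hb => ?_) hz'
      obtain rfl : a = b := Subsingleton.elim (α := Fin 1) a b
      exact hb
    · exact ⟨⟨l, z, hnd, h0, hz, hz'⟩, SSet.Subcomplex.mem_ofSimplex_obj _, fun _ => Nat.lt_succ_self l⟩
  · refine ⟨⟨l, Fin.cons 0 z, ?_, rfl, ?_, ?_⟩, ⟨(SimplexCategory.δ 0).op, ?_⟩, fun h => absurd h h0⟩
    · intro i
      by_cases hi : (i : ℕ) = 0
      · obtain rfl : i = 0 := Fin.ext hi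
        simpa using Ne.symm h0
      · obtain _ | l := l
        · omega
        obtain ⟨i, rfl⟩ := Fin.exists_succ_eq.2 (fun h => hi (congrArg Fin.val h))
        rw [← Fin.succ_castSucc, Fin.cons_succ, Fin.cons_succ]
        exact hnd i
    · intro a
      obtain ⟨b, hb⟩ := hz a
      exact ⟨b.succ, by simpa using hb⟩
    · intro h
      rw [IsLed.one_iff] at h
      obtain ⟨b, hb⟩ := hz 0
      have := h (Fin.succ 0) b.succ (Fin.succ_le_succ_iff.2 (Fin.zero_le _)) (by simpa using hb)
      exact h0 (by simpa using this)
    · refine congrArg ULift.up (funext fun i => ?_)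
      exact Fin.cons_succ (α := fun _ => Fin (n + 1)) 0 z i

lemma exists_mem_ofSimplex (w : Fin (m + 1) → Fin (n + 1)) (hw : Function.Surjective w)
    (hw' : ¬ IsLed 1 w) :
    ∃ x : LeadCell n, word.{v} w ∈ (SSet.Subcomplex.ofSimplex (word.{v} x.w)).obj (op ⦋m⦌) ∧
      (w 0 = 0 → x.dim < m) := by
  obtain ⟨l, f, hf, z, hz, rfl, hB⟩ := Toggle.exists_word_nonDegenerate.{v} w
  obtain ⟨x, hx, hd⟩ := exists_of_nonDegenerate.{v} z hw.of_comp (fun h => hw' (h.comp f.toOrderHom)) hz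
  refine ⟨x, (hB _).1 hx, fun h0 => (hd ?_).trans_le (SimplexCategory.len_le_of_epi f)⟩
  obtain ⟨a, ha⟩ := (SimplexCategory.epi_iff_surjective.1 hf) 0
  have : f.toOrderHom 0 = 0 := Fin.le_zero_iff.1 (ha ▸ f.toOrderHom.monotone (Fin.zero_le a))
  rw [← this]
  exact h0

lemma notMem_ledSub_iff (w : Fin (m + 1) → Fin (n + 1)) {r : ℕ} :
    word w ∉ (ledSub.{v} n r).obj (op ⦋m⦌) ↔ Function.Surjective w ∧ ¬ IsLed r w := by
  change ¬ (¬ Function.Surjective w ∨ IsLed r w) ↔ _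
  tauto

/-- The face starts with a nonzero letter, so it occurs in `y` away from the initial `0`. It can
then only be the `0`-th face of a cell of the same dimension, and prepending `0` recovers that cell.
-/
lemma face_notMem_cell (x y : LeadCell n) (hxy : y ≠ x) (hr : y.dim ≤ x.dim) :
    word (x.w ∘ (0 : Fin (x.dim + 2)).succAbove) ∉
      (SSet.Subcomplex.ofSimplex (word.{v} y.w)).obj (op ⦋x.dim⦌) := by
  intro hmem
  obtain ⟨f, hf⟩ := (SSet.Subcomplex.mem_ofSimplex_obj_iff _ _).1 hmem
  have hnd := (word_mem_nonDegenerate_iff.{v} (x.w ∘ (0 : Fin (x.dim + 2)).succAbove)).2 fun i => by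
    simpa using x.nonDegenerate i.succ
  have : Mono f := SSet.mono_of_nonDegenerate _ ⟨_, hnd⟩ f _ hf
  have hle : x.dim ≤ y.dim + 1 := SimplexCategory.le_of_mono f
  have h0 : f.toOrderHom 0 ≠ 0 := fun h0 => by
    have h1 : y.w (f.toOrderHom 0) = x.w (Fin.succ 0) := congrFun (congrArg ULift.down hf) 0
    rw [h0, y.zero] at h1
    exact x.succ_ne_zero h1.symm
  obtain ⟨d, w, hw, hz, hs, hl⟩ := x
  obtain hd | hd : d = y.dim + 1 ∨ d = y.dim := by simp only at hle hr; omega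
  · subst hd
    obtain rfl := SimplexCategory.eq_id_of_mono f
    exact h0 rfl
  · obtain ⟨d', w', hw', hz', hs', hl'⟩ := y
    obtain rfl : d = d' := hd
    obtain ⟨q, rfl⟩ := SimplexCategory.eq_δ_of_mono f
    have hf' : w' ∘ q.succAbove = w ∘ (0 : Fin (d + 2)).succAbove := congrArg ULift.down hf
    obtain rfl : q = 0 := by
      by_contra hq
      exact h0 (Fin.succAbove_ne_zero_zero hq)
    have : w = w' := funext fun a => by
      obtain rfl | ⟨a, rfl⟩ := Fin.eq_zero_or_eq_succ a
      · exact hz.trans hz'.symm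
      · simpa using (congrFun hf' a).symm
    subst this
    exact hxy rfl

end LeadCell

/-- The cell structure of a thick simplex over the subcomplex of words that miss a letter or have
their letters `0` at the beginning. -/
def leadCells (n : ℕ) : Cells (ledSub.{v} n 1) ⊤ where
  ι := LeadCell n
  dim := LeadCell.dim
  simplex x := word x.w
  idx _ := 0
  rank := LeadCell.dim
  finite := LeadCell.finite_dim n
  nonDegenerate x := (word_mem_nonDegenerate_iff _).2 x.nonDegenerate
  nonDegenerate_face x :=
    (word_mem_nonDegenerate_iff.{v} (x.w ∘ (0 : Fin (x.dim + 2)).succAbove)).2 fun i => by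
      simpa using x.nonDegenerate i.succ
  face_mem x q hq := by
    change word (x.w ∘ q.succAbove) ∈ _
    by_cases hA : word (x.w ∘ q.succAbove) ∈ (ledSub.{v} n 1).obj (op ⦋x.dim⦌)
    · exact Or.inl hA
    obtain ⟨h1, h2⟩ := (LeadCell.notMem_ledSub_iff _).1 hA
    obtain ⟨y, hy, hd⟩ := LeadCell.exists_mem_ofSimplex.{v} _ h1 h2
    -- A face other than the `0`-th one keeps the initial `0`, so it is carried by a cell of smaller
    -- dimension.
    have hr : y.dim < x.dim := hd (by
      rw [Function.comp_apply, Fin.succAbove_ne_zero_zero hq, x.zero])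
    exact (le_sup_of_le_right ((le_iSup (fun _ : y.dim < x.dim =>
      SSet.Subcomplex.ofSimplex (word.{v} y.w)) hr).trans (le_iSup (fun y : LeadCell n =>
        ⨆ (_ : y.dim < x.dim), SSet.Subcomplex.ofSimplex (word.{v} y.w)) y))) _ hy
  face_notMem x := (LeadCell.notMem_ledSub_iff _).2 ⟨x.face_surjective, x.face_not_led⟩
  face_notMem_cell := LeadCell.face_notMem_cell
  sup_eq := by
    refine le_antisymm le_top ?_
    rintro ⟨l⟩ ⟨w⟩ -
    by_cases hA : word w ∈ (ledSub.{v} n 1).obj (op ⦋l.len⦌)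
    · exact Or.inl hA
    · obtain ⟨h1, h2⟩ := (LeadCell.notMem_ledSub_iff _).1 hA
      obtain ⟨x, hx, -⟩ := LeadCell.exists_mem_ofSimplex.{v} (m := l.len) w h1 h2
      exact (le_sup_of_le_right (le_iSup_of_le x le_rfl) :
        SSet.Subcomplex.ofSimplex (word.{v} x.w) ≤ _) _ hx


end Lead

/-! ### Filling the thick simplex from its boundary and the standard simplex. -/

section LeadStep

variable {n : ℕ}

/-- The map of thick simplices given by a map of letters. -/
def thickPost {a b : ℕ} (g : Fin (a + 1) → Fin (b + 1)) :
    thick.{v}.obj ⦋a⦌ ⟶ thick.obj ⦋b⦌ where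
  app _ := TypeCat.ofHom fun s => ⟨g ∘ s.down⟩

lemma expansion_preimage_ι_iff (W : MorphismProperty (Cᵒᵖ ⥤ Type v)) [W.IsStableUnderBaseChange]
    (X : SimplicialObject C) {Z : SSet.{v}} {S T : Z.Subcomplex} (h : S ≤ T) :
    expansion W X (S.preimage T.ι).ι ↔ expansion W X (SSet.Subcomplex.homOfLE h) := by
  have : S.preimage T.ι = SSet.Subcomplex.range (SSet.Subcomplex.homOfLE h) := by
    refine Subfunctor.ext (funext fun m => Set.ext fun x => ⟨fun hx => ⟨⟨x.1, hx⟩, rfl⟩, ?_⟩)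
    rintro ⟨y, rfl⟩
    exact y.2
  rw [this, expansion_range_iff]

lemma mem_edgeSub_cases {l : SimplexCategoryᵒᵖ} (u : (thick.{v}.obj ⦋n + 2⦌).obj l)
    (hu : u ∈ (edgeSub n).obj l) :
    (∃ x, (toThick.app ⦋n + 2⦌).app l x = u) ∨ ∀ a, (u.down a : ℕ) ≤ 1 :=
  Or.imp_left (fun h => ⟨SSet.stdSimplex.objEquiv.symm (SimplexCategory.mkHom ⟨u.down, h⟩), rfl⟩) hu

variable {cover regular : MorphismProperty C} {k : ℕ} {X : SimplicialObject C}

/-- Attaching a cell whose initial edge is mapped into `L` along its outer horn. -/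
lemma expansion_sup_range_word (W : MorphismProperty (Cᵒᵖ ⥤ Type v)) [W.IsStableUnderBaseChange]
    (X : SimplicialObject C) {d : ℕ} (w : Fin (d + 3) → Fin (n + 1))
    (hw : word.{v} w ∈ (thick.{v}.obj ⦋n⦌).nonDegenerate (d + 2))
    (hw' : (thick.{v}.obj ⦋n⦌).δ 0 (word w) ∈ (thick.{v}.obj ⦋n⦌).nonDegenerate (d + 1))
    (L : (thick.{v}.obj ⦋n⦌).Subcomplex)
    (hL : L.preimage (SSet.yonedaEquiv.symm (word w)) = Λ[d + 2, 0])
    (hL' : ∀ {m : ℕ} (u : Fin (m + 1) → Fin (d + 3)), (∀ a, (u a : ℕ) ≤ 1) →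
      word (w ∘ u) ∈ L.obj (op ⦋m⦌))
    (h : expansion W X (SSet.Subcomplex.homOfLE (outerHornSub_le_edgeSub.{v} d))) :
    expansion W X (SSet.Subcomplex.homOfLE (le_sup_left :
      L ≤ L ⊔ SSet.Subcomplex.range (SSet.yonedaEquiv.symm (word w)))) := by
  have hx : ∀ {l : SimplexCategoryᵒᵖ} (x : (Δ[d + 2] : SSet.{v}).obj l),
      (toThick.app ⦋d + 2⦌).app l x ∈ (outerHornSub d).obj l ↔
        (SSet.yonedaEquiv.symm (word w)).app l x ∈ L.obj l := by
    intro l x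
    have h1 : x ∈ ((outerHornSub d).preimage (toThick.app ⦋d + 2⦌)).obj l ↔
      x ∈ (L.preimage (SSet.yonedaEquiv.symm (word w))).obj l := by
      rw [preimage_outerHornSub, hL]
    exact h1
  -- The cell is attached together with the thick initial edge, whose image already lies in `L`. The
  -- union is unchanged, but the attaching inclusion becomes `outerHornSub ≤ edgeSub`.
  let f : (edgeSub.{v} d).toSSet ⟶ thick.{v}.obj ⦋n⦌ := (edgeSub d).ι ≫ thickPost w
  have hmem : ∀ (l : SimplexCategoryᵒᵖ) (u : (edgeSub.{v} d).toSSet.obj l), u.1 ∈ (outerHornSub d).obj l ↔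
      f.app l u ∈ L.obj l := by
    rintro ⟨l⟩ ⟨u, hu⟩
    obtain ⟨x, rfl⟩ | h1 := mem_edgeSub_cases u hu
    · exact hx x
    · exact iff_of_true (Or.inr h1) (hL' (m := l.len) u.down h1)
  have hpre : L.preimage f = (outerHornSub d).preimage (edgeSub d).ι :=
    Subfunctor.ext (funext fun l => Set.ext fun u => (hmem l u).symm)
  have hsup : L ⊔ SSet.Subcomplex.range f =
      L ⊔ SSet.Subcomplex.range (SSet.yonedaEquiv.symm (word w)) := by
    apply le_antisymm
    · refine sup_le le_sup_left ?_
      rintro ⟨l⟩ _ ⟨⟨u, hu⟩, rfl⟩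
      obtain ⟨x, rfl⟩ | h1 := mem_edgeSub_cases u hu
      · exact Or.inr ⟨x, rfl⟩
      · exact Or.inl (hL' (m := l.len) u.down h1)
    · refine sup_le_sup le_rfl ?_
      rintro l _ ⟨x, rfl⟩
      exact ⟨⟨(toThick.app ⦋d + 2⦌).app l x, Or.inl (SSet.stdSimplex.objEquiv x).toOrderHom.monotone⟩,
        rfl⟩
  refine expansion_homOfLE_congr W X (h := le_sup_left) ?_ rfl hsup _
  refine expansion_attach W X f L ?_ ?_
  · rintro l ⟨x, hxe⟩ ⟨y, hye⟩ hxL hyL hxy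
    have hxo : x ∉ (outerHornSub d).obj l := fun h => hxL ((hmem l ⟨x, hxe⟩).1 h)
    have hyo : y ∉ (outerHornSub d).obj l := fun h => hyL ((hmem l ⟨y, hye⟩).1 h)
    obtain ⟨x, rfl⟩ | h1 := mem_edgeSub_cases x hxe
    · obtain ⟨y, rfl⟩ | h1 := mem_edgeSub_cases y hye
      · have hxh : ∀ z, (toThick.app ⦋d + 2⦌).app l z ∉ (outerHornSub.{v} d).obj l → z ∉ Λ[d + 2, 0].obj l := by
          intro z hz hz'
          rw [← preimage_outerHornSub] at hz'
          exact hz hz'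
        obtain rfl := injective_off_horn (word w) 0 hw hw' l x y (hxh x hxo) (hxh y hyo) hxy
        rfl
      · exact absurd (Or.inr h1) hyo
    · exact absurd (Or.inr h1) hxo
  · rw [hpre, expansion_preimage_ι_iff W X (outerHornSub_le_edgeSub d)]
    exact h

lemma LeadCell.not_surjective_comp {d : ℕ} (w : Fin (d + 3) → Fin (n + 1)) (hn : 2 ≤ n) {m : ℕ}
    (u : Fin (m + 1) → Fin (d + 3)) (hu : ∀ a, (u a : ℕ) ≤ 1) : ¬ Function.Surjective (w ∘ u) := by
  intro h
  have h1 : ∀ x, x ∈ ({w 0, w 1} : Finset (Fin (n + 1))) := fun x => by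
    obtain ⟨a, rfl⟩ := h x
    have : u a = 0 ∨ u a = 1 := by
      have := hu a
      rw [Fin.ext_iff, Fin.ext_iff, Fin.val_zero, Fin.val_one]
      omega
    rw [Finset.mem_insert, Finset.mem_singleton]
    exact this.imp (congrArg w) (congrArg w)
  have h2 := Finset.card_le_card (fun x _ => h1 x : Finset.univ ⊆ ({w 0, w 1} : Finset (Fin (n + 1))))
  have h3 := Finset.card_le_two (a := w 0) (b := w 1)
  simp only [Finset.card_univ, Fintype.card_fin] at h2
  omega

lemma leadCells_isStep (W : MorphismProperty (Cᵒᵖ ⥤ Type v)) [W.IsStableUnderBaseChange]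
    (X : SimplicialObject C) (hn : 2 ≤ n) (x : LeadCell n)
    (h : ∀ d, x.dim = d + 1 →
      expansion W X (SSet.Subcomplex.homOfLE (outerHornSub_le_edgeSub.{v} d))) :
    (leadCells.{v} n).IsStep W X x := by
  have hnd := (leadCells.{v} n).nonDegenerate x
  have hnd' := (leadCells.{v} n).nonDegenerate_face x
  obtain ⟨d, w, hw, hz, hs, hl⟩ := x
  obtain ⟨d, rfl⟩ : ∃ d', d = d' + 1 := by
    have := Fintype.card_le_of_surjective _ hs
    simp only [Fintype.card_fin] at this
    exact Nat.exists_eq_add_of_le' (by omega)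
  intro L hA hL
  -- The thick initial edge uses at most two letters. Since `n ≥ 2`, its words miss a letter and lie
  -- in the thick boundary, hence in `L`.
  exact expansion_sup_range_word W X w hnd hnd' L hL
    (fun u hu => hA _ (Or.inl (LeadCell.not_surjective_comp w hn u hu))) (h d rfl)

/-- The union of the boundary of a thick simplex and of the standard simplex. -/
theorem IsRegularKCategory.expansion_ledSub (hC : IsRegularDescentCategory cover regular)
    (hX : IsRegularKCategory cover regular k X) (hk : 0 < k) (hn : 2 ≤ n) :
    expansion cover.presheaf X (ledSub.{v} n n).ι := by
  have := hC.multiplicative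
  have := hC.stableUnderBaseChange
  -- The rank is `d + 1` for a horn of dimension `d + 2`, so rank at least `k + 1` gives `k ≤ d` and
  -- a unique filling.
  have h1 : expansion cover.presheaf X (SSet.Subcomplex.homOfLE (leadCells.{v} n).le) := by
    refine (leadCells.{v} n).expansion_homOfLE (fun x => leadCells_isStep _ X hn x fun d _ =>
      hX.expansion_outerHornSub hC d) (k + 1) fun x hx => leadCells_isStep _ X hn x fun d hd =>
        hX.isomorphisms_outerHornSub hC d hk ?_
    have : k + 1 ≤ x.dim := hx
    omega
  -- Toggling `c = r + 1` relaxes the order condition from letters `≤ c` to letters `< c`. The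
  -- letter `0` has nothing on one side and is not toggled; the outer horns of `h1` take over there.
  have h2 : ∀ r (hr : r + 1 ≤ n), expansion cover.presheaf X
      (SSet.Subcomplex.homOfLE (ledSub_anti.{v} (n := n) (Nat.le_add_left 1 r))) := by
    intro r
    induction r with
    | zero => exact fun _ => (expansion cover.presheaf X).id_mem _
    | succ r ih =>
      intro hr
      have h3 := (toggle_ledSub.{v} (c := (⟨r + 1, by omega⟩ : Fin (n + 1))) (Fin.lt_def.2 (by simp))
        (Fin.lt_def.2 (by simpa using hr))).expansion_homOfLE hC.toIsDescentCategory hX.toIsKCategory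
      exact (expansion cover.presheaf X).comp_mem _ _ h3 (ih (by omega))
  obtain ⟨n, rfl⟩ := Nat.exists_eq_add_of_le' (show 1 ≤ n by omega)
  rw [expansion_ι_iff]
  exact (expansion cover.presheaf X).comp_mem _ _ (h2 n le_rfl) h1

end LeadStep

/-! ### The simplicial object of maps from thick simplices, and its image -/

section ThickRepr

variable {X K : SimplicialObject C}

lemma exists_thickMapRepr
    (h : ∀ n : ℕ, (mapSpace (thick.{v}.obj ⦋n⦌) X).IsRepresentable) :
    ∃ K : SimplicialObject C, Nonempty (ThickMapRepr X K) := by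
  have h' : ∀ n : SimplexCategoryᵒᵖ, (yoneda (C := C)).essImage ((thickMap X).obj n) := by
    rintro ⟨n⟩
    have : ((thickMap X).obj (op n)).IsRepresentable := h n.len
    exact ⟨_, ⟨((thickMap X).obj (op n)).reprW⟩⟩
  let L : SimplexCategoryᵒᵖ ⥤ (yoneda (C := C)).EssImageSubcategory := ObjectProperty.lift _ (thickMap X) h'
  refine ⟨L ⋙ (yoneda (C := C)).toEssImage.inv, ⟨?_⟩⟩
  exact Functor.isoWhiskerLeft L (Functor.isoWhiskerRight
    (yoneda (C := C)).toEssImage.asEquivalence.counitIso (yoneda (C := C)).essImage.ι)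

namespace ThickMapRepr

variable (e : ThickMapRepr X K)

/-- The isomorphism in degree `n`. -/
def appIso (n : SimplexCategoryᵒᵖ) : yoneda.obj (K.obj n) ≅ mapSpace (thick.obj n.unop) X where
  hom := e.hom.app n
  inv := e.inv.app n
  hom_inv_id := congrArg (fun f => NatTrans.app f n) e.hom_inv_id
  inv_hom_id := congrArg (fun f => NatTrans.app f n) e.inv_hom_id

lemma hom_app_eq (n : SimplexCategoryᵒᵖ) {U : C} (g : U ⟶ K.obj n) :
    ((e.hom.app n).app (op U) : (U ⟶ K.obj n) → _) g =
      e.univ n ≫ ((SimplicialObject.whiskering C (Type v)).map (coyoneda.map g.op)).app X := by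
  have h := ConcreteCategory.congr_hom ((e.hom.app n).naturality g.op) (𝟙 (K.obj n))
  exact (congrArg (fun g' : U ⟶ K.obj n => ((e.hom.app n).app (op U) : (U ⟶ K.obj n) → _) g')
    (Category.comp_id g).symm).trans h

lemma yoneda_map_toBase (n : SimplexCategoryᵒᵖ) :
    yoneda.map (e.toBase.app n) =
      (e.appIso n).hom ≫ mapRestrict (toThick.app n.unop) X ≫ (mapStdSimplex n.unop X).hom := by
  refine NatTrans.ext (funext fun ⟨U⟩ => ConcreteCategory.hom_ext _ _ fun (g : U ⟶ K.obj n) => ?_)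
  change g ≫ e.toBase.app n = SSet.yonedaEquiv (toThick.app n.unop ≫
    ((e.hom.app n).app (op U) : (U ⟶ K.obj n) → _) g)
  rw [hom_app_eq]
  rfl

variable {cover regular : MorphismProperty C} {k : ℕ}

lemma regular_toBase (hC : IsRegularDescentCategory cover regular)
    (hX : IsRegularKCategory cover regular k X) (n : SimplexCategoryᵒᵖ) :
    regular (e.toBase.app n) := by
  have := hC.hasFiniteLimits
  have := hC.regular_stableUnderBaseChange
  obtain ⟨⟨n⟩⟩ := n
  refine (MorphismProperty.relative_map_iff (F := yoneda)).1 ?_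
  rw [yoneda_map_toBase]
  refine (regular.presheaf.cancel_left_of_respectsIso _ _).2
    ((regular.presheaf.cancel_right_of_respectsIso _ _).2 (hX.expansion_toThick hC n))

end ThickMapRepr

end ThickRepr

/-! ### Images of regular morphisms. -/

section Image

variable {cover regular : MorphismProperty C}

lemma IsCoimage.exists_desc {A B Z W : C} {f : A ⟶ B} {p : A ⟶ Z} (h : IsCoimage f p) (g : A ⟶ W)
    (hg : ∀ {U : C} (x y : U ⟶ A), x ≫ f = y ≫ f → x ≫ g = y ≫ g) : ∃ d : Z ⟶ W, p ≫ d = g := by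
  obtain ⟨R, a, b, hab, w, ⟨hc⟩⟩ := h
  exact ⟨hc.desc (Cofork.ofπ g (hg a b hab.w)), hc.fac _ WalkingParallelPair.one⟩

lemma IsCoimage.comp_eq {A B Z U : C} {f : A ⟶ B} {p : A ⟶ Z} (h : IsCoimage f p) {x y : U ⟶ A}
    (hxy : x ≫ f = y ≫ f) : x ≫ p = y ≫ p := by
  obtain ⟨R, a, b, hab, w, ⟨hc⟩⟩ := h
  rw [← hab.lift_fst x y hxy, Category.assoc, w, ← Category.assoc, hab.lift_snd]

lemma IsCoimage.epi {A B Z : C} {f : A ⟶ B} {p : A ⟶ Z} (h : IsCoimage f p) : Epi p :=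
  have := h.regularEpi
  inferInstance

variable (hC : IsRegularDescentCategory cover regular)

include hC

lemma IsCoimage.isCover {A B Z : C} {f : A ⟶ B} {p : A ⟶ Z} (hf : regular f) (h : IsCoimage f p) :
    cover p := by
  have := hC.multiplicative
  have := hC.stableUnderBaseChange
  obtain ⟨Z', p', h', hp'⟩ := hC.exists_coimage f hf
  have := h.epi
  have := h'.epi
  obtain ⟨d, hd⟩ := h.exists_desc p' fun x y hxy => h'.comp_eq hxy
  obtain ⟨d', hd'⟩ := h'.exists_desc p fun x y hxy => h.comp_eq hxy
  have : IsIso d' := ⟨d, by rw [← cancel_epi p', reassoc_of% hd', hd, Category.comp_id],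
    by rw [← cancel_epi p, reassoc_of% hd, hd', Category.comp_id]⟩
  rw [← hd']
  exact (cover.cancel_right_of_respectsIso _ _).2 hp'

/-- After pulling back along the cover `p` twice, both `x` and `y` lift to `A`. The lifts agree
under `f`, hence under `p`, and covers are epimorphisms. -/
lemma IsImageFactorization.mono {A B Z : C} {f : A ⟶ B} {p : A ⟶ Z} {i : Z ⟶ B} (hf : regular f)
    (h : IsImageFactorization f p i) : Mono i := by
  have := hC.hasFiniteLimits
  have := hC.stableUnderBaseChange
  have hp := h.1.isCover hC hf
  constructor
  intro U x y hxy
  have h1 : cover (pullback.snd p x) := cover.pullback_snd _ _ hp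
  have h2 : cover (pullback.snd p (pullback.snd p x ≫ y)) := cover.pullback_snd _ _ hp
  have := (hC.subcanonical _ h1).epi
  have := (hC.subcanonical _ h2).epi
  rw [← cancel_epi (pullback.snd p x), ← cancel_epi (pullback.snd p (pullback.snd p x ≫ y)),
    ← pullback.condition (f := p) (g := x), ← pullback.condition (f := p) (g := _ ≫ y),
    ← Category.assoc]
  refine h.1.comp_eq ?_
  rw [← h.2, Category.assoc, pullback.condition_assoc, pullback.condition_assoc]
  simp only [Category.assoc, hxy]

lemma exists_imageFactorization {K X : SimplicialObject C} (f : K ⟶ X)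
    (hf : ∀ n, regular (f.app n)) : ∃ (G : SimplicialObject C) (p : K ⟶ G) (i : G ⟶ X),
      ∀ n, IsImageFactorization (f.app n) (p.app n) (i.app n) := by
  choose Z p hp _ using fun n => hC.exists_coimage _ (hf n)
  choose i hi using fun n => (hp n).exists_desc (f.app n) fun _ _ h => h
  have hpi : ∀ n, IsImageFactorization (f.app n) (p n) (i n) := fun n => ⟨hp n, hi n⟩
  have := fun n => (hp n).epi
  have := fun n => (hpi n).mono hC (hf n)
  -- The structure maps of `K` descend to the coimages because `i m` is a monomorphism and `f` is
  -- simplicial.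
  have hex : ∀ {n m : SimplexCategoryᵒᵖ} (φ : n ⟶ m), ∃ g : Z n ⟶ Z m, p n ≫ g = K.map φ ≫ p m := by
    intro n m φ
    refine (hp n).exists_desc _ fun x y hxy => ?_
    rw [← cancel_mono (i m)]
    simp only [Category.assoc, hi]
    rw [f.naturality, ← Category.assoc, hxy, Category.assoc]
  choose g hg using @hex
  let G : SimplicialObject C :=
    { obj := Z
      map := g
      map_id n := by rw [← cancel_epi (p n), hg]; simp
      map_comp φ ψ := by rw [← cancel_epi (p _), hg, reassoc_of% hg, hg]; simp }
  refine ⟨G, { app := p, naturality := fun _ _ φ => (hg φ).symm }, { app := i, naturality := ?_ }, hpi⟩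
  intro n m φ
  change g φ ≫ i m = i n ≫ X.map φ
  rw [← cancel_epi (p n), reassoc_of% hg, hi, reassoc_of% hi, f.naturality]

end Image

/-! ### Maps to the simplicial object of maps from thick simplices -/

section Compare

variable {X K : SimplicialObject C} (e : ThickMapRepr X K)

/-- A natural family of maps from thick simplices to `T`, indexed by the simplices of `S`. -/
structure ThickFamily (S T : SSet.{v}) where
  /-- the map given by a simplex -/
  map : ∀ {m : SimplexCategoryᵒᵖ}, S.obj m → (thick.{v}.obj m.unop ⟶ T)
  naturality : ∀ {m l : SimplexCategoryᵒᵖ} (φ : m ⟶ l) (x : S.obj m),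
    map (S.map φ x) = thick.map φ.unop ≫ map x

namespace ThickMapRepr

variable {U : Cᵒᵖ}

/-- The point of `K_n` given by a point of `Map(Δ'^n, X)`. -/
def ofThick {n : SimplexCategoryᵒᵖ} (t : thick.{v}.obj n.unop ⟶ points X U) : U.unop ⟶ K.obj n :=
  ((e.appIso n).inv.app U : _ → (U.unop ⟶ K.obj n)) t

/-- The point of `Map(Δ'^n, X)` given by a point of `K_n`. -/
def toThickMap {n : SimplexCategoryᵒᵖ} (g : U.unop ⟶ K.obj n) : thick.{v}.obj n.unop ⟶ points X U :=
  ((e.appIso n).hom.app U : (U.unop ⟶ K.obj n) → _) g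

lemma toThickMap_ofThick {n : SimplexCategoryᵒᵖ} (t : thick.{v}.obj n.unop ⟶ points X U) :
    e.toThickMap (e.ofThick t) = t :=
  ConcreteCategory.congr_hom (NatTrans.congr_app (e.appIso n).inv_hom_id U) t

lemma ofThick_toThickMap {n : SimplexCategoryᵒᵖ} (g : U.unop ⟶ K.obj n) :
    e.ofThick (e.toThickMap g) = g :=
  ConcreteCategory.congr_hom (NatTrans.congr_app (e.appIso n).hom_inv_id U) g

lemma toThickMap_comp_map {n m : SimplexCategoryᵒᵖ} (g : U.unop ⟶ K.obj n) (φ : n ⟶ m) :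
    e.toThickMap (g ≫ K.map φ) = thick.map φ.unop ≫ e.toThickMap g :=
  ConcreteCategory.congr_hom (NatTrans.congr_app (e.hom.naturality φ) U) g

lemma ofThick_map_comp {n m : SimplexCategoryᵒᵖ} (t : thick.{v}.obj n.unop ⟶ points X U) (φ : n ⟶ m) :
    e.ofThick (thick.map φ.unop ≫ t) = e.ofThick t ≫ K.map φ := by
  rw [← e.ofThick_toThickMap (e.ofThick t ≫ K.map φ), toThickMap_comp_map, toThickMap_ofThick]

lemma ofThick_naturality {n : SimplexCategoryᵒᵖ} (t : thick.{v}.obj n.unop ⟶ points X U) {V : Cᵒᵖ}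
    (g : U ⟶ V) : e.ofThick
      (t ≫ ((SimplicialObject.whiskering C (Type v)).map (coyoneda.map g)).app X) =
        g.unop ≫ e.ofThick t :=
  ConcreteCategory.congr_hom ((e.appIso n).inv.naturality g) t

lemma ofThick_toBase {n : SimplexCategoryᵒᵖ} (t : thick.{v}.obj n.unop ⟶ points X U) :
    e.ofThick t ≫ e.toBase.app n = (t.app n ⟨id⟩ : U.unop ⟶ X.obj n) := by
  have h1 := ConcreteCategory.congr_hom (NatTrans.congr_app (e.yoneda_map_toBase n) U) (e.ofThick t)
  refine h1.trans ?_
  change SSet.yonedaEquiv (toThick.app n.unop ≫ e.toThickMap (e.ofThick t)) = _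
  rw [toThickMap_ofThick]
  rfl

end ThickMapRepr

namespace ThickFamily

variable {S T S' T' : SSet.{v}} (a : ThickFamily S T) (a' : ThickFamily S' T')

/-- The morphism `Map(T, X) ⟶ Map(S, K)`. -/
def compare : mapSpace T X ⟶ mapSpace S K where
  app U := TypeCat.ofHom fun (t : T ⟶ points X U) =>
    { app := fun m => TypeCat.ofHom fun x => (e.ofThick (a.map x ≫ t) : U.unop ⟶ K.obj m)
      naturality := fun m l φ => by
        refine ConcreteCategory.hom_ext _ _ fun x => ?_
        change e.ofThick (a.map (S.map φ x) ≫ t) = e.ofThick (a.map x ≫ t) ≫ K.map φ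
        rw [a.naturality, Category.assoc, ThickMapRepr.ofThick_map_comp] }
  naturality U V g := by
    refine ConcreteCategory.hom_ext _ _ fun (t : T ⟶ points X U) => ?_
    refine NatTrans.ext (funext fun m => ConcreteCategory.hom_ext _ _ fun x => ?_)
    exact e.ofThick_naturality (a.map x ≫ t) g

lemma compare_mapRestrict (j : S ⟶ S') (g : T ⟶ T')
    (h : ∀ {m : SimplexCategoryᵒᵖ} (x : S.obj m), a'.map (j.app m x) = a.map x ≫ g) :
    mapRestrict g X ≫ a.compare e = a'.compare e ≫ mapRestrict j K := by
  refine NatTrans.ext (funext fun U => ConcreteCategory.hom_ext _ _ fun (t : T' ⟶ points X U) => ?_)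
  refine NatTrans.ext (funext fun m => ConcreteCategory.hom_ext _ _ fun x => ?_)
  change e.ofThick (a.map x ≫ g ≫ t) = e.ofThick (a'.map (j.app m x) ≫ t)
  rw [h, Category.assoc]

lemma compare_toBase (b : S ⟶ T)
    (h : ∀ {m : SimplexCategoryᵒᵖ} (x : S.obj m), (a.map x).app m ⟨id⟩ = b.app m x) :
    a.compare e ≫ mapPush S e.toBase = mapRestrict b X := by
  refine NatTrans.ext (funext fun U => ConcreteCategory.hom_ext _ _ fun (t : T ⟶ points X U) => ?_)
  refine NatTrans.ext (funext fun m => ConcreteCategory.hom_ext _ _ fun x => ?_)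
  change e.ofThick (a.map x ≫ t) ≫ e.toBase.app m = t.app m (b.app m x)
  rw [e.ofThick_toBase, ← h]
  rfl

/-- The elementary relation between pairs consisting of a simplex of `S` and a simplex of the
corresponding thick simplex. -/
def Step (S : SSet.{v}) (m : SimplexCategoryᵒᵖ)
    (p q : Σ l : SimplexCategoryᵒᵖ, S.obj l × (thick.{v}.obj l.unop).obj m) : Prop :=
  ∃ φ : q.1 ⟶ p.1, p.2.1 = S.map φ q.2.1 ∧ (thick.map φ.unop).app m p.2.2 = q.2.2

/-- The hypotheses say that `T` is glued from thick simplices indexed by the simplices of `S`, with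
no relations other than those of `S`. A map from `T` to `X` is then a compatible family of maps from
thick simplices, that is, of points of `K`. -/
lemma isIso_compare
    (hex : ∀ (m : SimplexCategoryᵒᵖ) (w : T.obj m),
      ∃ p : Σ l : SimplexCategoryᵒᵖ, S.obj l × (thick.{v}.obj l.unop).obj m, (a.map p.2.1).app m p.2.2 = w)
    (huniq : ∀ (m : SimplexCategoryᵒᵖ)
      (p q : Σ l : SimplexCategoryᵒᵖ, S.obj l × (thick.{v}.obj l.unop).obj m),
      (a.map p.2.1).app m p.2.2 = (a.map q.2.1).app m q.2.2 → Relation.EqvGen (Step S m) p q) :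
    IsIso (a.compare e) := by
  refine (isIso_presheaf_iff _).2 fun U => ⟨fun (t t' : T ⟶ points X U) htt' => ?_,
    fun (s : S ⟶ points K U) => ?_⟩
  · refine NatTrans.ext (funext fun m => ConcreteCategory.hom_ext _ _ fun w => ?_)
    obtain ⟨⟨l, x, u⟩, rfl⟩ := hex m w
    have h1 : e.ofThick (a.map x ≫ t) = e.ofThick (a.map x ≫ t') :=
      ConcreteCategory.congr_hom (NatTrans.congr_app htt' l) x
    have h2 := congrArg e.toThickMap h1
    rw [e.toThickMap_ofThick, e.toThickMap_ofThick] at h2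
    exact ConcreteCategory.congr_hom (NatTrans.congr_app h2 m) u
  · choose p hp using hex
    let F : ∀ m : SimplexCategoryᵒᵖ, (Σ l : SimplexCategoryᵒᵖ, S.obj l × (thick.{v}.obj l.unop).obj m) →
      (points X U).obj m := fun m q =>
        (e.toThickMap (s.app q.1 q.2.1 : U.unop ⟶ K.obj q.1)).app m q.2.2
    have hF : ∀ m q q', Step S m q q' → F m q = F m q' := by
      rintro m q q' ⟨φ, hx, hu⟩
      have h1 : (s.app q.1 q.2.1 : U.unop ⟶ K.obj q.1) =
          (s.app q'.1 q'.2.1 : U.unop ⟶ K.obj q'.1) ≫ K.map φ :=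
        (congrArg (s.app q.1) hx).trans (ConcreteCategory.congr_hom (s.naturality φ) q'.2.1)
      have h2 := e.toThickMap_comp_map (s.app q'.1 q'.2.1 : U.unop ⟶ K.obj q'.1) φ
      rw [← h1] at h2
      exact (ConcreteCategory.congr_hom (NatTrans.congr_app h2 m) q.2.2).trans
        (congrArg ((e.toThickMap (s.app q'.1 q'.2.1 : U.unop ⟶ K.obj q'.1)).app m) hu)
    have hF' : ∀ m q q', (a.map q.2.1).app m q.2.2 = (a.map q'.2.1).app m q'.2.2 → F m q = F m q' := by
      intro m q q' h
      replace h := huniq m q q' h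
      induction h with
      | rel q q' h => exact hF m q q' h
      | refl q => rfl
      | symm q q' _ ih => exact ih.symm
      | trans q q' q'' _ _ ih ih' => exact ih.trans ih'
    have hFp : ∀ m q, F m (p m ((a.map q.2.1).app m q.2.2)) = F m q := fun m q => hF' m _ _ (hp m _)
    let t : T ⟶ points X U :=
      { app := fun m => TypeCat.ofHom fun w => F m (p m w)
        naturality := fun m m' φ => by
          refine ConcreteCategory.hom_ext _ _ fun w => ?_
          change F m' (p m' (T.map φ w)) = (points X U).map φ (F m (p m w))
          obtain ⟨q, rfl⟩ : ∃ q : Σ l : SimplexCategoryᵒᵖ, S.obj l × (thick.{v}.obj l.unop).obj m,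
            (a.map q.2.1).app m q.2.2 = w := ⟨p m w, hp m w⟩
          rw [hFp]
          let q' : Σ l : SimplexCategoryᵒᵖ, S.obj l × (thick.{v}.obj l.unop).obj m' :=
            ⟨q.1, q.2.1, (thick.obj q.1.unop).map φ q.2.2⟩
          have h1 : T.map φ ((a.map q.2.1).app m q.2.2) = (a.map q'.2.1).app m' q'.2.2 :=
            (ConcreteCategory.congr_hom ((a.map q.2.1).naturality φ) q.2.2).symm
          rw [h1, hFp]
          exact ConcreteCategory.congr_hom
            ((e.toThickMap (s.app q.1 q.2.1 : U.unop ⟶ K.obj q.1)).naturality φ) q.2.2 }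
    refine ⟨t, ?_⟩
    refine NatTrans.ext (funext fun m => ConcreteCategory.hom_ext _ _ fun x => ?_)
    change e.ofThick (a.map x ≫ t) = (s.app m x : U.unop ⟶ K.obj m)
    rw [← e.ofThick_toThickMap (s.app m x : U.unop ⟶ K.obj m)]
    congr 1
    refine NatTrans.ext (funext fun l => ConcreteCategory.hom_ext _ _ fun u => ?_)
    exact hFp l ⟨m, x, u⟩

end ThickFamily

end Compare

/-! ### Thick subcomplexes and maps into the thick mapping object. -/

section ThickSub

variable {n : ℕ}

/-- The first position at which a monotone map has a given value. -/
noncomputable def firstIdx {a : ℕ} (ψ : Fin (a + 1) →o Fin (n + 1)) (c : Fin (n + 1)) : Fin (a + 1) :=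
  sInf {j | ψ j = c}

lemma firstIdx_spec {a : ℕ} (ψ : Fin (a + 1) →o Fin (n + 1)) {c : Fin (n + 1)} (h : ∃ j, ψ j = c) :
    ψ (firstIdx ψ c) = c := csInf_mem (s := {j | ψ j = c}) h

lemma firstIdx_mono {a : ℕ} (ψ : Fin (a + 1) →o Fin (n + 1)) {c c' : Fin (n + 1)}
    (h : ∃ j, ψ j = c) (h' : ∃ j, ψ j = c') (hc : c ≤ c') : firstIdx ψ c ≤ firstIdx ψ c' := by
  by_contra! hlt
  have h1 := ψ.monotone hlt.le
  rw [firstIdx_spec ψ h, firstIdx_spec ψ h'] at h1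
  rw [le_antisymm hc h1] at hlt
  exact lt_irrefl _ hlt

/-- The factorization of a monotone map through the first positions of its values. -/
noncomputable def factor {a l : SimplexCategory} (ψ : a ⟶ ⦋n⦌) (z : l ⟶ ⦋n⦌)
    (h : ∀ i, ∃ j, ψ.toOrderHom j = z.toOrderHom i) : l ⟶ a :=
  SimplexCategory.Hom.mk
    ⟨fun i => firstIdx ψ.toOrderHom (z.toOrderHom i),
      fun i j hij => firstIdx_mono _ (h i) (h j) (z.toOrderHom.monotone hij)⟩

lemma factor_comp {a l : SimplexCategory} (ψ : a ⟶ ⦋n⦌) (z : l ⟶ ⦋n⦌)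
    (h : ∀ i, ∃ j, ψ.toOrderHom j = z.toOrderHom i) : factor ψ z h ≫ ψ = z :=
  SimplexCategory.Hom.ext _ _ (OrderHom.ext _ _ (funext fun i => firstIdx_spec _ (h i)))

lemma map_factor {m : SimplexCategoryᵒᵖ} {l : SimplexCategory} (x : (Δ[n] : SSet.{v}).obj m)
    (z : l ⟶ ⦋n⦌) (h : ∀ i, ∃ j, (SSet.stdSimplex.objEquiv x).toOrderHom j = z.toOrderHom i) :
    (Δ[n] : SSet.{v}).map (factor (SSet.stdSimplex.objEquiv x) z h).op x =
      SSet.stdSimplex.objEquiv.symm z := by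
  refine (SSet.stdSimplex.map_apply _ _).trans ?_
  exact congrArg SSet.stdSimplex.objEquiv.symm (factor_comp _ _ h)

/-- The face `z` is the ordered set of letters of `w`. -/
lemma exists_monotone_factor {m : ℕ} (w : Fin (m + 1) → Fin (n + 1)) :
    ∃ (d : ℕ) (z : ⦋d⦌ ⟶ ⦋n⦌) (u : Fin (m + 1) → Fin (d + 1)), z.toOrderHom ∘ u = w ∧
      ∀ i, ∃ a, w a = z.toOrderHom i := by
  classical
  let r : Finset (Fin (n + 1)) := Finset.univ.image w
  have hr : r.card = r.card - 1 + 1 :=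
    (Nat.sub_add_cancel (Finset.card_pos.2 ⟨w 0, Finset.mem_image_of_mem _ (Finset.mem_univ _)⟩)).symm
  have h1 : ∀ a, ∃ i, r.orderEmbOfFin hr i = w a := fun a => by
    have : w a ∈ Set.range (r.orderEmbOfFin hr) := by
      rw [Finset.range_orderEmbOfFin]
      exact Finset.mem_image_of_mem _ (Finset.mem_univ _)
    exact this
  choose u hu using h1
  refine ⟨r.card - 1, SimplexCategory.mkHom (r.orderEmbOfFin hr).toOrderHom, u, funext hu, fun i => ?_⟩
  obtain ⟨a, -, ha⟩ := Finset.mem_image.1 (Finset.orderEmbOfFin_mem r hr i)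
  exact ⟨a, ha⟩

/-- The subcomplex of a thick simplex corresponding to a subcomplex of the standard simplex. -/
def thickSub (S : (Δ[n] : SSet.{v}).Subcomplex) : (thick.{v}.obj ⦋n⦌).Subcomplex :=
  wordSub (fun m w => ∀ (l : SimplexCategory) (z : l ⟶ ⦋n⦌),
      (∀ i, ∃ a : Fin (m + 1), w a = z.toOrderHom i) → SSet.stdSimplex.objEquiv.symm z ∈ S.obj (op l))
    fun _ _ f _ h l z hz => h l z fun i => ⟨f (hz i).choose, (hz i).choose_spec⟩

lemma thickSub_mono {S T : (Δ[n] : SSet.{v}).Subcomplex} (h : S ≤ T) : thickSub S ≤ thickSub T :=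
  fun _ _ hw l z hz => h _ (hw l z hz)

lemma thickSub_top : thickSub (⊤ : (Δ[n] : SSet.{v}).Subcomplex) = ⊤ :=
  top_le_iff.1 fun _ _ _ _ _ _ => trivial

lemma word_mem_thickSub_horn_iff {m : ℕ} (i : Fin (n + 1)) (w : Fin (m + 1) → Fin (n + 1)) :
    word w ∈ (thickSub (Λ[n, i] : (Δ[n] : SSet.{v}).Subcomplex)).obj (op ⦋m⦌) ↔
      ∃ j ≠ i, ∀ a, w a ≠ j := by
  constructor
  · intro h
    obtain ⟨d, z, u, rfl, hz⟩ := exists_monotone_factor w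
    obtain ⟨j, hj, h⟩ := (SSet.mem_horn_iff_notMem_range _ _).1 (h ⦋d⦌ z hz)
    exact ⟨j, hj, fun a ha => h ⟨u a, ha⟩⟩
  · rintro ⟨j, hj, h⟩ l z hz
    induction l using SimplexCategory.rec with | _ l
    refine (SSet.mem_horn_iff_notMem_range _ _).2 ⟨j, hj, ?_⟩
    rintro ⟨b, hb⟩
    obtain ⟨a, ha⟩ := hz b
    exact h a (ha.trans hb)

lemma thickSub_horn (i : Fin (n + 1)) :
    thickSub (Λ[n, i] : (Δ[n] : SSet.{v}).Subcomplex) = thickHorn i :=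
  subcomplex_ext_word (word_mem_thickSub_horn_iff i)

lemma word_mem_thickSub_boundary_iff {m : ℕ} (w : Fin (m + 1) → Fin (n + 1)) :
    word w ∈ (thickSub (∂Δ[n] : (Δ[n] : SSet.{v}).Subcomplex)).obj (op ⦋m⦌) ↔
      ¬ Function.Surjective w := by
  simp only [Function.Surjective]
  push Not
  constructor
  · intro h
    obtain ⟨d, z, u, rfl, hz⟩ := exists_monotone_factor w
    obtain ⟨j, h⟩ := (SSet.mem_boundary_iff_notMem_range _).1 (h ⦋d⦌ z hz)
    exact ⟨j, fun a ha => h ⟨u a, ha⟩⟩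
  · rintro ⟨j, h⟩ l z hz
    induction l using SimplexCategory.rec with | _ l
    refine (SSet.mem_boundary_iff_notMem_range _).2 ⟨j, ?_⟩
    rintro ⟨b, hb⟩
    obtain ⟨a, ha⟩ := hz b
    exact h a (ha.trans hb)

lemma thickSub_boundary_sup_range :
    thickSub (∂Δ[n] : (Δ[n] : SSet.{v}).Subcomplex) ⊔
      SSet.Subcomplex.range (toThick.app ⦋n⦌) = ledSub n n := by
  rw [range_toThick]
  refine subcomplex_ext_word fun w => Iff.trans ?_ (ledSub_self_word_iff.{v} w).symm
  exact or_congr (word_mem_thickSub_boundary_iff w) Iff.rfl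

lemma preimage_thickSub (S : (Δ[n] : SSet.{v}).Subcomplex) :
    (thickSub S).preimage (toThick.app ⦋n⦌) = S := by
  refine Subfunctor.ext (funext fun l => Set.ext fun x => ⟨fun h => ?_, fun h => ?_⟩)
  · have := h l.unop (SSet.stdSimplex.objEquiv x) fun i => ⟨i, rfl⟩
    rwa [Equiv.symm_apply_apply] at this
  · intro k z hz
    rw [← map_factor x z hz]
    exact S.map _ h

/-- The thick simplices in the subcomplex of a thick simplex corresponding to a subcomplex of the standard
simplex. -/
def subFamily (S : (Δ[n] : SSet.{v}).Subcomplex) : ThickFamily S.toSSet (thickSub S).toSSet where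
  map {m} x := SSet.Subcomplex.lift (thick.{v}.map (SSet.stdSimplex.objEquiv x.1)) (by
    rintro l _ ⟨u, rfl⟩
    intro k z hz
    rw [← map_factor x.1 z fun i => ⟨u.down (hz i).choose, (hz i).choose_spec⟩]
    exact S.map _ x.2)
  naturality _ _ := rfl

/-- The canonical presentation of a word uses the face spanned by its letters. Every other
presentation is connected to it in two elementary steps. -/
lemma exists_eqvGen_step (S : (Δ[n] : SSet.{v}).Subcomplex) {m : SimplexCategoryᵒᵖ}
    (w : (thickSub S).toSSet.obj m) :
    ∃ p : Σ l : SimplexCategoryᵒᵖ, S.toSSet.obj l × (thick.{v}.obj l.unop).obj m,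
      ((subFamily S).map p.2.1).app m p.2.2 = w ∧
      ∀ q : Σ l : SimplexCategoryᵒᵖ, S.toSSet.obj l × (thick.{v}.obj l.unop).obj m,
        ((subFamily S).map q.2.1).app m q.2.2 = w →
          Relation.EqvGen (ThickFamily.Step S.toSSet m) q p := by
  obtain ⟨⟨w⟩, hw⟩ := w
  obtain ⟨d, z, u, rfl, hz⟩ := exists_monotone_factor (m := m.unop.len) w
  refine ⟨⟨op ⦋d⦌, ⟨SSet.stdSimplex.objEquiv.symm z, hw ⦋d⦌ z hz⟩, ⟨u⟩⟩, rfl, ?_⟩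
  rintro ⟨⟨l⟩, ⟨x, hx⟩, ⟨y⟩⟩ hq
  have hy : (SSet.stdSimplex.objEquiv x).toOrderHom ∘ y = z.toOrderHom ∘ u :=
    congrArg (fun t : (thickSub S).toSSet.obj m => t.1.down) hq
  let ρ := factor (SSet.stdSimplex.objEquiv x) z fun i =>
    ⟨y (hz i).choose, (congrFun hy _).trans (hz i).choose_spec⟩
  -- A degenerate `x` may show the same letter at several positions. The map `τ` moves each position
  -- to the first one with that letter and preserves `x`; only then does `y` factor through `ρ`.
  let τ := factor (SSet.stdSimplex.objEquiv x) (SSet.stdSimplex.objEquiv x) fun i => ⟨i, rfl⟩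
  refine .trans _ ⟨op l, ⟨x, hx⟩, ⟨τ.toOrderHom ∘ y⟩⟩ _ (.rel _ _ ⟨τ.op, ?_, rfl⟩)
    (.symm _ _ (.rel _ _ ⟨ρ.op, ?_, ?_⟩))
  · exact Subtype.ext ((map_factor x _ _).trans (SSet.stdSimplex.objEquiv.symm_apply_apply x)).symm
  · exact Subtype.ext (map_factor x _ _).symm
  · exact congrArg ULift.up (funext fun a =>
      congrArg (firstIdx (SSet.stdSimplex.objEquiv x).toOrderHom) (congrFun hy a).symm)

/-- The thick simplices in a thick simplex. -/
def stdFamily (n : ℕ) : ThickFamily (Δ[n] : SSet.{v}) (thick.{v}.obj ⦋n⦌) where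
  map x := thick.{v}.map (SSet.stdSimplex.objEquiv x)
  naturality _ _ := (congrArg thick.map rfl).trans (thick.map_comp _ _)

variable {X K : SimplicialObject C} (e : ThickMapRepr X K)

instance (S : (Δ[n] : SSet.{v}).Subcomplex) : IsIso ((subFamily S).compare e) := by
  refine (subFamily S).isIso_compare e (fun m w => ?_) fun m p q hpq => ?_
  · obtain ⟨p, hp, -⟩ := exists_eqvGen_step S w
    exact ⟨p, hp⟩
  · obtain ⟨p', -, h⟩ := exists_eqvGen_step S (((subFamily S).map p.2.1).app m p.2.2)
    exact .trans _ _ _ (h p rfl) (.symm _ _ (h q hpq.symm))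

instance (n : ℕ) : IsIso ((stdFamily n).compare e) := by
  have h : (stdFamily n).compare e ≫ (mapStdSimplex ⦋n⦌ K).hom ≫ (e.appIso (op ⦋n⦌)).hom = 𝟙 _ := by
    refine NatTrans.ext (funext fun U => ConcreteCategory.hom_ext _ _ fun
      (t : thick.{v}.obj ⦋n⦌ ⟶ points X U) => ?_)
    change e.toThickMap (e.ofThick (thick.map (𝟙 ⦋n⦌) ≫ t)) = t
    rw [e.toThickMap_ofThick, thick.map_id, Category.id_comp]
  exact IsIso.of_isIso_fac_right h

include e

/-- Restriction for maps to `K` corresponds to restriction between thick subcomplexes. -/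
lemma expansion_homOfLE_iff (W : MorphismProperty (Cᵒᵖ ⥤ Type v)) [W.RespectsIso]
    {S T : (Δ[n] : SSet.{v}).Subcomplex} (h : S ≤ T) :
    expansion W K (SSet.Subcomplex.homOfLE h) ↔
      expansion W X (SSet.Subcomplex.homOfLE (thickSub_mono h)) := by
  have h1 := (subFamily S).compare_mapRestrict e (subFamily T) (SSet.Subcomplex.homOfLE h)
    (SSet.Subcomplex.homOfLE (thickSub_mono h)) fun x => rfl
  rw [expansion, expansion, ← W.cancel_left_of_respectsIso ((subFamily T).compare e), ← h1,
    W.cancel_right_of_respectsIso]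

lemma expansion_ι_thickSub_iff (W : MorphismProperty (Cᵒᵖ ⥤ Type v)) [W.IsStableUnderBaseChange]
    (S : (Δ[n] : SSet.{v}).Subcomplex) :
    expansion W K S.ι ↔ expansion W X (thickSub S).ι := by
  rw [expansion_ι_iff, expansion_ι_iff, expansion_homOfLE_iff e]
  constructor
  · exact fun h => expansion_homOfLE_congr W X h rfl thickSub_top _
  · exact fun h => expansion_homOfLE_congr W X h rfl thickSub_top.symm _

end ThickSub

/-! ### Relative spaces of maps -/

section RelMap

variable {S T R : SSet.{v}} {X Y : SimplicialObject C} (f : X ⟶ Y)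

lemma mapRestrict_mapPush (j : S ⟶ T) :
    mapRestrict j X ≫ mapPush S f = mapPush T f ≫ mapRestrict j Y := by
  refine NatTrans.ext (funext fun U => ConcreteCategory.hom_ext _ _ fun (t : T ⟶ points X U) => ?_)
  exact Category.assoc j t (((SimplicialObject.whiskering C (Type v)).obj (coyoneda.obj U)).map f)

lemma relMap_fst (j : S ⟶ T) :
    relMap j f ≫ pullback.fst (mapPush S f) (mapRestrict j Y) = mapRestrict j X :=
  pullback.lift_fst _ _ _

lemma relMap_snd (j : S ⟶ T) :
    relMap j f ≫ pullback.snd (mapPush S f) (mapRestrict j Y) = mapPush T f :=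
  pullback.lift_snd _ _ _

lemma exists_pullback_lift {D : Type*} [Category* D] [HasPullbacks D] {A B E P : D} (f : A ⟶ E)
    (g : B ⟶ E) (x : P ⟶ A) (y : P ⟶ B) (h : x ≫ f = y ≫ g) :
    ∃ n : P ⟶ pullback f g, n ≫ pullback.fst f g = x ∧ n ≫ pullback.snd f g = y :=
  ⟨pullback.lift x y h, pullback.lift_fst _ _ _, pullback.lift_snd _ _ _⟩

variable {W : MorphismProperty (Cᵒᵖ ⥤ Type v)}

/-- The relative map of a composite is the relative map of `j` followed by a base change of that of
`i`. -/
lemma relMap_comp [W.IsMultiplicative] [W.IsStableUnderBaseChange] (i : S ⟶ T) (j : T ⟶ R)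
    (hi : W (relMap i f)) (hj : W (relMap j f)) : W (relMap (i ≫ j) f) := by
  obtain ⟨n, hn₁, hn₂⟩ := exists_pullback_lift (mapPush S f) (mapRestrict i Y)
    (pullback.fst (mapPush S f) (mapRestrict (i ≫ j) Y)) (pullback.snd _ _ ≫ mapRestrict j Y) (by
      rw [pullback.condition, mapRestrict_comp, Category.assoc])
  obtain ⟨m, hm₁, hm₂⟩ := exists_pullback_lift (mapPush S f) (mapRestrict (i ≫ j) Y)
    (pullback.fst (mapPush T f) (mapRestrict j Y) ≫ mapRestrict i X) (pullback.snd _ _) (by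
      rw [Category.assoc, mapRestrict_mapPush, ← Category.assoc, pullback.condition,
        mapRestrict_comp, Category.assoc])
  have h1 : IsPullback n (pullback.snd _ _) (pullback.snd _ _) (mapRestrict j Y) := by
    refine IsPullback.of_right (h₁₂ := pullback.fst _ _) (v₁₃ := mapPush S f)
      (h₂₂ := mapRestrict i Y) ?_ hn₂ (IsPullback.of_hasPullback _ _).flip.flip
    rw [hn₁, ← mapRestrict_comp]
    exact IsPullback.of_hasPullback _ _
  have h2 : IsPullback (pullback.fst (mapPush T f) (mapRestrict j Y)) m (relMap i f) n := by
    refine IsPullback.of_bot ?_ ?_ h1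
    · rw [hm₂, relMap_snd]
      exact IsPullback.of_hasPullback _ _
    · apply pullback.hom_ext
      · rw [Category.assoc, Category.assoc, relMap_fst, hn₁, hm₁]
      · rw [Category.assoc, Category.assoc, relMap_snd, hn₂, ← Category.assoc, hm₂,
          pullback.condition]
  have h3 : relMap (i ≫ j) f = relMap j f ≫ m := by
    apply pullback.hom_ext
    · rw [relMap_fst, Category.assoc, hm₁, ← Category.assoc, relMap_fst, mapRestrict_comp]
    · rw [relMap_snd, Category.assoc, hm₂, relMap_snd]
  rw [h3]
  exact W.comp_mem _ _ hj (W.of_isPullback h2 hi)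

/-- A pushout of simplicial sets makes the relative map of `r` a base change of that of `l`. -/
lemma relMap_of_isPushout [W.IsStableUnderBaseChange] {S' T' : SSet.{v}} {t : S ⟶ S'} {l : S ⟶ T}
    {r : S' ⟶ T'} {b : T ⟶ T'} (sq : IsPushout t l r b) (h : W (relMap l f)) : W (relMap r f) := by
  obtain ⟨n, hn₁, hn₂⟩ := exists_pullback_lift (mapPush S f) (mapRestrict l Y)
    (pullback.fst (mapPush S' f) (mapRestrict r Y) ≫ mapRestrict t X)
    (pullback.snd _ _ ≫ mapRestrict b Y) (by
      rw [Category.assoc, mapRestrict_mapPush, ← Category.assoc, pullback.condition, Category.assoc,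
        Category.assoc, ← mapRestrict_comp, ← mapRestrict_comp, sq.w])
  have h1 : IsPullback n (pullback.fst _ _) (pullback.fst _ _) (mapRestrict t X) := by
    refine IsPullback.of_right (h₁₂ := pullback.snd _ _) (v₁₃ := mapRestrict l Y)
      (h₂₂ := mapPush S f) ?_ hn₁ (IsPullback.of_hasPullback _ _).flip
    rw [hn₂, mapRestrict_mapPush]
    exact (IsPullback.of_hasPullback (mapPush S' f) (mapRestrict r Y)).flip.paste_horiz
      (isPullback_mapRestrict sq Y).flip
  have h2 : IsPullback (mapRestrict b X) (relMap r f) (relMap l f) n := by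
    refine IsPullback.of_bot ?_ ?_ h1
    · rw [relMap_fst, relMap_fst]
      exact (isPullback_mapRestrict sq X).flip
    · apply pullback.hom_ext
      · rw [Category.assoc, Category.assoc, relMap_fst, hn₁, ← Category.assoc, relMap_fst,
          ← mapRestrict_comp, ← mapRestrict_comp, sq.w]
      · rw [Category.assoc, Category.assoc, relMap_snd, hn₂, ← Category.assoc, relMap_snd,
          mapRestrict_mapPush]
  exact W.of_isPullback h2 h

end RelMap

/-! ### Relative maps for subcomplexes of a simplex. -/

section RelMapSubcomplex

variable {n : ℕ} {X Y : SimplicialObject C} (f : X ⟶ Y)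
  {W : MorphismProperty (Cᵒᵖ ⥤ Type v)}

lemma relMap_of_isIso [W.ContainsIdentities] [W.RespectsIso] {S T : SSet.{v}} (j : S ⟶ T) [IsIso j] : W (relMap j f) := by
  have h1 : ∀ Z : SimplicialObject C, IsIso (mapRestrict j Z) := fun Z =>
    (mapIso (asIso j) Z).isIso_hom
  have := h1 X
  have := h1 Y
  have h2 : IsIso (relMap j f ≫ pullback.fst (mapPush S f) (mapRestrict j Y)) := by
    rw [relMap_fst]; infer_instance
  have : IsIso (relMap j f) := IsIso.of_isIso_comp_right _ (pullback.fst _ _)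
  exact W.of_isIso _

lemma isIso_mapPush_bot {Z : SSet.{v}} : IsIso (mapPush (⊥ : Z.Subcomplex).toSSet f) := by
  refine (isIso_presheaf_iff _).2 fun U => ⟨fun x y _ => ?_, fun y => ?_⟩
  · exact Subsingleton.elim (α := (⊥ : Z.Subcomplex).toSSet ⟶ points X U) x y
  · exact ⟨(default : (⊥ : Z.Subcomplex).toSSet ⟶ points X U),
      Subsingleton.elim (α := (⊥ : Z.Subcomplex).toSSet ⟶ points Y U) _ _⟩

lemma relMap_iff_mapPush [W.RespectsIso] {S T : SSet.{v}} (j : S ⟶ T) (h : IsIso (mapPush S f)) :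
    W (relMap j f) ↔ W (mapPush T f) := by
  rw [← relMap_snd f j]
  exact (W.cancel_right_of_respectsIso _ _).symm

lemma mapPush_stdSimplex (n : SimplexCategory) :
    mapPush (SSet.stdSimplex.{v}.obj n) f ≫ (mapStdSimplex n Y).hom =
      (mapStdSimplex n X).hom ≫ yoneda.map (f.app (op n)) := rfl

lemma mapPush_stdSimplex_iff [W.RespectsIso] (n : SimplexCategory) :
    W (mapPush (SSet.stdSimplex.{v}.obj n) f) ↔ W (yoneda.map (f.app (op n))) := by
  rw [← W.cancel_right_of_respectsIso _ (mapStdSimplex n Y).hom, mapPush_stdSimplex,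
    W.cancel_left_of_respectsIso]

/-- A simplicial subset of `Δ[n]` that contains all proper faces of a face meets it in its boundary. -/
lemma preimage_map_eq_boundary {m : ℕ} (g : ⦋m⦌ ⟶ ⦋n⦌) [Mono g] (t : Finset (Fin (n + 1)))
    (ht : ∀ x, x ∈ t ↔ ∃ i, g.toOrderHom i = x) (S : (Δ[n] : SSet.{v}).Subcomplex)
    (hS : ¬ SSet.stdSimplex.face t ≤ S) (hS' : ∀ t' ⊂ t, SSet.stdSimplex.face t' ≤ S) :
    S.preimage (SSet.stdSimplex.map g) = ∂Δ[m] := by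
  have hg := SimplexCategory.mono_iff_injective.1 ‹_›
  ext ⟨l⟩ x
  induction l using SimplexCategory.rec with | _ l
  rw [SSet.Subcomplex.preimage_obj, Set.mem_preimage, SSet.mem_boundary_iff_notMem_range]
  constructor
  · intro hx
    by_contra! h
    refine hS ?_
    rintro ⟨l'⟩ z hz
    induction l' using SimplexCategory.rec with | _ l'
    rw [SSet.stdSimplex.mem_face_iff] at hz
    have := map_factor ((SSet.stdSimplex.map g).app (op ⦋l⦌) x) (SSet.stdSimplex.objEquiv z) fun i => by
      obtain ⟨j, hj⟩ := (ht _).1 (hz i)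
      obtain ⟨k, rfl⟩ := h j
      exact ⟨k, hj⟩
    rw [Equiv.symm_apply_apply] at this
    rw [← this]
    exact S.map _ hx
  · rintro ⟨j, hj⟩
    refine hS' (t.erase (g.toOrderHom j)) (Finset.erase_ssubset ((ht _).2 ⟨j, rfl⟩)) _ ?_
    rw [SSet.stdSimplex.mem_face_iff]
    intro i
    refine Finset.mem_erase.2 ⟨fun h => hj ⟨i, hg h⟩, (ht _).2 ⟨x i, rfl⟩⟩

lemma relMap_sup_range_map [W.IsStableUnderBaseChange] {m : ℕ} (g : ⦋m⦌ ⟶ ⦋n⦌) [Mono g] (S : (Δ[n] : SSet.{v}).Subcomplex)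
    (hS : S.preimage (SSet.stdSimplex.map g) = ∂Δ[m])
    (h : W (relMap (∂Δ[m] : (Δ[m] : SSet.{v}).Subcomplex).ι f)) :
    W (relMap (SSet.Subcomplex.homOfLE
      (le_sup_left : S ≤ S ⊔ SSet.Subcomplex.range (SSet.stdSimplex.map g))) f) := by
  refine relMap_of_isPushout f (isPushout_attach (SSet.stdSimplex.map g) S fun l x y _ _ hxy => ?_) ?_
  · refine SSet.stdSimplex.objEquiv.injective ((cancel_mono g).1 ?_)
    exact congrArg SSet.stdSimplex.objEquiv hxy
  · rw [hS]
    exact h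

variable [W.IsMultiplicative] [W.IsStableUnderBaseChange]

/-- A minimal face of `T` outside `S` has its whole boundary in `S`, so it is attached along that
boundary. The induction is on a bound `r` for the number of missing faces. -/
lemma relMap_homOfLE_aux (N : ℕ)
    (h : ∀ m ≤ N, W (relMap (∂Δ[m] : (Δ[m] : SSet.{v}).Subcomplex).ι f))
    (T : (Δ[n] : SSet.{v}).Subcomplex)
    (hT : ∀ t, SSet.stdSimplex.face t ≤ T → t.card ≤ N + 1) (r : ℕ)
    (S : (Δ[n] : SSet.{v}).Subcomplex) (hST : S ≤ T)
    (hr : ∀ F : Finset (Finset (Fin (n + 1))), (∀ t ∈ F, SSet.stdSimplex.face t ≤ T ∧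
      ¬ SSet.stdSimplex.face t ≤ S) → F.card ≤ r) :
    W (relMap (SSet.Subcomplex.homOfLE hST) f) := by
  induction r generalizing S with
  | zero =>
    obtain ⟨F, hF⟩ := exists_eq_faceUnion T
    have hTS : T ≤ S := by
      rw [hF, faceUnion_le_iff]
      intro s hs
      by_contra hsS
      have hsT : SSet.stdSimplex.face s ≤ T := by
        rw [hF]
        exact (faceUnion_le_iff F _).1 le_rfl s hs
      have := hr {s} (by simpa using ⟨hsT, hsS⟩)
      simp at this
    obtain rfl := le_antisymm hST hTS
    have : IsIso (SSet.Subcomplex.homOfLE hST) := inferInstanceAs (IsIso (𝟙 S.toSSet))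
    exact relMap_of_isIso f _
  | succ r ih =>
    by_cases hTS : T ≤ S
    · obtain rfl := le_antisymm hST hTS
      have : IsIso (SSet.Subcomplex.homOfLE hST) := inferInstanceAs (IsIso (𝟙 S.toSSet))
      exact relMap_of_isIso f _
    have hex : ∃ t : Finset (Fin (n + 1)), SSet.stdSimplex.face t ≤ T ∧
        ¬ SSet.stdSimplex.face t ≤ S := by
      by_contra! hex
      obtain ⟨F, hF⟩ := exists_eq_faceUnion T
      refine hTS ?_
      rw [hF, faceUnion_le_iff]
      intro s hs
      refine hex s ?_
      rw [hF]
      exact (faceUnion_le_iff F _).1 le_rfl s hs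
    obtain ⟨t, ⟨htT, htS⟩, hmin⟩ := WellFounded.has_min
      (wellFounded_lt : WellFounded ((· < ·) : Finset (Fin (n + 1)) → _ → Prop))
      {t | SSet.stdSimplex.face t ≤ T ∧ ¬ SSet.stdSimplex.face t ≤ S} hex
    have hne : t.Nonempty := by
      rw [Finset.nonempty_iff_ne_empty]
      rintro rfl
      rw [SSet.stdSimplex.face_empty] at htS
      exact htS bot_le
    have hc : t.card = t.card - 1 + 1 := (Nat.sub_add_cancel hne.card_pos).symm
    let g : ⦋t.card - 1⦌ ⟶ ⦋n⦌ := SimplexCategory.mkHom (t.orderEmbOfFin hc).toOrderHom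
    have : Mono g := SimplexCategory.mono_iff_injective.2 (t.orderEmbOfFin hc).injective
    have hg : ∀ x, x ∈ t ↔ ∃ i, g.toOrderHom i = x := fun x => by
      have h1 := Set.ext_iff.1 (Finset.range_orderEmbOfFin t hc) x
      exact h1.symm
    have hSt := preimage_map_eq_boundary g t hg S htS fun t' ht' => by
      by_contra h'
      exact hmin t' ⟨(SSet.stdSimplex.face_le_face_iff _ _).2 ht'.subset |>.trans htT, h'⟩ ht'
    have h1 := relMap_sup_range_map f g S hSt (h (t.card - 1) (by have := hT t htT; omega))
    have hle : S ⊔ SSet.Subcomplex.range (SSet.stdSimplex.map g) ≤ T := by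
      refine sup_le hST ?_
      rintro ⟨l⟩ _ ⟨x, rfl⟩
      induction l using SimplexCategory.rec with | _ l
      refine htT _ ((SSet.stdSimplex.mem_face_iff _ _).2 fun i => (hg _).2 ⟨x i, rfl⟩)
    have htS' : SSet.stdSimplex.face t ≤ S ⊔ SSet.Subcomplex.range (SSet.stdSimplex.map g) := by
      refine le_sup_of_le_right ?_
      rintro ⟨l⟩ z hz
      induction l using SimplexCategory.rec with | _ l
      rw [SSet.stdSimplex.mem_face_iff] at hz
      have := factor_comp g (SSet.stdSimplex.objEquiv z) fun i => (hg _).1 (hz i)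
      refine ⟨SSet.stdSimplex.objEquiv.symm (factor g (SSet.stdSimplex.objEquiv z)
        fun i => (hg _).1 (hz i)), ?_⟩
      exact (congrArg SSet.stdSimplex.objEquiv.symm this).trans (Equiv.symm_apply_apply _ _)
    refine relMap_comp f (SSet.Subcomplex.homOfLE le_sup_left) (SSet.Subcomplex.homOfLE hle) h1
      (ih _ hle fun F hF => ?_)
    have htF : t ∉ F := fun htF => (hF t htF).2 htS'
    have := hr (insert t F) fun t' ht' => by
      obtain rfl | ht' := Finset.mem_insert.1 ht'
      · exact ⟨htT, htS⟩
      · exact ⟨(hF t' ht').1, fun h' => (hF t' ht').2 (h'.trans le_sup_left)⟩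
    rw [Finset.card_insert_of_notMem htF] at this
    omega

/-- The bound on the faces of `T` limits the boundary conditions that are needed: `∂Δ[1]` uses only
degree `0`, which avoids circularity when degree `1` is treated. -/
theorem relMap_homOfLE (N : ℕ)
    (h : ∀ m ≤ N, W (relMap (∂Δ[m] : (Δ[m] : SSet.{v}).Subcomplex).ι f))
    {S T : (Δ[n] : SSet.{v}).Subcomplex}
    (hT : ∀ t, SSet.stdSimplex.face t ≤ T → t.card ≤ N + 1) (hST : S ≤ T) :
    W (relMap (SSet.Subcomplex.homOfLE hST) f) :=
  relMap_homOfLE_aux f N h T hT _ S hST fun F _ => Finset.card_le_univ F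

theorem mapPush_subcomplex (N : ℕ)
    (h : ∀ m ≤ N, W (relMap (∂Δ[m] : (Δ[m] : SSet.{v}).Subcomplex).ι f))
    {T : (Δ[n] : SSet.{v}).Subcomplex}
    (hT : ∀ t, SSet.stdSimplex.face t ≤ T → t.card ≤ N + 1) : W (mapPush T.toSSet f) :=
  (relMap_iff_mapPush f (SSet.Subcomplex.homOfLE (bot_le : ⊥ ≤ T)) (isIso_mapPush_bot f)).1
    (relMap_homOfLE f N h hT bot_le)

end RelMapSubcomplex

/-! ### Descent of monomorphisms along covers. -/

section MonoDescent

lemma mono_presheaf_of_points {F G : Cᵒᵖ ⥤ Type v} (m : F ⟶ G)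
    (h : ∀ (U : C) (x y : yoneda.obj U ⟶ F), x ≫ m = y ≫ m → x = y) : Mono m := by
  refine (NatTrans.mono_iff_mono_app _).2 fun ⟨U⟩ => (mono_iff_injective _).2 fun x y hxy => ?_
  refine yonedaEquiv.symm.injective (h U _ _ (yonedaEquiv.injective ?_))
  rw [yonedaEquiv_comp, yonedaEquiv_comp, Equiv.apply_symm_apply, Equiv.apply_symm_apply]
  exact hxy

/-- Monomorphisms descend along covers. -/
lemma mono_of_isPullback {cover : MorphismProperty C}
    (hs : ∀ {A B : C} (f : A ⟶ B), cover f → IsEffectiveEpi f) {E F G H : Cᵒᵖ ⥤ Type v}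
    {a : E ⟶ F} {b : E ⟶ G} {q : F ⟶ H} {m : G ⟶ H} (sq : IsPullback a b q m) [Mono a]
    (hq : cover.presheaf q) (hG : G.IsRepresentable) : Mono m := by
  refine mono_presheaf_of_points m fun U x y hxy => ?_
  -- Over the pullback of the cover `q` along the common composite, `x` and `y` lift to `E` with the
  -- same image under the monomorphism `a`. They agree there, and the pullback is an epimorphism
  -- onto `U`.
  have : Epi (hq.rep.snd (x ≫ m)) := (hs _ (hq.property_snd (x ≫ m))).epi
  have w := (hq.rep.isPullback (x ≫ m)).w
  rw [← Category.assoc] at w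
  have w' : hq.rep.fst (x ≫ m) ≫ q = (yoneda.map (hq.rep.snd (x ≫ m)) ≫ y) ≫ m := by
    rw [w, Category.assoc, hxy, Category.assoc]
  have h1 : yoneda.map (hq.rep.snd (x ≫ m)) ≫ x = yoneda.map (hq.rep.snd (x ≫ m)) ≫ y := by
    rw [← sq.lift_snd _ _ w, ← sq.lift_snd _ _ w']
    congr 1
    rw [← cancel_mono a, sq.lift_fst, sq.lift_fst]
  rw [← cancel_mono G.reprW.inv]
  obtain ⟨x', hx'⟩ := yoneda.map_surjective (x ≫ G.reprW.inv)
  obtain ⟨y', hy'⟩ := yoneda.map_surjective (y ≫ G.reprW.inv)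
  rw [← hx', ← hy']
  congr 1
  rw [← cancel_epi (hq.rep.snd (x ≫ m))]
  apply yoneda.map_injective
  rw [Functor.map_comp, Functor.map_comp, hx', hy', ← Category.assoc, h1, Category.assoc]

end MonoDescent

/-! ### Functoriality of mapping spaces in the target. -/

section MapPush

variable {X Y Z : SimplicialObject C} (f : X ⟶ Y) (g : Y ⟶ Z)

lemma mapPush_comp (S : SSet.{v}) : mapPush S (f ≫ g) = mapPush S f ≫ mapPush S g := by
  refine NatTrans.ext (funext fun U => ConcreteCategory.hom_ext _ _ fun (t : S ⟶ points X U) => ?_)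
  refine NatTrans.ext (funext fun m => ConcreteCategory.hom_ext _ _ fun x => ?_)
  exact (Category.assoc (t.app m x : U.unop ⟶ X.obj m) (f.app m) (g.app m)).symm

lemma mono_mapPush (S : SSet.{v}) (hf : ∀ n, Mono (f.app n)) : Mono (mapPush S f) := by
  refine (NatTrans.mono_iff_mono_app _).2 fun U => (mono_iff_injective _).2
    fun (t t' : S ⟶ points X U) h => ?_
  refine NatTrans.ext (funext fun m => ConcreteCategory.hom_ext _ _ fun x => ?_)
  have h1 := ConcreteCategory.congr_hom (NatTrans.congr_app h m) x
  exact (hf m).right_cancellation (t.app m x : U.unop ⟶ X.obj m) (t'.app m x) h1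

lemma exists_mono_relMap_comp {S T : SSet.{v}} (j : S ⟶ T) (hg : Mono (mapPush T g)) :
    ∃ m : pullback (mapPush S f) (mapRestrict j Y) ⟶ pullback (mapPush S (f ≫ g)) (mapRestrict j Z),
      Mono m ∧ relMap j f ≫ m = relMap j (f ≫ g) := by
  obtain ⟨m, hm₁, hm₂⟩ := exists_pullback_lift (mapPush S (f ≫ g)) (mapRestrict j Z)
    (pullback.fst (mapPush S f) (mapRestrict j Y)) (pullback.snd _ _ ≫ mapPush T g) (by
      rw [mapPush_comp, ← Category.assoc, pullback.condition, Category.assoc, Category.assoc,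
        mapRestrict_mapPush])
  refine ⟨m, ⟨fun x y hxy => ?_⟩, ?_⟩
  · apply pullback.hom_ext
    · rw [← hm₁, ← Category.assoc, hxy, Category.assoc]
    · rw [← cancel_mono (mapPush T g), Category.assoc, ← hm₂, ← Category.assoc, hxy, Category.assoc,
        Category.assoc, hm₂]
  · apply pullback.hom_ext
    · rw [Category.assoc, hm₁, relMap_fst, relMap_fst]
    · rw [Category.assoc, hm₂, relMap_snd, ← Category.assoc, relMap_snd, mapPush_comp]

end MapPush

/-! ### The relative map of `K ⟶ X` as a restriction of maps to `X`. -/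

section RelMapToBase

variable {X K : SimplicialObject C} (e : ThickMapRepr X K) {n : ℕ}

lemma isPushout_attach_of_preimage_eq {Y Z : SSet.{v}} (f : Y ⟶ Z) [Mono f] (L : Z.Subcomplex)
    {A : Y.Subcomplex} (hA : L.preimage f = A) (t : A.toSSet ⟶ L.toSSet) (ht : t ≫ L.ι = A.ι ≫ f) :
    IsPushout t A.ι (SSet.Subcomplex.homOfLE (le_sup_left : L ≤ L ⊔ SSet.Subcomplex.range f))
      (SSet.Subcomplex.lift f (le_sup_right : SSet.Subcomplex.range f ≤ L ⊔ SSet.Subcomplex.range f)) := by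
  subst hA
  obtain rfl : t = L.fromPreimage f := by
    rw [← cancel_mono L.ι, ht]
    rfl
  exact isPushout_attach f L fun m x y _ _ h =>
    (mono_iff_injective _).1 ((NatTrans.mono_iff_mono_app _).1 ‹_› m) h

/-- The inclusion of a subcomplex of the standard simplex into the corresponding subcomplex of the
thick simplex. -/
def subToThick (S : (Δ[n] : SSet.{v}).Subcomplex) : S.toSSet ⟶ (thickSub S).toSSet :=
  SSet.Subcomplex.lift (S.ι ≫ toThick.app ⦋n⦌) (by
    rintro l _ ⟨x, rfl⟩
    exact (preimage_thickSub S).ge l x.2)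

/-- The thick subcomplex of `S` meets the standard simplex exactly in `S`. Maps from their union to
`X` therefore form `Map(S, K) ×_{Map(S, X)} X_n`, and maps from the whole thick simplex form `K_n`.
-/
theorem relMap_toBase_iff (W : MorphismProperty (Cᵒᵖ ⥤ Type v)) [W.RespectsIso]
    (S : (Δ[n] : SSet.{v}).Subcomplex) :
    W (relMap S.ι e.toBase) ↔
      expansion W X (thickSub S ⊔ SSet.Subcomplex.range (toThick.app ⦋n⦌)).ι := by
  have h1 := isPullback_mapRestrict (isPushout_attach_of_preimage_eq (toThick.app ⦋n⦌) (thickSub S)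
    (preimage_thickSub S) (subToThick S) rfl) X
  have h2 := (subFamily S).compare_toBase e (subToThick S) fun x => rfl
  have h3 : IsPullback (mapRestrict (SSet.Subcomplex.homOfLE
        (le_sup_left : thickSub S ≤ thickSub S ⊔ SSet.Subcomplex.range (toThick.app ⦋n⦌))) X ≫
          (subFamily S).compare e)
      (mapRestrict (SSet.Subcomplex.lift (toThick.app ⦋n⦌) le_sup_right) X)
      (mapPush S.toSSet e.toBase) (mapRestrict S.ι X) :=
    h1.of_iso (Iso.refl _) (asIso ((subFamily S).compare e)) (Iso.refl _) (Iso.refl _)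
      (by simp) (by simp) (by simpa using h2.symm) (by simp)
  have h4 : (stdFamily n).compare e ≫ relMap S.ι e.toBase =
      mapRestrict (thickSub S ⊔ SSet.Subcomplex.range (toThick.app ⦋n⦌)).ι X ≫ h3.isoPullback.hom := by
    apply pullback.hom_ext
    · rw [Category.assoc, Category.assoc, relMap_fst, h3.isoPullback_hom_fst, ← Category.assoc,
        ← mapRestrict_comp]
      exact ((subFamily S).compare_mapRestrict e (stdFamily n) S.ι (thickSub S).ι fun x => rfl).symm
    · rw [Category.assoc, Category.assoc, relMap_snd, h3.isoPullback_hom_snd, ← mapRestrict_comp]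
      exact (stdFamily n).compare_toBase e (toThick.app ⦋n⦌) fun x => rfl
  rw [expansion, ← W.cancel_right_of_respectsIso _ h3.isoPullback.hom, ← h4,
    W.cancel_left_of_respectsIso]

end RelMapToBase

/-! ### Degrees zero and one. -/

section LowDegree

lemma isIso_toThick_zero : IsIso (toThick.{v}.app ⦋0⦌) := by
  rw [NatTrans.isIso_iff_isIso_app]
  refine fun m => (isIso_iff_bijective _).2 ⟨toThick_app_injective _ m, fun w => ?_⟩
  refine ⟨SSet.stdSimplex.objEquiv.symm (SimplexCategory.mkHom ⟨fun _ => 0, fun _ _ _ => le_rfl⟩), ?_⟩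
  exact congrArg ULift.up (funext fun i => Subsingleton.elim (α := Fin 1) _ _)

lemma ThickMapRepr.isIso_toBase_zero {X K : SimplicialObject C} (e : ThickMapRepr X K) :
    IsIso (e.toBase.app (op ⦋0⦌)) := by
  have := isIso_toThick_zero.{v}
  have : IsIso (mapRestrict (toThick.app ⦋0⦌) X) := (mapIso (asIso (toThick.{v}.app ⦋0⦌)) X).isIso_hom
  have : IsIso (yoneda.map (e.toBase.app (op ⦋0⦌))) := by
    rw [e.yoneda_map_toBase]
    infer_instance
  exact isIso_of_fully_faithful yoneda _

lemma range_ι_toThick_one (i : Fin 2) :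
    SSet.Subcomplex.range ((Λ[1, i] : (Δ[1] : SSet.{v}).Subcomplex).ι ≫ toThick.app ⦋1⦌) =
      thickHorn i := by
  refine subcomplex_ext_word fun {m} w => (word_mem_range_iff _ w).trans ⟨?_, ?_⟩
  · rintro ⟨⟨y, hy⟩, rfl⟩
    obtain ⟨j, hj, h⟩ := (SSet.mem_horn_iff_notMem_range _ _).1 hy
    exact ⟨j, hj, fun a ha => h ⟨a, ha⟩⟩
  · rintro ⟨j, hj, h⟩
    have hw : ∀ a, w a = i := fun a => by
      have : w a ≠ j := h a
      omega
    refine ⟨⟨SSet.stdSimplex.objEquiv.symm (SimplexCategory.mkHom ⟨fun _ => i, fun _ _ _ => le_rfl⟩),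
      (SSet.mem_horn_iff_notMem_range _ _).2 ⟨j, hj, ?_⟩⟩, funext fun a => (hw a).symm⟩
    rintro ⟨a, ha⟩
    exact hj ha.symm

lemma card_le_of_face_le_boundary {n : ℕ} (t : Finset (Fin (n + 1)))
    (h : SSet.stdSimplex.face.{v} t ≤ ∂Δ[n]) : t.card ≤ n := by
  by_contra! hn
  have ht : t = Finset.univ :=
    Finset.eq_univ_of_card t (le_antisymm (Finset.card_le_univ t) (by simpa using hn))
  rw [ht, SSet.stdSimplex.face_univ] at h
  exact (h.trans_lt (SSet.boundary_lt_top n)).false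

end LowDegree

/-! ### The image is a `k`-groupoid and the coimage a hypercover. -/

section Image

variable {cover regular : MorphismProperty C} {k : ℕ} {X K : SimplicialObject C}
  (hC : IsRegularDescentCategory cover regular) (hX : IsRegularKCategory cover regular k X)
  (e : ThickMapRepr X K)

include hC hX e

theorem IsRegularKCategory.expansion_horn_thickMapRepr {n : ℕ} (hn : 0 < n) (i : Fin (n + 1)) :
    expansion cover.presheaf K (Λ[n, i] : (Δ[n] : SSet.{v}).Subcomplex).ι := by
  have := hC.hasFiniteLimits
  have := hC.stableUnderBaseChange
  rw [expansion_ι_thickSub_iff e, thickSub_horn]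
  -- For `n = 1` the thick horn is a vertex, and the claim is the axiom `cover_vertex`.
  obtain rfl | hn := (Nat.succ_le_of_lt hn).eq_or_lt
  · have : Mono ((Λ[1, i] : (Δ[1] : SSet.{v}).Subcomplex).ι ≫ toThick.app ⦋1⦌) := mono_comp _ _
    have h1 := (representedBy_iff.1 (hX.cover_vertex i)).1
    exact range_ι_toThick_one i ▸ (expansion_range_iff _ _ _).2 h1
  · exact hX.expansion_thickHorn hC.toIsDescentCategory hn i

theorem IsRegularKCategory.relMap_boundary_toBase (hk : 0 < k) {n : ℕ} (hn : 2 ≤ n) :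
    cover.presheaf (relMap (∂Δ[n] : (Δ[n] : SSet.{v}).Subcomplex).ι e.toBase) := by
  have := hC.stableUnderBaseChange
  refine (relMap_toBase_iff e cover.presheaf _).2 ?_
  rw [thickSub_boundary_sup_range]
  exact hX.expansion_ledSub hC hk hn

variable {G : SimplicialObject C} {p : K ⟶ G} {i : G ⟶ X}
  (h : ∀ n : SimplexCategoryᵒᵖ, IsImageFactorization (e.toBase.app n) (p.app n) (i.app n))

include h

lemma mapPush_stdSimplex_cover (n : SimplexCategory) :
    cover.presheaf (mapPush (SSet.stdSimplex.{v}.obj n) p) := by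
  have := hC.hasFiniteLimits
  have := hC.stableUnderBaseChange
  refine (mapPush_stdSimplex_iff p n).2 ?_
  exact MorphismProperty.relative_map ((h _).1.isCover hC (e.regular_toBase hC hX _))

/-- The thick `0`-simplex is a point, so `K_0 ≅ X_0`. Hence `p` is a monomorphism in degree `0`, as
well as a regular epimorphism. -/
lemma isIso_imageFactorization_zero : IsIso (p.app (op ⦋0⦌)) := by
  have hi := (h (op ⦋0⦌)).mono hC (e.regular_toBase hC hX _)
  have hp := (h (op ⦋0⦌)).1.regularEpi
  have := e.isIso_toBase_zero
  rw [← (h (op ⦋0⦌)).2] at this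
  have : Mono (p.app (op ⦋0⦌)) := mono_of_mono _ (i.app (op ⦋0⦌))
  exact isIso_of_mono_of_strongEpi _

lemma isIso_mapPush_boundary_one :
    IsIso (mapPush (∂Δ[1] : (Δ[1] : SSet.{v}).Subcomplex).toSSet p) := by
  refine mapPush_subcomplex (W := .isomorphisms _) p 0 (fun m hm => ?_)
    fun t ht => card_le_of_face_le_boundary t ht
  obtain rfl := Nat.le_zero.1 hm
  refine (relMap_iff_mapPush p _ (by rw [SSet.boundary_zero]; exact isIso_mapPush_bot p)).2 ?_
  refine (mapPush_stdSimplex_iff (W := .isomorphisms _) p _).2 ?_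
  have := isIso_imageFactorization_zero hC hX e h
  exact (inferInstance : IsIso (yoneda.map (p.app (op ⦋0⦌))))

/-- For `n ≥ 2` the relative map of `K ⟶ X` is a cover and is that of `p` followed by a
monomorphism, which must be invertible. For `n ≤ 1` the map `p` is invertible on the boundary, so
only the cover `p` in degree `n` remains. -/
lemma relMap_boundary_cover (hk : 0 < k) (n : ℕ) :
    cover.presheaf (relMap (∂Δ[n] : (Δ[n] : SSet.{v}).Subcomplex).ι p) := by
  have := hC.hasFiniteLimits
  have := hC.stableUnderBaseChange
  obtain rfl | rfl | hn : n = 0 ∨ n = 1 ∨ 2 ≤ n := by omega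
  · exact (relMap_iff_mapPush p _ (by rw [SSet.boundary_zero]; exact isIso_mapPush_bot p)).2
      (mapPush_stdSimplex_cover hC hX e h _)
  · exact (relMap_iff_mapPush p _ (isIso_mapPush_boundary_one hC hX e h)).2
      (mapPush_stdSimplex_cover hC hX e h _)
  · have hi := mono_mapPush i Δ[n] fun m => (h m).mono hC (e.regular_toBase hC hX _)
    obtain ⟨m, hm, hpm⟩ := exists_mono_relMap_comp p i
      (∂Δ[n] : (Δ[n] : SSet.{v}).Subcomplex).ι hi
    have hpi : p ≫ i = e.toBase := NatTrans.ext (funext fun n => (h n).2)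
    have h1 := hX.relMap_boundary_toBase hC e hk hn
    rw [← hpi, ← hpm] at h1
    have h2 : ∀ {Y Z : SimplicialObject C} (f : Y ⟶ Z), (pullback
        (mapPush (∂Δ[n] : (Δ[n] : SSet.{v}).Subcomplex).toSSet f)
        (mapRestrict (∂Δ[n] : (Δ[n] : SSet.{v}).Subcomplex).ι Z)).IsRepresentable := fun f =>
      isRepresentable_of_isPullback (IsPullback.of_hasPullback _ _)
        (isRepresentable_mapSpace_subcomplex _ _) (isRepresentable_mapStdSimplex _ _)
        (isRepresentable_mapSpace_subcomplex _ _)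
    have := isIso_of_presheaf_comp_mono hC.toIsDescentCategory hC.subcanonical _ m h1 (h2 p) (h2 _)
    exact (cover.presheaf.cancel_right_of_respectsIso _ m).1 h1

theorem isHypercover_imageFactorization (hk : 0 < k) : IsHypercover cover p := fun n => by
  have := hC.hasFiniteLimits
  have := hC.stableUnderBaseChange
  exact representedBy_iff.2 ⟨relMap_boundary_cover hC hX e h hk n,
    isRepresentable_of_isPullback (IsPullback.of_hasPullback _ _)
      (isRepresentable_mapSpace_subcomplex _ _) (isRepresentable_mapStdSimplex _ _)
      (isRepresentable_mapSpace_subcomplex _ _)⟩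

/-- The composite `K_n ⟶ Map(Λ, K) ⟶ Map(Λ, G)` consists of covers and equals `K_n ⟶ G_n ⟶ Map(Λ,
G)`, whose first map is a cover; this cover is cancelled. -/
lemma expansion_horn_imageFactorization (hk : 0 < k) {n : ℕ} (hn : 0 < n) (j : Fin (n + 1)) :
    cover.presheaf (mapRestrict (Λ[n, j] : (Δ[n] : SSet.{v}).Subcomplex).ι G) := by
  have := hC.hasFiniteLimits
  have := hC.multiplicative
  have := hC.stableUnderBaseChange
  refine presheaf_cancel hC.toIsDescentCategory (mapPush Δ[n] p) _
    (mapPush_stdSimplex_cover hC hX e h _) ?_ (isRepresentable_mapStdSimplex _ _)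
    (isRepresentable_mapSpace_subcomplex _ _)
  rw [← mapRestrict_mapPush]
  exact cover.presheaf.comp_mem _ _ (hX.expansion_horn_thickMapRepr hC e hn j)
    (mapPush_subcomplex p n (fun m _ => relMap_boundary_cover hC hX e h hk m)
      fun t _ => by simpa using Finset.card_le_univ t)

/-- As `K_n ≅ Map(Λ, K)`, the cover `K_n ⟶ Map(Λ, K) ×_{Map(Λ, G)} G_n` is a monomorphism, hence
invertible. The base change of `G_n ⟶ Map(Λ, G)` along the cover `Map(Λ, K) ⟶ Map(Λ, G)` is then
invertible, so `G_n ⟶ Map(Λ, G)` is a monomorphism by descent, and it is a cover. -/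
lemma isIso_horn_imageFactorization (hk : 0 < k) {n : ℕ} (hn : k < n) (j : Fin (n + 1)) :
    IsIso (mapRestrict (Λ[n, j] : (Δ[n] : SSet.{v}).Subcomplex).ι G) := by
  have := hC.hasFiniteLimits
  have := hC.multiplicative
  have := hC.stableUnderBaseChange
  have hK : IsIso (mapRestrict (Λ[n, j] : (Δ[n] : SSet.{v}).Subcomplex).ι K) := by
    have h1 : expansion (.isomorphisms _) K (Λ[n, j] : (Δ[n] : SSet.{v}).Subcomplex).ι := by
      rw [expansion_ι_thickSub_iff e, thickSub_horn]
      exact hX.isomorphisms_thickHorn (by omega) hn j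
    exact h1
  have hB := fun m (_ : m ≤ n) => relMap_boundary_cover hC hX e h hk m
  have hL : cover.presheaf (mapPush (Λ[n, j] : (Δ[n] : SSet.{v}).Subcomplex).toSSet p) :=
    mapPush_subcomplex p n hB fun t _ => by simpa using Finset.card_le_univ t
  have hR : cover.presheaf (relMap (Λ[n, j] : (Δ[n] : SSet.{v}).Subcomplex).ι p) :=
    relMap_comp p (SSet.Subcomplex.homOfLE le_top) (⊤ : (Δ[n] : SSet.{v}).Subcomplex).ι
      (relMap_homOfLE p n hB (fun t _ => by simpa using Finset.card_le_univ t) le_top)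
      (relMap_of_isIso p _)
  have sq := IsPullback.of_hasPullback (mapPush (Λ[n, j] : (Δ[n] : SSet.{v}).Subcomplex).toSSet p)
    (mapRestrict (Λ[n, j] : (Δ[n] : SSet.{v}).Subcomplex).ι G)
  have hfst := relMap_fst p (Λ[n, j] : (Δ[n] : SSet.{v}).Subcomplex).ι
  rw [← hfst] at hK
  have : Mono (relMap (Λ[n, j] : (Δ[n] : SSet.{v}).Subcomplex).ι p) :=
    mono_of_mono _ (pullback.fst _ _)
  have : IsIso (relMap (Λ[n, j] : (Δ[n] : SSet.{v}).Subcomplex).ι p) :=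
    isIso_of_presheaf_mono hC.toIsDescentCategory hC.subcanonical _ hR
      (isRepresentable_of_isPullback sq (isRepresentable_mapSpace_subcomplex _ _)
        (isRepresentable_mapStdSimplex _ _) (isRepresentable_mapSpace_subcomplex _ _))
  have : IsIso (pullback.fst (mapPush (Λ[n, j] : (Δ[n] : SSet.{v}).Subcomplex).toSSet p)
    (mapRestrict (Λ[n, j] : (Δ[n] : SSet.{v}).Subcomplex).ι G)) :=
    IsIso.of_isIso_comp_left (relMap (Λ[n, j] : (Δ[n] : SSet.{v}).Subcomplex).ι p) _
  have := mono_of_isPullback hC.subcanonical sq hL (isRepresentable_mapStdSimplex _ _)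
  exact isIso_of_presheaf_mono hC.toIsDescentCategory hC.subcanonical _
    (expansion_horn_imageFactorization hC hX e h hk (by omega) j)
    (isRepresentable_mapSpace_subcomplex _ _)

theorem isKGroupoid_imageFactorization (hk : 0 < k) : IsKGroupoid cover k G where
  cover_horn n j hn := by
    have := hC.hasFiniteLimits
    have := hC.stableUnderBaseChange
    exact representedBy_iff.2 ⟨expansion_horn_imageFactorization hC hX e h hk hn j,
      isRepresentable_mapSpace_subcomplex _ _⟩
  iso_horn _ j _ hn := isIso_horn_imageFactorization hC hX e h hk hn j

end Image

end DescentCat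

theorem mainTheorem5 {C : Type u} [Category.{v} C] (cover regular : MorphismProperty C)
    (hC : IsRegularDescentCategory cover regular) (k : ℕ) (hk : 0 < k)
    (X : SimplicialObject C) (hX : IsRegularKCategory cover regular k X) :
    (∃ K : SimplicialObject C, Nonempty (ThickMapRepr X K)) ∧
    ∀ (K : SimplicialObject C) (e : ThickMapRepr X K),
      (∀ n : SimplexCategoryᵒᵖ, regular (e.toBase.app n)) ∧
      (∃ (G : SimplicialObject C) (p : K ⟶ G) (i : G ⟶ X),
        ∀ n : SimplexCategoryᵒᵖ, IsImageFactorization (e.toBase.app n) (p.app n) (i.app n)) ∧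
      ∀ (G : SimplicialObject C) (p : K ⟶ G) (i : G ⟶ X),
        (∀ n : SimplexCategoryᵒᵖ, IsImageFactorization (e.toBase.app n) (p.app n) (i.app n)) →
        IsKGroupoid cover k G ∧ IsHypercover cover p := by
  refine ⟨exists_thickMapRepr fun n => hX.isRepresentable_mapSpace_thick hC n, fun K e => ?_⟩
  refine ⟨e.regular_toBase hC hX, exists_imageFactorization hC _ (e.regular_toBase hC hX),
    fun G p i h => ?_⟩
  exact ⟨isKGroupoid_imageFactorization hC hX e h hk, isHypercover_imageFactorization hC hX e h hk⟩
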